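/- Let $N$ be a von Neumann algebra acting on a Hilbert space $H$, let $J\subseteq N$ be a norm closed two-sided ideal, and let $\pi:N\to N/J$ be the quotient map. Let $\partial:K_1(N/J)\to K_0(J)$ be the boundary (index) map of the extension $0\to J\to N\to N/J\to 0$, with the sign convention $\partial[\pi(v)]=[1-v^*v]-[1-vv^*]$ when $v$ is a partial isometry over $N$ and $\pi(v)$ is unitary. *Index.* For projections $p,q\in N$, an operator $S\in qNp$ is $(q\text{-}p)$-Fredholm if there are $T,R\in pNq$ with $\pi(TS)=\pi(p)$ and $\pi(SR)=\pi(q)$; its index is $$\mathrm{Ind}_{(q\text{-}p)}(S)=[N(S)\cap p]-[N(S^*)\cap q]\in K_0(J),$$ where $N(S)$ is the projection onto $\ker S$ and $p\cap q$ denotes the projection onto $\mathrm{Im}(p)\cap\mathrm{Im}(q)$. *Spectral flow.* Let $\chi$ be the indicator function of $[0,\infty)$. For a norm continuous path $(B_t)_{t\in[0,1]}$ of self-adjoint elements of $N$ with every $\pi(B_t)$ invertible, choose $0=t_0<t_1<\dots<t_n=1$ such that $\|\pi(\chi(B_t))-\pi(\chi(B_s))\|<1/2$ for all $s,t\in[t_{i-1},t_i]$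 and all $i$, put $p_i=\chi(B_{t_i})$, and set $$\mathrm{sf}\{B_t\}=\sum_{i=1}^n\big([(1-p_i)\cap p_{i-1}]-[(1-p_{i-1})\cap p_i]\big)\in K_0(J),$$ which does not depend on the partition. For a self-adjoint operator $\mathcal D$ put $F_{\mathcal D}=\mathcal D(1+\mathcal D^2)^{-1/2}$. For a path $\mathcal D_t=\mathcal D+A_t$, with $(A_t)$ a norm continuous path of self-adjoint elements of $N$, put $\mathrm{sf}\{\mathcal D_t\}=\mathrm{sf}\{F_{\mathcal D_t}\}$. *Spectral triple.* Let $(\mathcal A,H,\mathcal D)$ be a unital von Neumann spectral triple relative to $(N,J)$: $\mathcal A$ is a $*$-algebra represented in $N$ with the unit of $N$ in its image, and $\mathcal D$ is a self-adjoint operator on $H$ affiliated to $N$ such that, for every $a\in\mathcal A$, $a$ maps $\mathrm{Dom}(\mathcal D)$ into itself, $[\mathcal D,a]$ extends from $\mathrm{Dom}(\mathcal D)$ to a bounded operator on $H$, and $a(\lambda-\mathcal D)^{-1}\in J$ for all $\lambda\in\mathbb C\setminus\mathbb R$. Let $u\in\mathcal A$ be unitary in $N$. **Theorem.** Put $\mathcal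 D_t=(1-t)\mathcal D+t\,u^*\mathcal D u$ for $t\in[0,1]$, $p=\chi(F_{\mathcal D})$ and $p_F=\tfrac12(F_{\mathcal D}+1)$. Then $\mathcal D_t=\mathcal D+A_t$ for a norm continuous path $(A_t)$ of self-adjoint elements of $N$, the spectral flow of $(\mathcal D_t)$ is defined, the elements $\pi(pup)+\pi(1-p)$ and $\pi(p_Fup_F+1-p_F)$ of $N/J$ are invertible, $pup$ is $(p\text{-}p)$-Fredholm, and in $K_0(J)$ $$\mathrm{sf}\{\mathcal D_t\}=\mathrm{sf}\{F_{\mathcal D_t}\}=\partial\big[\pi(pup)+\pi(1-p)\big]=\mathrm{Ind}_{(p\text{-}p)}(pup)=\partial\big[\pi(p_Fup_F+1-p_F)\big].$$ -/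

import Mathlib

namespace VNSpectralFlow

open Matrix

/-! ## `K`-theory -/

section KZero

/-- Algebraic equivalence of idempotent matrices (of possibly different sizes): `e = x y` and
`f = y x` for some rectangular matrices `x`, `y`. -/
def MatEquiv {R : Type*} [Ring R] {ι κ : Type*} [Fintype ι] [Fintype κ]
    (e : Matrix ι ι R) (f : Matrix κ κ R) : Prop :=
  ∃ (x : Matrix ι κ R) (y : Matrix κ ι R), x * y = e ∧ y * x = f

/-- An idempotent matrix of arbitrary finite size over `R`. -/
structure IdemMat (R : Type*) [Ring R] where
  size : ℕ
  mat : Matrix (Fin size) (Fin size) R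
  idem : IsIdempotentElem mat

lemma isIdempotentElem_reindex {R : Type*} [Ring R] {ι κ : Type*} [Fintype ι] [Fintype κ]
    (σ : ι ≃ κ) {e : Matrix ι ι R} (he : IsIdempotentElem e) :
    IsIdempotentElem (Matrix.reindex σ σ e) := by
  unfold IsIdempotentElem at *
  simp only [Matrix.reindex_apply]
  rw [Matrix.submatrix_mul_equiv, he]

lemma isIdempotentElem_fromBlocks {R : Type*} [Ring R] {ι κ : Type*} [Fintype ι] [Fintype κ]
    {e : Matrix ι ι R} {f : Matrix κ κ R} (he : IsIdempotentElem e) (hf : IsIdempotentElem f) :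
    IsIdempotentElem (Matrix.fromBlocks e 0 0 f) := by
  unfold IsIdempotentElem at *
  simp [Matrix.fromBlocks_multiply, he, hf]

/-- An idempotent matrix indexed by any finite type, seen as one indexed by `Fin n`. -/
noncomputable def IdemMat.of {R : Type*} [Ring R] {ι : Type*} [Fintype ι]
    (e : Matrix ι ι R) (he : IsIdempotentElem e) : IdemMat R :=
  ⟨Fintype.card ι, Matrix.reindex (Fintype.equivFin ι) (Fintype.equivFin ι) e,
    isIdempotentElem_reindex _ he⟩

/-- The block sum `diag(e, f)` of two idempotent matrices. -/
noncomputable def IdemMat.sum {R : Type*} [Ring R] (e f : IdemMat R) : IdemMat R :=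
  IdemMat.of (Matrix.fromBlocks e.mat 0 0 f.mat) (isIdempotentElem_fromBlocks e.idem f.idem)

/-- The relations defining `K₀` of a unital ring: equivalent idempotents are identified, and the
block sum is the sum. -/
def kZeroRel (R : Type*) [Ring R] : AddSubgroup (FreeAbelianGroup (IdemMat R)) :=
  AddSubgroup.closure
    ({x | ∃ e f : IdemMat R, MatEquiv e.mat f.mat ∧
        x = FreeAbelianGroup.of e - FreeAbelianGroup.of f} ∪
      {x | ∃ e f : IdemMat R,
        x = FreeAbelianGroup.of (e.sum f) - (FreeAbelianGroup.of e + FreeAbelianGroup.of f)})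

/-- `K₀` of a unital ring: the Grothendieck group of the monoid of equivalence classes of
idempotent matrices under block sum, presented by generators and relations. -/
def KZeroUnital (R : Type*) [Ring R] : Type _ := FreeAbelianGroup (IdemMat R) ⧸ kZeroRel R

noncomputable instance (R : Type*) [Ring R] : AddCommGroup (KZeroUnital R) :=
  inferInstanceAs (AddCommGroup (FreeAbelianGroup (IdemMat R) ⧸ kZeroRel R))

/-- The quotient map from the free abelian group on idempotent matrices onto `K₀`. -/
noncomputable def KZeroUnital.proj (R : Type*) [Ring R] :
    FreeAbelianGroup (IdemMat R) →+ KZeroUnital R :=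
  QuotientAddGroup.mk' (kZeroRel R)

lemma KZeroUnital.proj_eq_zero {R : Type*} [Ring R] {x : FreeAbelianGroup (IdemMat R)}
    (hx : x ∈ kZeroRel R) : KZeroUnital.proj R x = 0 :=
  (QuotientAddGroup.eq_zero_iff x).2 hx

/-- The class in `K₀(R)` of an idempotent matrix over `R`. -/
noncomputable def KZeroUnital.mk {R : Type*} [Ring R] {ι : Type*} [Fintype ι]
    (e : Matrix ι ι R) (he : IsIdempotentElem e) : KZeroUnital R :=
  KZeroUnital.proj R (FreeAbelianGroup.of (IdemMat.of e he))

lemma matEquiv_reindex {R : Type*} [Ring R] {ι κ ι' κ' : Type*} [Fintype ι] [Fintype κ]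
    [Fintype ι'] [Fintype κ'] (σ : ι ≃ ι') (τ : κ ≃ κ') {e : Matrix ι ι R} {f : Matrix κ κ R}
    (h : MatEquiv e f) : MatEquiv (Matrix.reindex σ σ e) (Matrix.reindex τ τ f) := by
  obtain ⟨x, y, rfl, rfl⟩ := h
  refine ⟨Matrix.reindex σ τ x, Matrix.reindex τ σ y, ?_, ?_⟩ <;>
  simp only [Matrix.reindex_apply] <;> rw [Matrix.submatrix_mul_equiv]

lemma matEquiv_refl {R : Type*} [Ring R] {ι : Type*} [Fintype ι] {e : Matrix ι ι R}
    (he : IsIdempotentElem e) : MatEquiv e e := ⟨e, e, he, he⟩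

lemma matEquiv_reindex_self {R : Type*} [Ring R] {ι κ : Type*} [Fintype ι] [Fintype κ]
    (σ : ι ≃ κ) {e : Matrix ι ι R} (he : IsIdempotentElem e) :
    MatEquiv e (Matrix.reindex σ σ e) := by
  simpa using matEquiv_reindex (Equiv.refl ι) σ (matEquiv_refl he)

lemma KZeroUnital.mk_eq_of_matEquiv {R : Type*} [Ring R] {ι κ : Type*} [Fintype ι] [Fintype κ]
    {e : Matrix ι ι R} {f : Matrix κ κ R} (he : IsIdempotentElem e) (hf : IsIdempotentElem f)
    (h : MatEquiv e f) : KZeroUnital.mk e he = KZeroUnital.mk f hf := by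
  unfold KZeroUnital.mk
  rw [← sub_eq_zero, ← map_sub]
  apply KZeroUnital.proj_eq_zero
  exact AddSubgroup.subset_closure (Or.inl ⟨_, _, matEquiv_reindex _ _ h, rfl⟩)

lemma KZeroUnital.of_eq_mk {R : Type*} [Ring R] (e : IdemMat R) :
    KZeroUnital.proj R (FreeAbelianGroup.of e) =
      KZeroUnital.mk e.mat e.idem := by
  unfold KZeroUnital.mk
  rw [← sub_eq_zero, ← map_sub]
  apply KZeroUnital.proj_eq_zero
  exact AddSubgroup.subset_closure (Or.inl ⟨_, _, matEquiv_reindex_self _ e.idem, rfl⟩)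

lemma matEquiv_fromBlocks {R : Type*} [Ring R] {ι κ ι' κ' : Type*} [Fintype ι] [Fintype κ]
    [Fintype ι'] [Fintype κ'] {e : Matrix ι ι R} {f : Matrix κ κ R} {e' : Matrix ι' ι' R}
    {f' : Matrix κ' κ' R} (h : MatEquiv e e') (h' : MatEquiv f f') :
    MatEquiv (Matrix.fromBlocks e 0 0 f) (Matrix.fromBlocks e' 0 0 f') := by
  obtain ⟨x, y, rfl, rfl⟩ := h
  obtain ⟨x', y', rfl, rfl⟩ := h'
  exact ⟨Matrix.fromBlocks x 0 0 x', Matrix.fromBlocks y 0 0 y',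
    by simp [Matrix.fromBlocks_multiply], by simp [Matrix.fromBlocks_multiply]⟩

lemma KZeroUnital.mk_fromBlocks {R : Type*} [Ring R] {ι κ : Type*} [Fintype ι] [Fintype κ]
    {e : Matrix ι ι R} {f : Matrix κ κ R} (he : IsIdempotentElem e) (hf : IsIdempotentElem f) :
    KZeroUnital.mk (Matrix.fromBlocks e 0 0 f) (isIdempotentElem_fromBlocks he hf) =
      KZeroUnital.mk e he + KZeroUnital.mk f hf := by
  have h1 : KZeroUnital.mk (Matrix.fromBlocks e 0 0 f) (isIdempotentElem_fromBlocks he hf) =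
      KZeroUnital.proj R (FreeAbelianGroup.of ((IdemMat.of e he).sum (IdemMat.of f hf))) := by
    rw [KZeroUnital.of_eq_mk]
    apply KZeroUnital.mk_eq_of_matEquiv
    refine Eq.mp ?_ (matEquiv_reindex (Equiv.refl _)
      (Fintype.equivFin (Fin (Fintype.card ι) ⊕ Fin (Fintype.card κ)))
      (matEquiv_fromBlocks (matEquiv_reindex_self (Fintype.equivFin ι) he)
        (matEquiv_reindex_self (Fintype.equivFin κ) hf)))
    simp only [Matrix.reindex_apply, Equiv.refl_symm, Equiv.coe_refl, Matrix.submatrix_id_id]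
    rfl
  rw [h1]
  unfold KZeroUnital.mk
  rw [← map_add, ← sub_eq_zero, ← map_sub]
  apply KZeroUnital.proj_eq_zero
  exact AddSubgroup.subset_closure (Or.inr ⟨_, _, rfl⟩)

lemma KZeroUnital.mk_zero {R : Type*} [Ring R] {ι : Type*} [Fintype ι] :
    KZeroUnital.mk (0 : Matrix ι ι R) (by simp [IsIdempotentElem]) = 0 := by
  have h0 : IsIdempotentElem (0 : Matrix ι ι R) := by simp [IsIdempotentElem]
  have h := KZeroUnital.mk_fromBlocks h0 h0
  have h2 : KZeroUnital.mk (Matrix.fromBlocks (0 : Matrix ι ι R) 0 0 (0 : Matrix ι ι R))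
      (isIdempotentElem_fromBlocks h0 h0) = KZeroUnital.mk (0 : Matrix ι ι R) h0 :=
    KZeroUnital.mk_eq_of_matEquiv _ _ ⟨0, 0, by simp [Matrix.fromBlocks_zero], by simp⟩
  rw [h2] at h
  simpa using h

lemma isIdempotentElem_mapMatrix {R S : Type*} [Ring R] [Ring S] (φ : R →+* S) {ι : Type*}
    [Fintype ι] {e : Matrix ι ι R} (he : IsIdempotentElem e) :
    IsIdempotentElem (e.map φ) := by
  unfold IsIdempotentElem at *
  rw [← Matrix.map_mul, he]

lemma matEquiv_map {R S : Type*} [Ring R] [Ring S] (φ : R →+* S) {ι κ : Type*} [Fintype ι]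
    [Fintype κ] {e : Matrix ι ι R} {f : Matrix κ κ R} (h : MatEquiv e f) :
    MatEquiv (e.map φ) (f.map φ) := by
  obtain ⟨x, y, rfl, rfl⟩ := h
  exact ⟨x.map φ, y.map φ, by rw [Matrix.map_mul], by rw [Matrix.map_mul]⟩

/-- Functoriality of `K₀` for unital rings: `[e] ↦ [φ(e)]`. -/
noncomputable def KZeroUnital.map {R S : Type*} [Ring R] [Ring S] (φ : R →+* S) :
    KZeroUnital R →+ KZeroUnital S :=
  QuotientAddGroup.lift (kZeroRel R)
    (FreeAbelianGroup.lift fun e : IdemMat R =>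
      KZeroUnital.mk (e.mat.map φ) (isIdempotentElem_mapMatrix φ e.idem)) (by
    refine (AddSubgroup.closure_le _).2 ?_
    rintro x (⟨e, f, h, rfl⟩ | ⟨e, f, rfl⟩)
    · simp only [SetLike.mem_coe, AddMonoidHom.mem_ker, map_sub, FreeAbelianGroup.lift_apply_of]
      rw [sub_eq_zero]
      exact KZeroUnital.mk_eq_of_matEquiv _ _ (matEquiv_map φ h)
    · simp only [SetLike.mem_coe, AddMonoidHom.mem_ker, map_sub, map_add,
        FreeAbelianGroup.lift_apply_of]
      rw [sub_eq_zero, ← KZeroUnital.mk_fromBlocks]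
      apply KZeroUnital.mk_eq_of_matEquiv
      have h := matEquiv_reindex (Fintype.equivFin (Fin e.size ⊕ Fin f.size)) (Equiv.refl _)
        (matEquiv_refl (isIdempotentElem_fromBlocks (isIdempotentElem_mapMatrix φ e.idem)
          (isIdempotentElem_mapMatrix φ f.idem)))
      refine Eq.mp ?_ h
      congr 1
      have h3 : Matrix.fromBlocks (e.mat.map φ) 0 0 (f.mat.map φ) =
          (Matrix.fromBlocks e.mat 0 0 f.mat).map φ := by
        rw [Matrix.fromBlocks_map]; simp
      rw [h3]
      rfl)

lemma KZeroUnital.map_mk {R S : Type*} [Ring R] [Ring S] (φ : R →+* S) {ι : Type*} [Fintype ι]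
    (e : Matrix ι ι R) (he : IsIdempotentElem e) :
    KZeroUnital.map φ (KZeroUnital.mk e he) =
      KZeroUnital.mk (e.map φ) (isIdempotentElem_mapMatrix φ he) := by
  have h : KZeroUnital.map φ (KZeroUnital.mk e he) =
      KZeroUnital.mk ((IdemMat.of e he).mat.map φ)
        (isIdempotentElem_mapMatrix φ (IdemMat.of e he).idem) := by
    change FreeAbelianGroup.lift _ (FreeAbelianGroup.of (IdemMat.of e he)) = _
    rw [FreeAbelianGroup.lift_apply_of]
  rw [h]
  apply KZeroUnital.mk_eq_of_matEquiv
  refine Eq.mp ?_ (matEquiv_reindex (Fintype.equivFin ι) (Equiv.refl ι)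
    (matEquiv_refl (isIdempotentElem_mapMatrix φ he)))
  rfl

/-- `K₀` of a possibly non-unital complex algebra `B`: the kernel of the map
`K₀(B⁺) → K₀(ℂ)` induced by the augmentation `B⁺ = ℂ ⊕ B → ℂ`. -/
noncomputable abbrev KZero (B : Type*) [NonUnitalRing B] [Module ℂ B] [IsScalarTower ℂ B B]
    [SMulCommClass ℂ B B] : AddSubgroup (KZeroUnital (Unitization ℂ B)) :=
  (KZeroUnital.map (Unitization.fstHom ℂ B : Unitization ℂ B →+* ℂ)).ker

/-- The class `[e] ∈ K₀(B)` of an idempotent `e ∈ B`. -/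
noncomputable def KZero.ofIdem {B : Type*} [NonUnitalRing B] [Module ℂ B] [IsScalarTower ℂ B B]
    [SMulCommClass ℂ B B] (e : B) (he : IsIdempotentElem e) : KZero B :=
  ⟨KZeroUnital.mk (Matrix.scalar (Fin 1) (e : Unitization ℂ B)) (by
      unfold IsIdempotentElem at *
      rw [← map_mul, ← Unitization.inr_mul, he]), by
    rw [AddMonoidHom.mem_ker, KZeroUnital.map_mk]
    rw [← KZeroUnital.mk_zero (R := ℂ) (ι := Fin 1)]
    apply KZeroUnital.mk_eq_of_matEquiv
    refine ⟨0, 0, ?_, by simp⟩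
    ext i j
    fin_cases i; fin_cases j
    simp⟩

end KZero

section KOne

/-- An invertible matrix of arbitrary finite size over `R`. -/
structure InvMat (R : Type*) [Ring R] where
  size : ℕ
  mat : (Matrix (Fin size) (Fin size) R)ˣ

/-- The block sum `diag(u, v)` of two invertible matrices. -/
def blockUnit {R : Type*} [Ring R] {ι κ : Type*} [Fintype ι] [Fintype κ] [DecidableEq ι]
    [DecidableEq κ] (u : (Matrix ι ι R)ˣ) (v : (Matrix κ κ R)ˣ) :
    (Matrix (ι ⊕ κ) (ι ⊕ κ) R)ˣ where
  val := Matrix.fromBlocks u.val 0 0 v.val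
  inv := Matrix.fromBlocks u.inv 0 0 v.inv
  val_inv := by simp [Matrix.fromBlocks_multiply]
  inv_val := by simp [Matrix.fromBlocks_multiply]

/-- Reindexing of invertible matrices. -/
def reindexUnit {R : Type*} [Ring R] {ι κ : Type*} [Fintype ι] [Fintype κ] [DecidableEq ι]
    [DecidableEq κ] (σ : ι ≃ κ) (u : (Matrix ι ι R)ˣ) : (Matrix κ κ R)ˣ where
  val := Matrix.reindex σ σ u.val
  inv := Matrix.reindex σ σ u.inv
  val_inv := by simp only [Matrix.reindex_apply]; rw [Matrix.submatrix_mul_equiv]; simp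
  inv_val := by simp only [Matrix.reindex_apply]; rw [Matrix.submatrix_mul_equiv]; simp

/-- The block sum `diag(u, v)` of two invertible matrices. -/
def InvMat.sum {R : Type*} [Ring R] (u v : InvMat R) : InvMat R :=
  ⟨u.size + v.size, reindexUnit finSumFinEquiv (blockUnit u.mat v.mat)⟩

/-- The relations defining `K₁` of a unital Banach algebra: matrices joined by a path of invertible
matrices are identified, identity matrices are trivial and the block sum is the sum. -/
def kOneRel (R : Type*) [Ring R] [TopologicalSpace R] :
    AddSubgroup (FreeAbelianGroup (InvMat R)) :=
  AddSubgroup.closure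
    ({x | ∃ (n : ℕ) (u v : (Matrix (Fin n) (Fin n) R)ˣ), Joined u v ∧
        x = FreeAbelianGroup.of ⟨n, u⟩ - FreeAbelianGroup.of ⟨n, v⟩} ∪
      {x | ∃ n : ℕ, x = FreeAbelianGroup.of ⟨n, 1⟩} ∪
      {x | ∃ u v : InvMat R,
        x = FreeAbelianGroup.of (u.sum v) - (FreeAbelianGroup.of u + FreeAbelianGroup.of v)})

/-- `K₁` of a unital Banach algebra `R`, that is `GL_∞(R) / GL_∞(R)₀`, presented by generators and
relations. -/
def KOne (R : Type*) [Ring R] [TopologicalSpace R] : Type _ :=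
  FreeAbelianGroup (InvMat R) ⧸ kOneRel R

noncomputable instance (R : Type*) [Ring R] [TopologicalSpace R] : AddCommGroup (KOne R) :=
  inferInstanceAs (AddCommGroup (FreeAbelianGroup (InvMat R) ⧸ kOneRel R))

/-- The class in `K₁(R)` of an invertible matrix over `R`. -/
def KOne.mk {R : Type*} [Ring R] [TopologicalSpace R] {n : ℕ}
    (u : (Matrix (Fin n) (Fin n) R)ˣ) : KOne R :=
  QuotientAddGroup.mk' (kOneRel R) (FreeAbelianGroup.of ⟨n, u⟩)

/-- The class in `K₁(R)` of an invertible element of `R`. -/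
def KOne.ofUnit {R : Type*} [Ring R] [TopologicalSpace R] (x : Rˣ) : KOne R :=
  KOne.mk (Units.map (Matrix.scalar (Fin 1) : R →+* Matrix (Fin 1) (Fin 1) R).toMonoidHom x)

end KOne

section Boundary

set_option linter.unusedSectionVars false

/-- The quotient of a normed ring by a two-sided ideal with the quotient seminorm. -/
noncomputable instance quotientSeminormedRing {A : Type*} [NormedRing A] (J : Ideal A)
    [J.IsTwoSided] : SeminormedRing (A ⧸ J) where
  __ := (Submodule.Quotient.seminormedAddCommGroup J : SeminormedAddCommGroup (A ⧸ J))
  __ := (inferInstance : Ring (A ⧸ J))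
  dist_eq := (Submodule.Quotient.seminormedAddCommGroup J).dist_eq
  norm_mul_le x y := by
    refine le_of_forall_pos_le_add fun ε hε => ?_
    have h := ((Metric.nhds_basis_ball.prod_nhds Metric.nhds_basis_ball).tendsto_iff Metric.nhds_basis_ball).mp
      (continuous_mul.tendsto (‖x‖, ‖y‖)) ε hε
    simp only [Set.mem_prod, Metric.mem_ball, and_imp, Prod.forall, Prod.exists] at h
    rcases h with ⟨ε₁, ε₂, ⟨h₁, h₂⟩, h⟩
    obtain ⟨a, rfl, ha⟩ := Submodule.Quotient.norm_mk_lt x h₁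
    obtain ⟨b, rfl, hb⟩ := Submodule.Quotient.norm_mk_lt y h₂
    have hna := Submodule.Quotient.norm_mk_le J a
    have hnb := Submodule.Quotient.norm_mk_le J b
    specialize h ‖a‖ ‖b‖
      (by rw [Real.dist_eq, abs_lt]; constructor <;> linarith)
      (by rw [Real.dist_eq, abs_lt]; constructor <;> linarith)
    rw [Real.dist_eq, abs_lt] at h
    have h3 := Submodule.Quotient.norm_mk_le J (a * b)
    exact h3.trans ((norm_mul_le a b).trans (by linarith [h.2]))


/-- A two-sided ideal of a complex algebra, as a (non-unital) algebra in its own right. -/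
def idealAlg {A : Type*} [Ring A] [Algebra ℂ A] (J : Ideal A) [J.IsTwoSided] :
    NonUnitalSubalgebra ℂ A where
  carrier := J
  add_mem' := J.add_mem
  zero_mem' := J.zero_mem
  mul_mem' := fun {a _} _ hb => J.mul_mem_left a hb
  smul_mem' := fun c x hx => by
    have h := J.mul_mem_left (algebraMap ℂ A c) hx
    rwa [← Algebra.smul_def] at h

variable {A : Type*} [NormedRing A] [NormedAlgebra ℂ A] (J : Ideal A) [J.IsTwoSided]

/-- The quotient map `M_ι(A) → M_ι(A / J)`. -/
def matPi (ι : Type*) [Fintype ι] [DecidableEq ι] : Matrix ι ι A →+* Matrix ι ι (A ⧸ J) :=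
  (Ideal.Quotient.mk J).mapMatrix

/-- The inclusion `M_ι(ℂ) → M_ι(A)`. -/
noncomputable def scal (A : Type*) [Ring A] [Algebra ℂ A] (ι : Type*) [Fintype ι] [DecidableEq ι] :
    Matrix ι ι ℂ →+* Matrix ι ι A :=
  (algebraMap ℂ A).mapMatrix

variable {ι κ : Type*} [Fintype ι] [Fintype κ] [DecidableEq ι] [DecidableEq κ]

/-- The matrix over `J⁺ = ℂ ⊕ J` with scalar part `z` that is mapped to `a` by the canonical map
`J⁺ → A`, where `a` is congruent to `z` modulo `J`. -/
noncomputable def pairMat (z : Matrix ι ι ℂ) (a : Matrix ι ι A) (h : matPi J ι a = matPi J ι (scal A ι z)) :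
    Matrix ι ι (Unitization ℂ (idealAlg J)) :=
  Matrix.of fun i j =>
    Unitization.inl (z i j) + Unitization.inr (⟨a i j - algebraMap ℂ A (z i j),
      Ideal.Quotient.eq.1 (congrFun (congrFun h i) j)⟩ : idealAlg J)

/-- The augmentation `M_ι(J⁺) → M_ι(ℂ)`. -/
noncomputable def matFst (ι : Type*) [Fintype ι] [DecidableEq ι] :
    Matrix ι ι (Unitization ℂ (idealAlg J)) →+* Matrix ι ι ℂ :=
  (Unitization.fstHom ℂ (idealAlg J) : Unitization ℂ (idealAlg J) →+* ℂ).mapMatrix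

/-- The canonical map `M_ι(J⁺) → M_ι(A)`. -/
noncomputable def matVal (ι : Type*) [Fintype ι] [DecidableEq ι] :
    Matrix ι ι (Unitization ℂ (idealAlg J)) →+* Matrix ι ι A :=
  ((NonUnitalSubalgebra.unitization (idealAlg J)) : Unitization ℂ (idealAlg J) →+* A).mapMatrix

@[simp] lemma matFst_pairMat (z : Matrix ι ι ℂ) (a : Matrix ι ι A)
    (h : matPi J ι a = matPi J ι (scal A ι z)) : matFst J ι (pairMat J z a h) = z := by
  ext i j
  simp [matFst, pairMat]

@[simp] lemma matVal_pairMat (z : Matrix ι ι ℂ) (a : Matrix ι ι A)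
    (h : matPi J ι a = matPi J ι (scal A ι z)) : matVal J ι (pairMat J z a h) = a := by
  ext i j
  simp [matVal, pairMat]

lemma matPair_ext {x y : Matrix ι ι (Unitization ℂ (idealAlg J))}
    (h1 : matFst J ι x = matFst J ι y) (h2 : matVal J ι x = matVal J ι y) : x = y := by
  ext i j
  · exact congrFun (congrFun h1 i) j
  · have h3 := congrFun (congrFun h1 i) j
    have h4 := congrFun (congrFun h2 i) j
    simp only [matFst, matVal, RingHom.mapMatrix_apply, Matrix.map_apply, RingHom.coe_coe,
      NonUnitalSubalgebra.unitization_apply, Unitization.fstHom_apply] at h3 h4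
    rw [h3] at h4
    exact add_left_cancel h4

lemma pairMat_mul {z z' : Matrix ι ι ℂ} {a a' : Matrix ι ι A}
    (h : matPi J ι a = matPi J ι (scal A ι z)) (h' : matPi J ι a' = matPi J ι (scal A ι z'))
    (h'' : matPi J ι (a * a') = matPi J ι (scal A ι (z * z'))) :
    pairMat J z a h * pairMat J z' a' h' = pairMat J (z * z') (a * a') h'' := by
  apply matPair_ext <;> simp

lemma isIdempotentElem_pairMat {z : Matrix ι ι ℂ} {a : Matrix ι ι A}
    (h : matPi J ι a = matPi J ι (scal A ι z)) (hz : IsIdempotentElem z)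
    (ha : IsIdempotentElem a) : IsIdempotentElem (pairMat J z a h) := by
  unfold IsIdempotentElem at *
  apply matPair_ext <;> simp [hz, ha]

/-- The projection `diag(1, 0)`. -/
def pOne (ι : Type*) [DecidableEq ι] : Matrix (ι ⊕ ι) (ι ⊕ ι) ℂ := Matrix.fromBlocks 1 0 0 0

lemma isIdempotentElem_pOne : IsIdempotentElem (pOne ι) := by
  unfold IsIdempotentElem
  simp [pOne, Matrix.fromBlocks_multiply]

/-- `W` is an invertible lift of `diag(u, u⁻¹)` to a matrix over `A`. -/
def IsLift (u : (Matrix ι ι (A ⧸ J))ˣ) (W : (Matrix (ι ⊕ ι) (ι ⊕ ι) A)ˣ) : Prop :=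
  Units.map (matPi J (ι ⊕ ι)).toMonoidHom W = blockUnit u u⁻¹

lemma scal_pOne : scal A (ι ⊕ ι) (pOne ι) = Matrix.fromBlocks 1 0 0 0 := by
  unfold scal pOne
  rw [RingHom.mapMatrix_apply, Matrix.fromBlocks_map]
  simp

lemma matPi_pOne : matPi J (ι ⊕ ι) (scal A (ι ⊕ ι) (pOne ι)) = Matrix.fromBlocks 1 0 0 0 := by
  rw [scal_pOne]
  unfold matPi
  rw [RingHom.mapMatrix_apply, Matrix.fromBlocks_map]
  simp

lemma IsLift.val {J : Ideal A} [J.IsTwoSided] {u : (Matrix ι ι (A ⧸ J))ˣ}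
    {W : (Matrix (ι ⊕ ι) (ι ⊕ ι) A)ˣ} (h : IsLift J u W) :
    matPi J (ι ⊕ ι) W.val = Matrix.fromBlocks u.val 0 0 (u⁻¹).val :=
  congrArg Units.val h

lemma IsLift.inv {J : Ideal A} [J.IsTwoSided] {u : (Matrix ι ι (A ⧸ J))ˣ}
    {W : (Matrix (ι ⊕ ι) (ι ⊕ ι) A)ˣ} (h : IsLift J u W) :
    matPi J (ι ⊕ ι) (W⁻¹).val = Matrix.fromBlocks (u⁻¹).val 0 0 u.val :=
  congrArg (fun x => (x⁻¹).val) h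

lemma IsLift.conj {J : Ideal A} [J.IsTwoSided] {u : (Matrix ι ι (A ⧸ J))ˣ}
    {W V : (Matrix (ι ⊕ ι) (ι ⊕ ι) A)ˣ} (h : IsLift J u W) (h' : IsLift J u V) :
    matPi J (ι ⊕ ι) (W.val * scal A (ι ⊕ ι) (pOne ι) * (V⁻¹).val) =
      matPi J (ι ⊕ ι) (scal A (ι ⊕ ι) (pOne ι)) := by
  rw [map_mul, map_mul, h.val, h'.inv, matPi_pOne]
  simp [Matrix.fromBlocks_multiply]

/-- Every `diag(u, u⁻¹)` has an invertible lift: it is a product of elementary matrices. -/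
lemma exists_isLift (u : (Matrix ι ι (A ⧸ J))ˣ) : ∃ W, IsLift J u W := by
  have hs : Function.Surjective (matPi J ι) := by
    intro x
    choose f hf using fun i j => Ideal.Quotient.mk_surjective (x i j)
    exact ⟨Matrix.of f, by ext i j; exact hf i j⟩
  obtain ⟨a, ha⟩ := hs u.val
  obtain ⟨b, hb⟩ := hs (u⁻¹).val
  let E : Matrix ι ι A → (Matrix (ι ⊕ ι) (ι ⊕ ι) A)ˣ := fun c =>
    ⟨Matrix.fromBlocks 1 c 0 1, Matrix.fromBlocks 1 (-c) 0 1,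
      by simp [Matrix.fromBlocks_multiply], by simp [Matrix.fromBlocks_multiply]⟩
  let F : Matrix ι ι A → (Matrix (ι ⊕ ι) (ι ⊕ ι) A)ˣ := fun c =>
    ⟨Matrix.fromBlocks 1 0 c 1, Matrix.fromBlocks 1 0 (-c) 1,
      by simp [Matrix.fromBlocks_multiply], by simp [Matrix.fromBlocks_multiply]⟩
  let T : (Matrix (ι ⊕ ι) (ι ⊕ ι) A)ˣ :=
    ⟨Matrix.fromBlocks 0 (-1) 1 0, Matrix.fromBlocks 0 1 (-1) 0,
      by simp [Matrix.fromBlocks_multiply], by simp [Matrix.fromBlocks_multiply]⟩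
  refine ⟨E a * F (-b) * E a * T, ?_⟩
  apply Units.ext
  change matPi J (ι ⊕ ι) (Matrix.fromBlocks 1 a 0 1 * Matrix.fromBlocks 1 0 (-b) 1 *
    Matrix.fromBlocks 1 a 0 1 * Matrix.fromBlocks 0 (-1) 1 0) =
    Matrix.fromBlocks u.val 0 0 (u⁻¹).val
  have hB : ∀ p q r s : Matrix ι ι A, matPi J (ι ⊕ ι) (Matrix.fromBlocks p q r s) =
      Matrix.fromBlocks (matPi J ι p) (matPi J ι q) (matPi J ι r) (matPi J ι s) := by
    intro p q r s
    exact Matrix.fromBlocks_map ..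
  simp only [map_mul, hB, ha, hb, map_neg, map_one, map_zero]
  simp [Matrix.fromBlocks_multiply]

/-- The class `[W p W⁻¹] ∈ K₀(J⁺)`, where `p = diag(1, 0)` and `W` lifts `diag(u, u⁻¹)`. -/
noncomputable def liftClass {u : (Matrix ι ι (A ⧸ J))ˣ} {W : (Matrix (ι ⊕ ι) (ι ⊕ ι) A)ˣ}
    (h : IsLift J u W) : KZeroUnital (Unitization ℂ (idealAlg J)) :=
  KZeroUnital.mk (pairMat J (pOne ι) (W.val * scal A (ι ⊕ ι) (pOne ι) * (W⁻¹).val) (h.conj h))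
    (isIdempotentElem_pairMat J _ isIdempotentElem_pOne (by
      unfold IsIdempotentElem
      have h2 : scal A (ι ⊕ ι) (pOne ι) * scal A (ι ⊕ ι) (pOne ι) = scal A (ι ⊕ ι) (pOne ι) := by
        rw [← map_mul, isIdempotentElem_pOne.eq]
      calc _ = W.val * scal A (ι ⊕ ι) (pOne ι) * ((W⁻¹).val * W.val) *
            scal A (ι ⊕ ι) (pOne ι) * (W⁻¹).val := by noncomm_ring
        _ = W.val * (scal A (ι ⊕ ι) (pOne ι) * scal A (ι ⊕ ι) (pOne ι)) * (W⁻¹).val := by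
          rw [Units.inv_mul]; noncomm_ring
        _ = _ := by rw [h2]))

/-- The class of the scalar projection `p = diag(1, 0)` in `K₀(J⁺)`. -/
noncomputable def scalarClass (ι : Type*) [Fintype ι] [DecidableEq ι] :
    KZeroUnital (Unitization ℂ (idealAlg J)) :=
  KZeroUnital.mk (pairMat J (pOne ι) (scal A (ι ⊕ ι) (pOne ι)) rfl)
    (isIdempotentElem_pairMat J _ isIdempotentElem_pOne (isIdempotentElem_pOne.map _))

/-- The class does not depend on the lift. -/
lemma liftClass_eq {u : (Matrix ι ι (A ⧸ J))ˣ} {W V : (Matrix (ι ⊕ ι) (ι ⊕ ι) A)ˣ}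
    (h : IsLift J u W) (h' : IsLift J u V) : liftClass J h = liftClass J h' := by
  have hp : scal A (ι ⊕ ι) (pOne ι) * scal A (ι ⊕ ι) (pOne ι) = scal A (ι ⊕ ι) (pOne ι) := by
    rw [← map_mul, isIdempotentElem_pOne.eq]
  have key : ∀ X Y : (Matrix (ι ⊕ ι) (ι ⊕ ι) A)ˣ,
      X.val * scal A (ι ⊕ ι) (pOne ι) * (Y⁻¹).val *
        (Y.val * scal A (ι ⊕ ι) (pOne ι) * (X⁻¹).val) =
      X.val * scal A (ι ⊕ ι) (pOne ι) * (X⁻¹).val := by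
    intro X Y
    calc _ = X.val * scal A (ι ⊕ ι) (pOne ι) * ((Y⁻¹).val * Y.val) *
            scal A (ι ⊕ ι) (pOne ι) * (X⁻¹).val := by noncomm_ring
        _ = X.val * (scal A (ι ⊕ ι) (pOne ι) * scal A (ι ⊕ ι) (pOne ι)) * (X⁻¹).val := by
          rw [Units.inv_mul]; noncomm_ring
        _ = _ := by rw [hp]
  apply KZeroUnital.mk_eq_of_matEquiv
  refine ⟨pairMat J (pOne ι) _ (h.conj h'), pairMat J (pOne ι) _ (h'.conj h), ?_, ?_⟩
  · apply matPair_ext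
    · simp only [map_mul, matFst_pairMat, isIdempotentElem_pOne.eq]
    · simp only [map_mul, matVal_pairMat, key]
  · apply matPair_ext
    · simp only [map_mul, matFst_pairMat, isIdempotentElem_pOne.eq]
    · simp only [map_mul, matVal_pairMat, key]

/-- The index `[W p W⁻¹] - [p]` of an invertible matrix `u` over `A / J`, where `W` is any
invertible lift of `diag(u, u⁻¹)`. -/
noncomputable def indexAux (u : (Matrix ι ι (A ⧸ J))ˣ) :
    KZeroUnital (Unitization ℂ (idealAlg J)) :=
  liftClass J (exists_isLift J u).choose_spec - scalarClass J ι

lemma indexAux_eq {u : (Matrix ι ι (A ⧸ J))ˣ} {W : (Matrix (ι ⊕ ι) (ι ⊕ ι) A)ˣ}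
    (h : IsLift J u W) : indexAux J u = liftClass J h - scalarClass J ι := by
  unfold indexAux
  rw [liftClass_eq J _ h]

lemma map_fst_mk (z : Matrix ι ι ℂ) (a : Matrix ι ι A)
    (h : matPi J ι a = matPi J ι (scal A ι z)) (hz : IsIdempotentElem z)
    (ha : IsIdempotentElem (pairMat J z a h)) :
    KZeroUnital.map (Unitization.fstHom ℂ (idealAlg J) : Unitization ℂ (idealAlg J) →+* ℂ)
      (KZeroUnital.mk (pairMat J z a h) ha) = KZeroUnital.mk z hz := by
  rw [KZeroUnital.map_mk]
  congr 1
  exact matFst_pairMat J z a h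

lemma indexAux_mem (u : (Matrix ι ι (A ⧸ J))ˣ) : indexAux J u ∈ KZero (idealAlg J) := by
  rw [AddMonoidHom.mem_ker]
  unfold indexAux liftClass scalarClass
  rw [map_sub, map_fst_mk J _ _ _ isIdempotentElem_pOne,
    map_fst_mk J _ _ _ isIdempotentElem_pOne, sub_self]

lemma indexAux_one : indexAux J (1 : (Matrix ι ι (A ⧸ J))ˣ) = 0 := by
  have h : IsLift J (1 : (Matrix ι ι (A ⧸ J))ˣ) 1 := by
    unfold IsLift
    rw [map_one]
    apply Units.ext
    simp [blockUnit]
  rw [indexAux_eq J h, sub_eq_zero]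
  apply KZeroUnital.mk_eq_of_matEquiv
  refine Eq.mp ?_ (matEquiv_refl (isIdempotentElem_pairMat J (a := scal A (ι ⊕ ι) (pOne ι)) rfl
    isIdempotentElem_pOne (isIdempotentElem_pOne.map _)))
  congr 2
  simp

lemma isOpenMap_matPi : IsOpenMap (matPi J ι) := by
  have h : IsOpenMap (Ideal.Quotient.mk J) := QuotientAddGroup.isOpenMap_coe
  have hs : Function.Surjective (Ideal.Quotient.mk J) := Ideal.Quotient.mk_surjective
  have h1 : IsOpenMap (Pi.map fun _ : ι => (Ideal.Quotient.mk J : A → A ⧸ J)) :=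
    IsOpenMap.piMap (fun _ => h) (Filter.Eventually.of_forall fun _ => hs)
  exact IsOpenMap.piMap (fun _ : ι => h1)
    (Filter.Eventually.of_forall fun _ => Function.Surjective.piMap fun _ => hs)

open scoped Matrix.Norms.Operator in
lemma isOpen_isUnit_matrix [CompleteSpace A] : IsOpen {x : Matrix ι ι A | IsUnit x} := by
  have h : @CompleteSpace (Matrix ι ι A)
      (Matrix.linftyOpNormedRing (n := ι) (α := A)).toPseudoMetricSpace.toUniformSpace :=
    inferInstanceAs (CompleteSpace (ι → ι → A))
  exact @Units.isOpen _ _ (@instHasSummableGeomSeriesOfCompleteSpace _ _ h)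

lemma isOpen_range_units_matPi [CompleteSpace A] :
    IsOpen ((Units.map (matPi J ι).toMonoidHom).range : Set (Matrix ι ι (A ⧸ J))ˣ) := by
  refine Subgroup.isOpen_of_mem_nhds (g := 1) _ ?_
  have h : IsOpen (matPi J ι '' {x : Matrix ι ι A | IsUnit x}) :=
    isOpenMap_matPi J _ (isOpen_isUnit_matrix)
  have h1 := h.preimage (Units.continuous_val (M := Matrix ι ι (A ⧸ J)))
  refine Filter.mem_of_superset (h1.mem_nhds ⟨1, isUnit_one, by simp⟩) ?_
  rintro g ⟨x, hx, hxg⟩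
  obtain ⟨y, rfl⟩ := hx
  exact ⟨y, Units.ext hxg⟩

/-- Invertible matrices over `A / J` in the path component of the identity have invertible lifts. -/
lemma exists_lift_of_path [CompleteSpace A] (f : unitInterval → (Matrix ι ι (A ⧸ J))ˣ)
    (hf : Continuous f) (h0 : f 0 = 1) (t : unitInterval) :
    ∃ V, Units.map (matPi J ι).toMonoidHom V = f t := by
  let L := (Units.map (matPi J ι).toMonoidHom).range
  have hL : IsClopen (L : Set (Matrix ι ι (A ⧸ J))ˣ) :=
    ⟨Subgroup.isClosed_of_isOpen _ (isOpen_range_units_matPi J), isOpen_range_units_matPi J⟩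
  have h := (hL.preimage hf).eq_univ ⟨0, by
    change f 0 ∈ L
    rw [h0]
    exact one_mem _⟩
  have h2 : t ∈ f ⁻¹' (L : Set (Matrix ι ι (A ⧸ J))ˣ) := h ▸ Set.mem_univ t
  exact h2

lemma indexAux_joined [CompleteSpace A] {u v : (Matrix ι ι (A ⧸ J))ˣ} (h : Joined u v) :
    indexAux J u = indexAux J v := by
  obtain ⟨γ⟩ := h
  obtain ⟨V, hV⟩ := exists_lift_of_path J (fun t => u⁻¹ * γ t) (by fun_prop) (by simp) 1
  obtain ⟨V', hV'⟩ := exists_lift_of_path J (fun t => u * (γ t)⁻¹) (by fun_prop) (by simp) 1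
  obtain ⟨W, hW⟩ := exists_isLift J u
  have hW' : IsLift J v (W * blockUnit V V') := by
    unfold IsLift
    rw [map_mul, hW]
    have h1 : Units.map (matPi J (ι ⊕ ι)).toMonoidHom (blockUnit V V') =
        blockUnit (u⁻¹ * v) (u * v⁻¹) := by
      simp only [Path.target] at hV hV'
      rw [← hV, ← hV']
      apply Units.ext
      exact (Matrix.fromBlocks_map ..).trans (by simp [blockUnit, matPi])
    rw [h1]
    apply Units.ext
    simp [blockUnit, Matrix.fromBlocks_multiply]
  rw [indexAux_eq J hW, indexAux_eq J hW']
  congr 1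
  unfold liftClass
  congr 2
  rw [_root_.mul_inv_rev]
  simp only [Units.val_mul]
  have h2 : (blockUnit V V').val * scal A (ι ⊕ ι) (pOne ι) * ((blockUnit V V')⁻¹).val =
      scal A (ι ⊕ ι) (pOne ι) := by
    rw [scal_pOne]
    change Matrix.fromBlocks V.val 0 0 V'.val * _ *
      Matrix.fromBlocks (V⁻¹).val 0 0 (V'⁻¹).val = _
    simp [Matrix.fromBlocks_multiply]
  conv_lhs => rw [← h2]
  noncomm_ring

lemma mk_pairMat_reindex (σ : ι ≃ κ) {z : Matrix ι ι ℂ} {a : Matrix ι ι A} {z' : Matrix κ κ ℂ}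
    {a' : Matrix κ κ A} (h : matPi J ι a = matPi J ι (scal A ι z))
    (h' : matPi J κ a' = matPi J κ (scal A κ z')) (hz : z' = Matrix.reindex σ σ z)
    (ha : a' = Matrix.reindex σ σ a) (hi : IsIdempotentElem (pairMat J z a h))
    (hi' : IsIdempotentElem (pairMat J z' a' h')) :
    KZeroUnital.mk (pairMat J z' a' h') hi' = KZeroUnital.mk (pairMat J z a h) hi := by
  subst hz ha
  exact (KZeroUnital.mk_eq_of_matEquiv _ _ (matEquiv_reindex_self σ hi)).symm

lemma mk_pairMat_block {z₁ : Matrix ι ι ℂ} {a₁ : Matrix ι ι A} {z₂ : Matrix κ κ ℂ}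
    {a₂ : Matrix κ κ A} (h₁ : matPi J ι a₁ = matPi J ι (scal A ι z₁))
    (h₂ : matPi J κ a₂ = matPi J κ (scal A κ z₂))
    (h : matPi J (ι ⊕ κ) (Matrix.fromBlocks a₁ 0 0 a₂) =
      matPi J (ι ⊕ κ) (scal A (ι ⊕ κ) (Matrix.fromBlocks z₁ 0 0 z₂)))
    (hi₁ : IsIdempotentElem (pairMat J z₁ a₁ h₁)) (hi₂ : IsIdempotentElem (pairMat J z₂ a₂ h₂))
    (hi : IsIdempotentElem (pairMat J _ _ h)) :
    KZeroUnital.mk (pairMat J _ _ h) hi =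
      KZeroUnital.mk (pairMat J z₁ a₁ h₁) hi₁ + KZeroUnital.mk (pairMat J z₂ a₂ h₂) hi₂ := by
  rw [← KZeroUnital.mk_fromBlocks]
  congr 1
  have hz : ∀ (y : A) (hy : y ∈ idealAlg J), y = 0 →
      (Unitization.inl 0 + Unitization.inr ⟨y, hy⟩ : Unitization ℂ (idealAlg J)) = 0 := by
    rintro y hy rfl
    rw [Unitization.inl_zero, zero_add]
    exact Unitization.inr_zero ℂ
  ext1 i j
  rcases i with i | i <;> rcases j with j | j
  · rfl
  · exact hz _ _ (by simp)
  · exact hz _ _ (by simp)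
  · rfl

lemma reindex_mul {R : Type*} [Ring R] (σ : ι ≃ κ) (x y : Matrix ι ι R) :
    Matrix.reindex σ σ x * Matrix.reindex σ σ y = Matrix.reindex σ σ (x * y) := by
  simp only [Matrix.reindex_apply]
  rw [Matrix.submatrix_mul_equiv]

lemma indexAux_reindex (σ : ι ≃ κ) (u : (Matrix ι ι (A ⧸ J))ˣ) :
    indexAux J (reindexUnit σ u) = indexAux J u := by
  obtain ⟨W, hW⟩ := exists_isLift J u
  have hp : pOne κ = Matrix.reindex (σ.sumCongr σ) (σ.sumCongr σ) (pOne ι) := by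
    ext (i | i) (j | j) <;> simp [pOne, Matrix.one_apply]
  have hsp : scal A (κ ⊕ κ) (pOne κ) =
      Matrix.reindex (σ.sumCongr σ) (σ.sumCongr σ) (scal A (ι ⊕ ι) (pOne ι)) := by
    rw [hp]; rfl
  have hW' : IsLift J (reindexUnit σ u) (reindexUnit (σ.sumCongr σ) W) := by
    apply Units.ext
    have h := hW.val
    change Matrix.reindex (σ.sumCongr σ) (σ.sumCongr σ) (matPi J (ι ⊕ ι) W.val) = _
    rw [h]
    ext (i | i) (j | j) <;> rfl
  rw [indexAux_eq J hW, indexAux_eq J hW']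
  congr 1
  · refine mk_pairMat_reindex J (σ.sumCongr σ) _ _ hp ?_ _ _
    rw [hsp]
    change Matrix.reindex _ _ W.val * _ * Matrix.reindex _ _ (W⁻¹).val = _
    rw [reindex_mul, reindex_mul]
  · exact mk_pairMat_reindex J (σ.sumCongr σ) _ _ hp hsp _ _

lemma isIdempotentElem_conj {R : Type*} [Ring R] (X : Rˣ) {p : R} (hp : IsIdempotentElem p) :
    IsIdempotentElem (X.val * p * (X⁻¹).val) := by
  unfold IsIdempotentElem
  calc _ = X.val * p * ((X⁻¹).val * X.val) * p * (X⁻¹).val := by noncomm_ring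
    _ = X.val * (p * p) * (X⁻¹).val := by rw [Units.inv_mul]; noncomm_ring
    _ = _ := by rw [hp.eq]

lemma indexAux_block (u : (Matrix ι ι (A ⧸ J))ˣ) (v : (Matrix κ κ (A ⧸ J))ˣ) :
    indexAux J (blockUnit u v) = indexAux J u + indexAux J v := by
  obtain ⟨W, hW⟩ := exists_isLift J u
  obtain ⟨V, hV⟩ := exists_isLift J v
  let σ : (ι ⊕ ι) ⊕ (κ ⊕ κ) ≃ (ι ⊕ κ) ⊕ (ι ⊕ κ) := Equiv.sumSumSumComm ι ι κ κ
  have hp : pOne (ι ⊕ κ) =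
      Matrix.reindex σ σ (Matrix.fromBlocks (pOne ι) 0 0 (pOne κ)) := by
    ext ((i | i) | (i | i)) ((j | j) | (j | j)) <;>
      simp [pOne, σ, Matrix.one_apply]
  have hB : scal A _ (Matrix.fromBlocks (pOne ι) 0 0 (pOne κ)) =
      Matrix.fromBlocks (scal A _ (pOne ι)) 0 0 (scal A _ (pOne κ)) := by
    exact (Matrix.fromBlocks_map ..).trans (by simp [scal])
  have hsp : scal A _ (pOne (ι ⊕ κ)) =
      Matrix.reindex σ σ (Matrix.fromBlocks (scal A _ (pOne ι)) 0 0 (scal A _ (pOne κ))) := by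
    rw [hp, ← hB]; rfl
  have hπ : ∀ (x : Matrix (ι ⊕ ι) (ι ⊕ ι) A) (y : Matrix (κ ⊕ κ) (κ ⊕ κ) A),
      matPi J _ (Matrix.fromBlocks x 0 0 y) =
        Matrix.fromBlocks (matPi J _ x) 0 0 (matPi J _ y) := by
    intro x y
    exact (Matrix.fromBlocks_map ..).trans (by simp [matPi])
  have hWV : IsLift J (blockUnit u v) (reindexUnit σ (blockUnit W V)) := by
    apply Units.ext
    change Matrix.reindex σ σ (matPi J _ (Matrix.fromBlocks W.val 0 0 V.val)) = _
    rw [hπ, hW.val, hV.val]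
    ext ((i | i) | (i | i)) ((j | j) | (j | j)) <;> rfl
  have hip : IsIdempotentElem (Matrix.fromBlocks (pOne ι) 0 0 (pOne κ)) :=
    isIdempotentElem_fromBlocks isIdempotentElem_pOne isIdempotentElem_pOne
  have e1 : liftClass J hWV = liftClass J hW + liftClass J hV := by
    unfold liftClass
    have hc : matPi J _ (Matrix.fromBlocks (W.val * scal A (ι ⊕ ι) (pOne ι) * (W⁻¹).val) 0 0
        (V.val * scal A (κ ⊕ κ) (pOne κ) * (V⁻¹).val)) =
        matPi J _ (scal A _ (Matrix.fromBlocks (pOne ι) 0 0 (pOne κ))) := by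
      rw [hB, hπ, hπ, hW.conj hW, hV.conj hV]
    rw [← mk_pairMat_block J (hW.conj hW) (hV.conj hV) hc _ _
      (isIdempotentElem_pairMat J _ hip (isIdempotentElem_fromBlocks
        (isIdempotentElem_conj _ (isIdempotentElem_pOne.map _)) (isIdempotentElem_conj _ (isIdempotentElem_pOne.map _))))]
    refine mk_pairMat_reindex J σ _ _ hp ?_ _ _
    rw [hsp]
    change Matrix.reindex _ _ (Matrix.fromBlocks W.val 0 0 V.val) * _ *
      Matrix.reindex _ _ (Matrix.fromBlocks (W⁻¹).val 0 0 (V⁻¹).val) = _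
    rw [reindex_mul, reindex_mul]
    simp [Matrix.fromBlocks_multiply]
  have e2 : scalarClass J (ι ⊕ κ) = scalarClass J ι + scalarClass J κ := by
    unfold scalarClass
    have hc : matPi J _ (Matrix.fromBlocks (scal A (ι ⊕ ι) (pOne ι)) 0 0
        (scal A (κ ⊕ κ) (pOne κ))) =
        matPi J _ (scal A _ (Matrix.fromBlocks (pOne ι) 0 0 (pOne κ))) := by rw [hB]
    rw [← mk_pairMat_block J rfl rfl hc _ _
      (isIdempotentElem_pairMat J _ hip (isIdempotentElem_fromBlocks
        (isIdempotentElem_pOne.map _) (isIdempotentElem_pOne.map _)))]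
    exact mk_pairMat_reindex J σ _ _ hp hsp _ _
  rw [indexAux_eq J hW, indexAux_eq J hV, indexAux_eq J hWV, e1, e2]
  abel

/-- The boundary map (index map) `∂ : K₁(A / J) → K₀(J)` of the extension `0 → J → A → A / J → 0`:
for `u ∈ GL_n(A / J)`, `∂[u] = [W p W⁻¹] - [p]` where `W ∈ GL_{2n}(A)` is any lift of
`diag(u, u⁻¹)` and `p = diag(1_n, 0)`. -/
noncomputable def boundary [CompleteSpace A] : KOne (A ⧸ J) →+ KZero (idealAlg J) :=
  QuotientAddGroup.lift (kOneRel (A ⧸ J))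
    (FreeAbelianGroup.lift fun u : InvMat (A ⧸ J) =>
      (⟨indexAux J u.mat, indexAux_mem J u.mat⟩ : KZero (idealAlg J))) (by
    refine (AddSubgroup.closure_le _).2 ?_
    rintro x ((⟨n, u, v, h, rfl⟩ | ⟨n, rfl⟩) | ⟨u, v, rfl⟩)
    · simp only [SetLike.mem_coe, AddMonoidHom.mem_ker, map_sub, FreeAbelianGroup.lift_apply_of]
      rw [sub_eq_zero]
      exact Subtype.ext (indexAux_joined J h)
    · simp only [SetLike.mem_coe, AddMonoidHom.mem_ker, FreeAbelianGroup.lift_apply_of]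
      exact Subtype.ext (indexAux_one J)
    · simp only [SetLike.mem_coe, AddMonoidHom.mem_ker, map_sub, map_add,
        FreeAbelianGroup.lift_apply_of]
      rw [sub_eq_zero]
      apply Subtype.ext
      exact (indexAux_reindex J _ _).trans (indexAux_block J _ _))

end Boundary

/-! ## Operators, index and spectral flow -/

section Unbounded

variable {H : Type*} [NormedAddCommGroup H] [InnerProductSpace ℂ H] [CompleteSpace H]

/-- The graph of an operator, as a subspace of the Hilbert space direct sum `H ⊕ H`. -/
def graphL2 (D : H →ₗ.[ℂ] H) : Submodule ℂ (WithLp 2 (H × H)) :=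
  D.graph.comap (WithLp.prodContinuousLinearEquiv 2 ℂ H H).toLinearMap

lemma isClosed_graphL2 {D : H →ₗ.[ℂ] H} (hD : IsSelfAdjoint D) :
    IsClosed (graphL2 D : Set (WithLp 2 (H × H))) :=
  IsClosed.preimage (WithLp.prodContinuousLinearEquiv 2 ℂ H H).continuous hD.isClosed

/-- The orthogonal projection of `H ⊕ H` onto the graph of a self-adjoint operator. -/
noncomputable def graphProj (D : H →ₗ.[ℂ] H) (hD : IsSelfAdjoint D) :
    WithLp 2 (H × H) →L[ℂ] WithLp 2 (H × H) :=
  haveI : CompleteSpace (graphL2 D) := (isClosed_graphL2 hD).completeSpace_coe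
  (graphL2 D).starProjection

/-- The bounded operator `x ↦ fst (P (x, 0))`, where `P` is the projection onto the graph of `D`.
It is `(1 + D²)⁻¹`, see `invOneAddSq_spec`. -/
noncomputable def invOneAddSq (D : H →ₗ.[ℂ] H) (hD : IsSelfAdjoint D) : H →L[ℂ] H :=
  ContinuousLinearMap.fst ℂ H H ∘L (WithLp.prodContinuousLinearEquiv 2 ℂ H H).toContinuousLinearMap ∘L
    graphProj D hD ∘L (WithLp.prodContinuousLinearEquiv 2 ℂ H H).symm.toContinuousLinearMap ∘L
    ContinuousLinearMap.inl ℂ H H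

/-- The bounded operator `x ↦ snd (P (x, 0))`, that is `D (1 + D²)⁻¹`. -/
noncomputable def mulInvOneAddSq (D : H →ₗ.[ℂ] H) (hD : IsSelfAdjoint D) : H →L[ℂ] H :=
  ContinuousLinearMap.snd ℂ H H ∘L (WithLp.prodContinuousLinearEquiv 2 ℂ H H).toContinuousLinearMap ∘L
    graphProj D hD ∘L (WithLp.prodContinuousLinearEquiv 2 ℂ H H).symm.toContinuousLinearMap ∘L
    ContinuousLinearMap.inl ℂ H H

lemma invOneAddSq_mem_graph (D : H →ₗ.[ℂ] H) (hD : IsSelfAdjoint D) (y : H) :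
    (invOneAddSq D hD y, mulInvOneAddSq D hD y) ∈ D.graph := by
  have : CompleteSpace (graphL2 D) := (isClosed_graphL2 hD).completeSpace_coe
  exact (graphL2 D).starProjection_apply_mem (WithLp.toLp 2 (y, 0))

lemma invOneAddSq_inner (D : H →ₗ.[ℂ] H) (hD : IsSelfAdjoint D) (y : H) {z w : H}
    (hz : (z, w) ∈ D.graph) :
    inner ℂ (mulInvOneAddSq D hD y) w = inner ℂ (y - invOneAddSq D hD y) z := by
  have : CompleteSpace (graphL2 D) := (isClosed_graphL2 hD).completeSpace_coe
  have h := (graphL2 D).starProjection_inner_eq_zero (WithLp.toLp 2 (y, 0)) (WithLp.toLp 2 (z, w)) hz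
  rw [WithLp.prod_inner_apply] at h
  have h' : inner ℂ (y - invOneAddSq D hD y) z + inner ℂ (0 - mulInvOneAddSq D hD y) w = 0 := h
  rw [zero_sub, inner_neg_left] at h'
  exact (add_neg_eq_zero.1 h').symm

/-- `invOneAddSq D` is `(1 + D²)⁻¹`. -/
lemma invOneAddSq_spec (D : H →ₗ.[ℂ] H) (hD : IsSelfAdjoint D) (y : H) :
    ∃ (h : invOneAddSq D hD y ∈ D.domain)
      (h' : D ⟨invOneAddSq D hD y, h⟩ ∈ D.domain),
      invOneAddSq D hD y + D ⟨D ⟨invOneAddSq D hD y, h⟩, h'⟩ = y := by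
  obtain ⟨⟨a, ha⟩, ha1, ha2⟩ := D.mem_graph_iff.1 (invOneAddSq_mem_graph D hD y)
  simp only at ha1 ha2
  subst ha1
  have hin : ∀ x : D.domain,
      inner ℂ (y - invOneAddSq D hD y) (x : H) = inner ℂ (mulInvOneAddSq D hD y) (D x) :=
    fun x => (invOneAddSq_inner D hD y (D.mem_graph x)).symm
  have hm : mulInvOneAddSq D hD y ∈ D.adjoint.domain :=
    LinearPMap.mem_adjoint_domain_of_exists _ ⟨_, hin⟩
  have hv := LinearPMap.adjoint_apply_eq hD.dense_domain ⟨_, hm⟩ hin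
  have hs : D.adjoint = D := hD
  have key : ∀ (E : H →ₗ.[ℂ] H), E = D → ∀ hm' : mulInvOneAddSq D hD y ∈ E.domain,
      E ⟨_, hm'⟩ = y - invOneAddSq D hD y →
      ∃ h' : mulInvOneAddSq D hD y ∈ D.domain, D ⟨_, h'⟩ = y - invOneAddSq D hD y := by
    rintro E rfl hm' he
    exact ⟨hm', he⟩
  obtain ⟨h', he⟩ := key _ hs hm hv
  refine ⟨ha, ha2 ▸ h', ?_⟩
  have : (⟨D ⟨invOneAddSq D hD y, ha⟩, ha2 ▸ h'⟩ : D.domain) = ⟨mulInvOneAddSq D hD y, h'⟩ :=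
    Subtype.ext ha2
  rw [this, he]
  abel

lemma norm_sq_invOneAddSq (D : H →ₗ.[ℂ] H) (hD : IsSelfAdjoint D) (y : H) :
    inner ℂ (invOneAddSq D hD y) y =
      ((‖mulInvOneAddSq D hD y‖ ^ 2 + ‖invOneAddSq D hD y‖ ^ 2 : ℝ) : ℂ) := by
  have h := invOneAddSq_inner D hD y (invOneAddSq_mem_graph D hD y)
  rw [inner_sub_left, inner_self_eq_norm_sq_to_K, inner_self_eq_norm_sq_to_K] at h
  have h2 : inner ℂ y (invOneAddSq D hD y) =
      ((‖mulInvOneAddSq D hD y‖ ^ 2 + ‖invOneAddSq D hD y‖ ^ 2 : ℝ) : ℂ) := by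
    push_cast
    exact (sub_eq_iff_eq_add.1 h.symm)
  rw [← inner_conj_symm, h2, Complex.conj_ofReal]

lemma invOneAddSq_nonneg (D : H →ₗ.[ℂ] H) (hD : IsSelfAdjoint D) : 0 ≤ invOneAddSq D hD := by
  rw [ContinuousLinearMap.nonneg_iff_isPositive, ContinuousLinearMap.isPositive_iff_complex]
  intro y
  rw [norm_sq_invOneAddSq]
  rw [RCLike.re_eq_complex_re, Complex.ofReal_re]
  refine ⟨rfl, ?_⟩
  positivity

/-- The bounded operator `(1 + D²)^{-1/2}`. -/
noncomputable def invSqrtOneAddSq (D : H →ₗ.[ℂ] H) (hD : IsSelfAdjoint D) : H →L[ℂ] H :=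
  CFC.sqrt (invOneAddSq D hD)

lemma norm_sq_invSqrt (D : H →ₗ.[ℂ] H) (hD : IsSelfAdjoint D) (y : H) :
    ‖invSqrtOneAddSq D hD y‖ ^ 2 = ‖mulInvOneAddSq D hD y‖ ^ 2 + ‖invOneAddSq D hD y‖ ^ 2 := by
  have hsa : IsSelfAdjoint (invSqrtOneAddSq D hD) := (CFC.sqrt_nonneg _).isSelfAdjoint
  have hmul : invSqrtOneAddSq D hD * invSqrtOneAddSq D hD = invOneAddSq D hD :=
    CFC.sqrt_mul_sqrt_self _ (invOneAddSq_nonneg D hD)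
  have h := norm_sq_invOneAddSq D hD y
  rw [← hmul, mul_apply_eq_comp] at h
  have h2 : inner ℂ (invSqrtOneAddSq D hD (invSqrtOneAddSq D hD y)) y =
      inner ℂ (invSqrtOneAddSq D hD y) (invSqrtOneAddSq D hD y) := by
    have h6 : ContinuousLinearMap.adjoint (invSqrtOneAddSq D hD) = invSqrtOneAddSq D hD :=
      hsa.star_eq
    have h7 := ContinuousLinearMap.adjoint_inner_left (invSqrtOneAddSq D hD) y
      (invSqrtOneAddSq D hD y)
    rwa [h6] at h7
  rw [h2, inner_self_eq_norm_sq_to_K] at h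
  have h3 : invOneAddSq D hD y = invSqrtOneAddSq D hD (invSqrtOneAddSq D hD y) := by
    rw [← hmul, mul_apply_eq_comp]
  rw [h3]
  have h8 := congrArg Complex.re h
  rw [Complex.ofReal_re] at h8
  rw [← h8]
  change _ = (((‖invSqrtOneAddSq D hD y‖ : ℝ) : ℂ) ^ 2).re
  rw [← Complex.ofReal_pow, Complex.ofReal_re]

lemma denseRange_invSqrt (D : H →ₗ.[ℂ] H) (hD : IsSelfAdjoint D) :
    DenseRange (invSqrtOneAddSq D hD) := by
  have hsa : IsSelfAdjoint (invSqrtOneAddSq D hD) := (CFC.sqrt_nonneg _).isSelfAdjoint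
  have hmul : invSqrtOneAddSq D hD * invSqrtOneAddSq D hD = invOneAddSq D hD :=
    CFC.sqrt_mul_sqrt_self _ (invOneAddSq_nonneg D hD)
  have hker : ∀ y, invSqrtOneAddSq D hD y = 0 → y = 0 := by
    intro y hy
    have h1 : invOneAddSq D hD y = 0 := by
      rw [← hmul, mul_apply_eq_comp, hy, map_zero]
    have h2 := norm_sq_invSqrt D hD y
    rw [hy, h1] at h2
    have h3 : mulInvOneAddSq D hD y = 0 := by simpa using h2.symm
    refine hD.dense_domain.eq_zero_of_inner_left (𝕜 := ℂ) fun z hz => ?_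
    have h4 := invOneAddSq_inner D hD y (D.mem_graph ⟨z, hz⟩)
    rw [h1, h3] at h4
    simpa using h4.symm
  have h : (LinearMap.range (invSqrtOneAddSq D hD : H →ₗ[ℂ] H)).topologicalClosure = ⊤ := by
    rw [Submodule.topologicalClosure_eq_top_iff, Submodule.eq_bot_iff]
    intro y hy
    apply hker
    rw [Submodule.mem_orthogonal] at hy
    rw [← inner_self_eq_zero (𝕜 := ℂ)]
    have h5 := hy _ (LinearMap.mem_range_self (invSqrtOneAddSq D hD : H →ₗ[ℂ] H)
      (invSqrtOneAddSq D hD y))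
    rw [← ContinuousLinearMap.adjoint_inner_left]
    have h6 : ContinuousLinearMap.adjoint (invSqrtOneAddSq D hD) = invSqrtOneAddSq D hD :=
      hsa.star_eq
    rw [h6]
    exact h5
  exact (Submodule.dense_iff_topologicalClosure_eq_top).2 h

/-- The operator `(1 + D²)^{-1/2}` maps `H` into the domain of `D`. -/
lemma invSqrt_mem_graph (D : H →ₗ.[ℂ] H) (hD : IsSelfAdjoint D) (x : H) :
    ∃ d, (invSqrtOneAddSq D hD x, d) ∈ D.graph ∧ ‖d‖ ≤ ‖x‖ := by
  have hmul : invSqrtOneAddSq D hD * invSqrtOneAddSq D hD = invOneAddSq D hD :=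
    CFC.sqrt_mul_sqrt_self _ (invOneAddSq_nonneg D hD)
  have hle : ∀ y, ‖mulInvOneAddSq D hD y‖ ≤ ‖invSqrtOneAddSq D hD y‖ := by
    intro y
    apply le_of_sq_le_sq _ (norm_nonneg _)
    rw [norm_sq_invSqrt]
    nlinarith [sq_nonneg ‖invOneAddSq D hD y‖]
  obtain ⟨s, hs, hx⟩ := mem_closure_iff_seq_limit.1 (denseRange_invSqrt D hD x)
  choose y hy using hs
  have hc : CauchySeq fun n => mulInvOneAddSq D hD (y n) := by
    have hsc := hx.cauchySeq
    rw [Metric.cauchySeq_iff] at hsc ⊢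
    intro ε hε
    obtain ⟨M, hM⟩ := hsc ε hε
    refine ⟨M, fun m hm n hn => lt_of_le_of_lt ?_ (hM m hm n hn)⟩
    rw [dist_eq_norm, dist_eq_norm, ← hy m, ← hy n, ← map_sub, ← map_sub]
    exact hle _
  obtain ⟨d, hd⟩ := cauchySeq_tendsto_of_complete hc
  refine ⟨d, ?_, ?_⟩
  · have h1 : Filter.Tendsto (fun n => (invSqrtOneAddSq D hD (s n), mulInvOneAddSq D hD (y n)))
        Filter.atTop (nhds (invSqrtOneAddSq D hD x, d)) :=
      (((invSqrtOneAddSq D hD).continuous.tendsto x).comp hx).prodMk_nhds hd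
    refine hD.isClosed.mem_of_tendsto h1 (Filter.Eventually.of_forall fun n => ?_)
    have h2 := invOneAddSq_mem_graph D hD (y n)
    rw [← hmul, mul_apply_eq_comp, hy] at h2
    exact h2
  · refine le_of_tendsto_of_tendsto' hd.norm hx.norm fun n => ?_
    rw [← hy n]
    exact hle _

lemma invSqrt_mem_domain (D : H →ₗ.[ℂ] H) (hD : IsSelfAdjoint D) (x : H) :
    invSqrtOneAddSq D hD x ∈ D.domain :=
  let ⟨_, hd, _⟩ := invSqrt_mem_graph D hD x
  D.mem_domain_of_mem_graph hd

/-- The bounded transform `F_D = D (1 + D²)^{-1/2}` of a self-adjoint operator `D`. -/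
noncomputable def boundedTransform (D : H →ₗ.[ℂ] H) (hD : IsSelfAdjoint D) : H →L[ℂ] H :=
  LinearMap.mkContinuous
    (D.toFun ∘ₗ (invSqrtOneAddSq D hD : H →ₗ[ℂ] H).codRestrict D.domain
      (invSqrt_mem_domain D hD)) 1 (by
    intro x
    obtain ⟨d, hd, hn⟩ := invSqrt_mem_graph D hD x
    have h : D ⟨invSqrtOneAddSq D hD x, invSqrt_mem_domain D hD x⟩ = d :=
      D.mem_graph_snd_inj (D.mem_graph _) hd rfl
    rw [one_mul]
    exact (congrArg norm h).trans_le hn)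

lemma boundedTransform_apply (D : H →ₗ.[ℂ] H) (hD : IsSelfAdjoint D) (x : H) :
    boundedTransform D hD x = D ⟨invSqrtOneAddSq D hD x, invSqrt_mem_domain D hD x⟩ := rfl

/-- A (self-adjoint) operator is affiliated to `N` if it commutes with the commutant of `N`:
`y D ⊆ D y` for all `y ∈ N'`. -/
def IsAffiliated (D : H →ₗ.[ℂ] H) (N : VonNeumannAlgebra H) : Prop :=
  ∀ y ∈ N.commutant, ∀ x : D.domain, ∃ h : y x ∈ D.domain, D ⟨y x, h⟩ = y (D x)

lemma IsAffiliated.mem_graph {D : H →ₗ.[ℂ] H} {N : VonNeumannAlgebra H} (hN : IsAffiliated D N)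
    {y : H →L[ℂ] H} (hy : y ∈ N.commutant) {z w : H} (h : (z, w) ∈ D.graph) :
    (y z, y w) ∈ D.graph := by
  obtain ⟨x, rfl, rfl⟩ := D.mem_graph_iff.1 h
  obtain ⟨h1, h2⟩ := hN y hy x
  exact D.mem_graph_iff.2 ⟨⟨_, h1⟩, rfl, h2⟩

lemma invOneAddSq_commute {D : H →ₗ.[ℂ] H} (hD : IsSelfAdjoint D) {N : VonNeumannAlgebra H}
    (hN : IsAffiliated D N) {y : H →L[ℂ] H} (hy : y ∈ N.commutant) :
    Commute (invOneAddSq D hD) y := by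
  have : CompleteSpace (graphL2 D) := (isClosed_graphL2 hD).completeSpace_coe
  ext x
  have hm : WithLp.toLp 2 (y (invOneAddSq D hD x), y (mulInvOneAddSq D hD x)) ∈ graphL2 D :=
    hN.mem_graph hy (invOneAddSq_mem_graph D hD x)
  have h := Submodule.eq_starProjection_of_mem_of_inner_eq_zero (u := WithLp.toLp 2 (y x, 0)) hm (by
    intro w hw
    have hw' : (w.fst, w.snd) ∈ D.graph := hw
    have h1 := invOneAddSq_inner D hD x (hN.mem_graph (star_mem hy) hw')
    rw [WithLp.prod_inner_apply]
    change inner ℂ (y x - y (invOneAddSq D hD x)) w.fst +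
      inner ℂ (0 - y (mulInvOneAddSq D hD x)) w.snd = 0
    rw [zero_sub, inner_neg_left, ← map_sub]
    rw [ContinuousLinearMap.star_eq_adjoint, ContinuousLinearMap.adjoint_inner_right,
      ContinuousLinearMap.adjoint_inner_right] at h1
    rw [h1, add_neg_cancel])
  exact congrArg WithLp.fst h

lemma boundedTransform_mem {D : H →ₗ.[ℂ] H} (hD : IsSelfAdjoint D) {N : VonNeumannAlgebra H}
    (hN : IsAffiliated D N) : boundedTransform D hD ∈ N := by
  rw [← VonNeumannAlgebra.commutant_commutant N, VonNeumannAlgebra.mem_commutant_iff]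
  intro y hy
  have hc : Commute (invSqrtOneAddSq D hD) y := by
    unfold invSqrtOneAddSq
    rw [CFC.sqrt_eq_real_sqrt _ (invOneAddSq_nonneg D hD)]
    exact (invOneAddSq_commute hD hN hy).cfcₙ_real _
  ext x
  obtain ⟨h1, h2⟩ := hN y hy ⟨_, invSqrt_mem_domain D hD x⟩
  change y (D ⟨_, invSqrt_mem_domain D hD x⟩) = D ⟨_, invSqrt_mem_domain D hD (y x)⟩
  rw [← h2]
  congr 1
  exact Subtype.ext (congrArg (fun T : H →L[ℂ] H => T x) hc.eq).symm

end Unbounded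

section Projections

variable {H : Type*} [NormedAddCommGroup H] [InnerProductSpace ℂ H] [CompleteSpace H]

/-- A von Neumann algebra as a type: the `C⋆`-algebra of its elements. -/
abbrev Elts (N : VonNeumannAlgebra H) : Type _ := N.toStarSubalgebra

instance (N : VonNeumannAlgebra H) : CompleteSpace (Elts N) := by
  have h : IsClosed (N : Set (H →L[ℂ] H)) := by
    rw [← VonNeumannAlgebra.centralizer_centralizer]
    exact Set.isClosed_centralizer _
  exact h.completeSpace_coe

/-- The projection `N(S)` onto the kernel of a bounded operator. -/
noncomputable def kerProj (S : H →L[ℂ] H) : H →L[ℂ] H :=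
  (LinearMap.ker (S : H →ₗ[ℂ] H)).starProjection

/-- The intersection of the images of two projections; the image of a projection `p` is the
kernel of `1 - p`. -/
def imInter (p q : H →L[ℂ] H) : Submodule ℂ H :=
  LinearMap.ker ((1 - p : H →L[ℂ] H) : H →ₗ[ℂ] H) ⊓ LinearMap.ker ((1 - q : H →L[ℂ] H) : H →ₗ[ℂ] H)

instance (p q : H →L[ℂ] H) : CompleteSpace (imInter p q) :=
  ((1 - p).isClosed_ker.inter (1 - q).isClosed_ker).completeSpace_coe

/-- The projection `p ∩ q` onto `Im p ∩ Im q`. -/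
noncomputable def interProj (p q : H →L[ℂ] H) : H →L[ℂ] H := (imInter p q).starProjection

/-- The spectral projection `χ(T)` of a bounded self-adjoint operator `T`, where `χ` is the indicator
function of `[0, ∞)`: the projection onto the kernel of the negative part `max(-T, 0)` of `T`. -/
noncomputable def chiOp (T : H →L[ℂ] H) : H →L[ℂ] H := kerProj (cfc (fun t : ℝ => max (-t) 0) T)

lemma starProjection_mem (N : VonNeumannAlgebra H) (K : Submodule ℂ H) [K.HasOrthogonalProjection]
    (hK : ∀ y ∈ N.commutant, ∀ x ∈ K, y x ∈ K) : K.starProjection ∈ N := by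
  rw [VonNeumannAlgebra.IsStarProjection.mem_iff isStarProjection_starProjection]
  intro y hy
  rw [Submodule.range_starProjection]
  exact fun x hx => hK y hy x hx

lemma commutant_apply {N : VonNeumannAlgebra H} {S y : H →L[ℂ] H} (hS : S ∈ N)
    (hy : y ∈ N.commutant) (x : H) : S (y x) = y (S x) :=
  congrArg (fun T : H →L[ℂ] H => T x) (VonNeumannAlgebra.mem_commutant_iff.1 hy S hS)

lemma kerProj_mem {N : VonNeumannAlgebra H} {S : H →L[ℂ] H} (hS : S ∈ N) : kerProj S ∈ N := by
  refine starProjection_mem N _ fun y hy x hx => ?_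
  have hx' : S x = 0 := hx
  change S (y x) = 0
  rw [commutant_apply hS hy, hx', map_zero]

lemma interProj_mem {N : VonNeumannAlgebra H} {p q : H →L[ℂ] H} (hp : p ∈ N) (hq : q ∈ N) :
    interProj p q ∈ N := by
  refine starProjection_mem N _ fun y hy x hx => ?_
  obtain ⟨h1, h2⟩ := hx
  have h1' : (1 - p) x = 0 := h1
  have h2' : (1 - q) x = 0 := h2
  refine ⟨?_, ?_⟩
  · change (1 - p) (y x) = 0
    rw [commutant_apply (sub_mem (one_mem N) hp) hy, h1', map_zero]
  · change (1 - q) (y x) = 0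
    rw [commutant_apply (sub_mem (one_mem N) hq) hy, h2', map_zero]

lemma cfc_mem {N : VonNeumannAlgebra H} {T : H →L[ℂ] H} (hT : T ∈ N) (f : ℝ → ℝ) :
    cfc f T ∈ N := by
  rw [← VonNeumannAlgebra.commutant_commutant N, VonNeumannAlgebra.mem_commutant_iff]
  intro y hy
  have h : Commute T y := VonNeumannAlgebra.mem_commutant_iff.1 hy T hT
  exact (h.cfc_real f).eq.symm

variable {N : VonNeumannAlgebra H}

/-- `N(S)` as an element of the von Neumann algebra. -/
noncomputable def nullProj (S : Elts N) : Elts N := ⟨kerProj S, kerProj_mem S.2⟩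

/-- `p ∩ q` as an element of the von Neumann algebra. -/
noncomputable def cap (p q : Elts N) : Elts N := ⟨interProj p q, interProj_mem p.2 q.2⟩

/-- `χ(T)` as an element of the von Neumann algebra. -/
noncomputable def chi (T : Elts N) : Elts N := ⟨chiOp T, kerProj_mem (cfc_mem T.2 _)⟩

lemma cap_idem (p q : Elts N) : IsIdempotentElem (cap p q) :=
  Subtype.ext (Submodule.isIdempotentElem_starProjection (imInter p.1 q.1))

lemma mul_cap_left (p q : Elts N) : p * cap p q = cap p q := by
  apply Subtype.ext
  ext x
  have h := ((imInter p.1 q.1).starProjection_apply_mem x).1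
  have h' : (1 - p.1) (interProj p.1 q.1 x) = 0 := h
  exact (sub_eq_zero.1 h').symm

lemma mul_cap_right (p q : Elts N) : q * cap p q = cap p q := by
  apply Subtype.ext
  ext x
  have h := ((imInter p.1 q.1).starProjection_apply_mem x).2
  have h' : (1 - q.1) (interProj p.1 q.1 x) = 0 := h
  exact (sub_eq_zero.1 h').symm

lemma mul_nullProj (S : Elts N) : S * nullProj S = 0 := by
  apply Subtype.ext
  ext x
  exact (LinearMap.ker (S.1 : H →ₗ[ℂ] H)).starProjection_apply_mem x

end Projections

section Index

variable {H : Type*} [NormedAddCommGroup H] [InnerProductSpace ℂ H] [CompleteSpace H]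
  {N : VonNeumannAlgebra H} (J : Ideal (Elts N)) [J.IsTwoSided]

/-- The class `[e] ∈ K₀(J)` of an idempotent `e ∈ J`. -/
noncomputable def idemClass (e : Elts N) (he : IsIdempotentElem e) (hJ : e ∈ J) :
    KZero (idealAlg J) :=
  KZero.ofIdem (⟨e, hJ⟩ : idealAlg J) (Subtype.ext he)

/-- `S ∈ qNp` is a `(q-p)`-Fredholm operator relative to `J`. -/
structure IsFredholm (q p S : Elts N) : Prop where
  left_proj : IsStarProjection q
  right_proj : IsStarProjection p
  corner : q * S * p = S
  left_inv : ∃ T : Elts N, p * T * q = T ∧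
    Ideal.Quotient.mk J (T * S) = Ideal.Quotient.mk J p
  right_inv : ∃ R : Elts N, p * R * q = R ∧
    Ideal.Quotient.mk J (S * R) = Ideal.Quotient.mk J q

variable {J}

lemma IsFredholm.ker_mem {q p S : Elts N} (h : IsFredholm J q p S) : cap (nullProj S) p ∈ J := by
  obtain ⟨T, -, hT⟩ := h.left_inv
  have h1 := J.mul_mem_right (cap (nullProj S) p) (Ideal.Quotient.eq.1 hT)
  rw [sub_mul, mul_cap_right, mul_assoc, ← mul_cap_left (nullProj S) p, ← mul_assoc S,
    mul_nullProj, zero_mul, mul_zero, zero_sub, neg_mem_iff, mul_cap_left] at h1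
  exact h1

lemma IsFredholm.coker_mem {q p S : Elts N} (h : IsFredholm J q p S) :
    cap (nullProj (star S)) q ∈ J := by
  obtain ⟨R, -, hR⟩ := h.right_inv
  set f := cap (nullProj (star S)) q with hf
  have hsf : star f = f := Subtype.ext
    (isStarProjection_starProjection (U := imInter (nullProj (star S)).1 q.1)).isSelfAdjoint
  have h0 : star S * f = 0 := by
    rw [hf, ← mul_cap_left, ← mul_assoc, mul_nullProj, zero_mul]
  have h1 : f * S = 0 := by
    have h2 := congrArg star h0
    rwa [star_mul, star_star, hsf, star_zero] at h2
  have h3 : f * q = f := by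
    have h4 := congrArg star (mul_cap_right (nullProj (star S)) q)
    rwa [star_mul, ← hf, hsf, h.left_proj.isSelfAdjoint.star_eq] at h4
  have h5 := J.mul_mem_left f (Ideal.Quotient.eq.1 hR)
  rw [mul_sub, h3, ← mul_assoc, h1, zero_mul, zero_sub, neg_mem_iff] at h5
  exact h5

/-- The `(q-p)`-index `[N(S) ∩ p] - [N(S*) ∩ q] ∈ K₀(J)` of a `(q-p)`-Fredholm operator. -/
noncomputable def fredholmIndex {q p S : Elts N} (h : IsFredholm J q p S) : KZero (idealAlg J) :=
  idemClass J (cap (nullProj S) p) (cap_idem _ _) h.ker_mem -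
    idemClass J (cap (nullProj (star S)) q) (cap_idem _ _) h.coker_mem

variable (J)

lemma cap_mem_of_norm_lt [hJ : IsClosed (J : Set (Elts N))] {p q : Elts N}
    (h : ‖Ideal.Quotient.mk J p - Ideal.Quotient.mk J q‖ < 1) : cap (1 - p) q ∈ J := by
  set f := cap (1 - p) q with hf
  have h1 : p * f = 0 := by
    have h2 := mul_cap_left (1 - p) q
    rw [sub_mul, one_mul] at h2
    exact sub_eq_self.1 h2
  have h3 : q * f = f := mul_cap_right (1 - p) q
  have h4 : f = (q - p) * f := by rw [sub_mul, h1, h3, sub_zero]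
  have h5 : ‖Ideal.Quotient.mk J f‖ ≤
      ‖Ideal.Quotient.mk J p - Ideal.Quotient.mk J q‖ * ‖Ideal.Quotient.mk J f‖ := by
    conv_lhs => rw [h4, map_mul, map_sub]
    rw [norm_sub_rev]
    exact norm_mul_le _ _
  have h6 : ‖Ideal.Quotient.mk J f‖ = 0 := by
    nlinarith [norm_nonneg (Ideal.Quotient.mk J f)]
  have h7 : f ∈ closure (J : Set (Elts N)) :=
    (QuotientAddGroup.norm_mk_eq_zero_iff_mem_closure (S := J.toAddSubgroup)).1 h6
  rwa [hJ.closure_eq] at h7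

/-- An admissible partition for a path `B` of self-adjoint `J`-Fredholm operators:
`0 = t₀ < t₁ < ⋯ < tₙ = 1` such that `‖π(χ(B_t)) - π(χ(B_s))‖ < 1/2` for all `t`, `s` in the same
subinterval. -/
structure AdmissiblePartition (B : unitInterval → Elts N) where
  n : ℕ
  t : Fin (n + 1) → unitInterval
  strictMono : StrictMono t
  first : t 0 = 0
  last : t (Fin.last n) = 1
  small : ∀ i : Fin n, ∀ r ∈ Set.Icc (t i.castSucc) (t i.succ),
    ∀ s ∈ Set.Icc (t i.castSucc) (t i.succ),
      ‖Ideal.Quotient.mk J (chi (B r)) - Ideal.Quotient.mk J (chi (B s))‖ < 1 / 2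

variable {J}

lemma AdmissiblePartition.norm_lt {B : unitInterval → Elts N} (P : AdmissiblePartition J B)
    (i : Fin P.n) : ‖Ideal.Quotient.mk J (chi (B (P.t i.succ))) -
      Ideal.Quotient.mk J (chi (B (P.t i.castSucc)))‖ < 1 := by
  have hle : P.t i.castSucc ≤ P.t i.succ := P.strictMono.monotone (Fin.castSucc_le_succ i)
  have h := P.small i _ (Set.right_mem_Icc.2 hle) _ (Set.left_mem_Icc.2 hle)
  linarith

/-- The sum `∑ᵢ [(1 - pᵢ) ∩ pᵢ₋₁] - [(1 - pᵢ₋₁) ∩ pᵢ]` with `pᵢ = χ(B_{tᵢ})`. -/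
noncomputable def AdmissiblePartition.flow [IsClosed (J : Set (Elts N))]
    {B : unitInterval → Elts N} (P : AdmissiblePartition J B) : KZero (idealAlg J) :=
  ∑ i : Fin P.n,
    (idemClass J (cap (1 - chi (B (P.t i.succ))) (chi (B (P.t i.castSucc)))) (cap_idem _ _)
        (cap_mem_of_norm_lt J (P.norm_lt i)) -
      idemClass J (cap (1 - chi (B (P.t i.castSucc))) (chi (B (P.t i.succ)))) (cap_idem _ _)
        (cap_mem_of_norm_lt J ((norm_sub_rev _ _).trans_lt (P.norm_lt i))))

/-- `sf{B_t} = y`: the path `B` is a norm continuous path of self-adjoint `J`-Fredholm operators, it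
has an admissible partition, and every admissible partition yields the class `y`. -/
def HasSpectralFlow (J : Ideal (Elts N)) [J.IsTwoSided] [IsClosed (J : Set (Elts N))]
    (B : unitInterval → Elts N) (y : KZero (idealAlg J)) : Prop :=
  Continuous B ∧ (∀ t, IsSelfAdjoint (B t) ∧ IsUnit (Ideal.Quotient.mk J (B t))) ∧
    Nonempty (AdmissiblePartition J B) ∧ ∀ P : AdmissiblePartition J B, P.flow = y

/-- `sf{D_t} = y` for a path of unbounded operators `D_t = D + A_t`, where `A` is a norm continuous
path of self-adjoint elements of `N`: the operators `D_t` are self-adjoint, their bounded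
transforms `F_{D_t}` belong to `N`, and `sf{F_{D_t}} = y`. -/
def HasUnboundedSpectralFlow (J : Ideal (Elts N)) [J.IsTwoSided] [IsClosed (J : Set (Elts N))]
    (D : H →ₗ.[ℂ] H) (Dt : unitInterval → H →ₗ.[ℂ] H) (y : KZero (idealAlg J)) : Prop :=
  (∃ A : unitInterval → Elts N, Continuous A ∧ (∀ t, IsSelfAdjoint (A t)) ∧
    ∀ t, Dt t = D + LinearMap.toPMap ((A t : H →L[ℂ] H) : H →ₗ[ℂ] H) ⊤) ∧
  ∃ (hsa : ∀ t, IsSelfAdjoint (Dt t)) (B : unitInterval → Elts N),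
    (∀ t, (B t : H →L[ℂ] H) = boundedTransform (Dt t) (hsa t)) ∧ HasSpectralFlow J B y

end Index

section SpectralTriple

variable {H : Type*} [NormedAddCommGroup H] [InnerProductSpace ℂ H] [CompleteSpace H]

/-- The bounded operator `R` is the resolvent `(z - D)⁻¹`. -/
def IsResolvent (D : H →ₗ.[ℂ] H) (z : ℂ) (R : H →L[ℂ] H) : Prop :=
  (∀ x : H, ∃ h : R x ∈ D.domain, z • R x - D ⟨R x, h⟩ = x) ∧
    ∀ x : D.domain, R (z • (x : H) - D x) = x

/-- A von Neumann spectral triple `(𝒜, H, D)` relative to `(N, J)`: a representation of the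
`*`-algebra `𝒜` in `N` and a self-adjoint operator `D` affiliated to `N` such that every `a ∈ 𝒜`
preserves the domain of `D`, the commutator `[D, a]` extends to a bounded operator, and
`a (z - D)⁻¹ ∈ J` for all non-real `z` (the resolvent exists as `D` is self-adjoint). -/
structure VNSpectralTriple (𝒜 : Type*) [NonUnitalRing 𝒜] [StarRing 𝒜] [Module ℂ 𝒜]
    (N : VonNeumannAlgebra H) (J : Ideal (Elts N)) where
  /-- The representation of `𝒜` in `N`. -/
  rep : 𝒜 →⋆ₙₐ[ℂ] Elts N
  /-- The operator of the triple. -/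
  D : H →ₗ.[ℂ] H
  selfAdjoint : IsSelfAdjoint D
  affiliated : IsAffiliated D N
  mem_domain : ∀ (a : 𝒜) (x : D.domain), (rep a : H →L[ℂ] H) x ∈ D.domain
  bounded_commutator : ∀ a : 𝒜, ∃ C : H →L[ℂ] H, ∀ x : D.domain,
    C x = D ⟨(rep a : H →L[ℂ] H) x, mem_domain a x⟩ - (rep a : H →L[ℂ] H) (D x)
  resolvent_mem : ∀ (z : ℂ), z.im ≠ 0 → ∀ R : H →L[ℂ] H, IsResolvent D z R →
    ∀ a : 𝒜, ∃ j ∈ J, (j : H →L[ℂ] H) = (rep a : H →L[ℂ] H) * R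

variable {𝒜 : Type*} [NonUnitalRing 𝒜] [StarRing 𝒜] [Module ℂ 𝒜]
  {N : VonNeumannAlgebra H} {J : Ideal (Elts N)}

/-- The triple is unital if the unit of `N` is in (the image of) `𝒜`. -/
def VNSpectralTriple.IsUnital (T : VNSpectralTriple 𝒜 N J) : Prop := ∃ a : 𝒜, T.rep a = 1

/-- The bounded transform `F_D = D (1 + D²)^{-1/2}` as an element of `N`. -/
noncomputable def VNSpectralTriple.F (T : VNSpectralTriple 𝒜 N J) : Elts N :=
  ⟨boundedTransform T.D T.selfAdjoint, boundedTransform_mem T.selfAdjoint T.affiliated⟩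

/-- The operator `u* D u` with its natural domain `{x | u x ∈ dom D}`. -/
noncomputable def conjOp (D : H →ₗ.[ℂ] H) (u : H →L[ℂ] H) : H →ₗ.[ℂ] H where
  domain := D.domain.comap (u : H →ₗ[ℂ] H)
  toFun := ((star u : H →L[ℂ] H) : H →ₗ[ℂ] H) ∘ₗ D.toFun ∘ₗ
    ((u : H →ₗ[ℂ] H).restrict (p := D.domain.comap (u : H →ₗ[ℂ] H)) (q := D.domain)
      fun _ hx => hx)

/-- The path `D_t = (1 - t) D + t u* D u`. -/
noncomputable def conjPath (D : H →ₗ.[ℂ] H) (u : H →L[ℂ] H) (t : unitInterval) : H →ₗ.[ℂ] H :=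
  (((1 - t : ℝ) : ℂ)) • D + ((t : ℝ) : ℂ) • conjOp D u

end SpectralTriple

end VNSpectralFlow

open VNSpectralFlow

/-! The path is a bounded perturbation. As `u` and `u*` preserve the domain of `D` and `[D, u]` is
bounded, `u* D u = D + A` with `A = u* [D, u]`; this `A` is self-adjoint and lies in `N`
(`VNSpectralTriple.exists_conjPerturbation`), so `D_t = D + t A`. Put `R_t = (1 + D_t²)^{-1/2}` and
`F_t = D_t R_t`.

Three analytic facts reduce the problem to projections. The bounded transform is 1-Lipschitz under
bounded perturbations (`IsTransformPair.norm_sub_le`), so `F_t` is norm continuous. The resolvents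
at `±i` put `R_0²` and `F_0 R_0` in `J`, whence `1 - F_t² = R_t²` is in `J` for all `t`
(`sq_mem_of_relation`). Finally `F_t - F_0` is in `J` (`sub_mem_of_relation`): replacing `D` by `ε
D` changes the transform only by an element of `J`, while the transforms of `ε D` and `ε (D + A)`
are at distance at most `ε ‖A‖`, and `J` is closed. The Lipschitz bound comes from a Sylvester
equation for the difference of the unitaries `F_t + i R_t`, tested on almost norming vectors.

When `1 - B²` is in `J`, `2 χ(B) - 1 - B = (2 χ(B) - 1)(1 - |B|)` is in `J` (`two_chi_sub_mem`).
Hence all `χ(F_t)` agree modulo `J`, every partition is admissible, `p_F` and `p` have the same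
image in `N / J`, and the path of projections ends at `χ(u* F u) = u* p u`.

The algebraic core is the relative index `[p - V* V] - [q - V V*]` of a partial isometry `V` from
`p` to `q` that is unitary modulo `J`. By `index_comp` it is additive under composition and sees
only the class of `V` modulo `J`. For the polar part of `q p` it is `[(1 - q) ∩ p] - [(1 - p) ∩ q]`,
one term of the spectral flow; so the sum telescopes to the index of a `W` from `p` to `u* p u` with
`W = p` modulo `J` (`flow_eq_index`). For the polar part `V` of `p u p` it is the Fredholm index,
and an explicit invertible lift shows that it is also the boundary of `π(p u p) + π(1 - p)`
(`indexAux_scalar`). The two are compared through `u* p`, a partial isometry from `p` onto `u* p u`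
without defects: `u* p V = W` modulo `J`, so `W` and `V` have the same index (`index_conj`). -/

namespace VNSpectralFlow

open Matrix

/-! ### Orthogonal sums of idempotents in `K₀` -/

section OrthogonalSums

variable {R : Type*} [Ring R] {ι κ : Type*} [Fintype ι] [Fintype κ]

lemma IsIdempotentElem.add_of_orthogonal {S : Type*} [Ring S] {e f : S} (he : IsIdempotentElem e)
    (hf : IsIdempotentElem f) (hef : e * f = 0) (hfe : f * e = 0) : IsIdempotentElem (e + f) := by
  unfold IsIdempotentElem at *
  rw [add_mul, mul_add, mul_add, he, hf, hef, hfe, add_zero, zero_add]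

lemma KZeroUnital.mk_congr {e f : Matrix ι ι R} (he : IsIdempotentElem e)
    (hf : IsIdempotentElem f) (h : e = f) : KZeroUnital.mk e he = KZeroUnital.mk f hf := by
  subst h; rfl

/-- The row `(e f)` and the column `(e f)ᵗ` multiply to `e + f` in one order and, by orthogonality,
to `diag(e, f)` in the other. -/
lemma KZeroUnital.mk_add {e f : Matrix ι ι R} (he : IsIdempotentElem e)
    (hf : IsIdempotentElem f) (hef : e * f = 0) (hfe : f * e = 0)
    (h : IsIdempotentElem (e + f)) :
    KZeroUnital.mk (e + f) h = KZeroUnital.mk e he + KZeroUnital.mk f hf := by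
  rw [← KZeroUnital.mk_fromBlocks]
  refine KZeroUnital.mk_eq_of_matEquiv _ _ ⟨fromCols e f, fromRows e f, ?_, ?_⟩
  · rw [fromCols_mul_fromRows, he.eq, hf.eq]
  · rw [fromRows_mul_fromCols, he.eq, hf.eq, hef, hfe]

lemma isIdempotentElem_single [DecidableEq ι] (i : ι) {e : R} (he : IsIdempotentElem e) :
    IsIdempotentElem (Matrix.single i i e) := by
  unfold IsIdempotentElem at *
  rw [Matrix.single_mul_single_same, he]

/-- The class of an idempotent of the ring itself. -/
noncomputable def KZeroUnital.ofElem (e : R) (he : IsIdempotentElem e) : KZeroUnital R :=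
  KZeroUnital.mk (Matrix.scalar (Fin 1) e) (he.map (Matrix.scalar (Fin 1)))

lemma KZeroUnital.mk_single [DecidableEq ι] (i : ι) {e : R} (he : IsIdempotentElem e) :
    KZeroUnital.mk (Matrix.single i i e) (isIdempotentElem_single i he) =
      KZeroUnital.ofElem e he := by
  refine KZeroUnital.mk_eq_of_matEquiv _ _
    ⟨Matrix.single i 0 e, Matrix.single 0 i e, ?_, ?_⟩
  · rw [Matrix.single_mul_single_same, he.eq]
  · rw [Matrix.single_mul_single_same, he.eq]
    ext a b
    fin_cases a; fin_cases b
    simp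

lemma KZeroUnital.ofElem_add {e f g : R} (he : IsIdempotentElem e) (hf : IsIdempotentElem f)
    (hef : e * f = 0) (hfe : f * e = 0) (hg : IsIdempotentElem g) (h : g = e + f) :
    KZeroUnital.ofElem g hg = KZeroUnital.ofElem e he + KZeroUnital.ofElem f hf := by
  subst h
  unfold KZeroUnital.ofElem
  rw [← KZeroUnital.mk_add (he.map (Matrix.scalar (Fin 1))) (hf.map (Matrix.scalar (Fin 1)))
    (by rw [← map_mul, hef, map_zero]) (by rw [← map_mul, hfe, map_zero])
    (by rw [← map_add]; exact hg.map (Matrix.scalar (Fin 1)))]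
  exact KZeroUnital.mk_congr _ _ (map_add _ _ _)

lemma KZeroUnital.ofElem_one_sub {e : R} (he : IsIdempotentElem e) :
    KZeroUnital.ofElem (1 - e) he.one_sub =
      KZeroUnital.ofElem 1 IsIdempotentElem.one - KZeroUnital.ofElem e he := by
  rw [eq_sub_iff_add_eq]
  refine (KZeroUnital.ofElem_add _ _ ?_ ?_ _ (by abel)).symm
  · rw [sub_mul, one_mul, he.eq, sub_self]
  · rw [mul_sub, mul_one, he.eq, sub_self]

/-- The product formula behind the equivalence of the idempotents `c d + E` and `c' d' + E` built
from columns `c`, `c'` and rows `d`, `d'` with `d c = d' c' = P`. -/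
lemma vecMulVec_add_mul {c c' d d' : ι → R} {E : Matrix ι ι R} {P : R}
    (hE : IsIdempotentElem E) (h : d' ⬝ᵥ c' = P) (hd : P • d = d) (hc' : E *ᵥ c' = 0)
    (hd' : d' ᵥ* E = 0) :
    (vecMulVec c d' + E) * (vecMulVec c' d + E) = vecMulVec c d + E := by
  rw [add_mul, mul_add, mul_add, vecMulVec_mul_vecMulVec, h, hd, vecMulVec_mul, hd',
    mul_vecMulVec, hc', hE.eq, vecMulVec_zero, zero_vecMulVec, zero_add, add_zero]

end OrthogonalSums

/-! ### Classes of idempotents over the unitization of `J` -/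

section PairClasses

variable {A : Type*} [NormedRing A] [NormedAlgebra ℂ A] (J : Ideal A) [J.IsTwoSided]
  {ι : Type*} [Fintype ι] [DecidableEq ι]

/-- Idempotents over `A` that are equivalent through matrices congruent to the same scalar
idempotent modulo `J` have the same class. -/
lemma mk_pairMat_eq {z : Matrix ι ι ℂ} (hz : IsIdempotentElem z) {x y a b : Matrix ι ι A}
    (hx : matPi J ι x = matPi J ι (scal A ι z)) (hy : matPi J ι y = matPi J ι (scal A ι z))
    (ha : matPi J ι a = matPi J ι (scal A ι z)) (hb : matPi J ι b = matPi J ι (scal A ι z))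
    (hxy : x * y = a) (hyx : y * x = b) (hia : IsIdempotentElem (pairMat J z a ha))
    (hib : IsIdempotentElem (pairMat J z b hb)) :
    KZeroUnital.mk (pairMat J z a ha) hia = KZeroUnital.mk (pairMat J z b hb) hib := by
  refine KZeroUnital.mk_eq_of_matEquiv _ _ ⟨pairMat J z x hx, pairMat J z y hy, ?_, ?_⟩
  · apply matPair_ext <;> simp [hz.eq, hxy]
  · apply matPair_ext <;> simp [hz.eq, hyx]

/-- The element of the unitization defined by an element of the ideal. -/
noncomputable def toPlus (e : A) (h : e ∈ J) : Unitization ℂ (idealAlg J) :=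
  Unitization.inr (⟨e, h⟩ : idealAlg J)

lemma isIdempotentElem_toPlus {e : A} (h : e ∈ J) (he : IsIdempotentElem e) :
    IsIdempotentElem (toPlus J e h) := by
  unfold IsIdempotentElem toPlus at *
  rw [← Unitization.inr_mul]
  congr 1
  exact Subtype.ext he

/-- The class `[e]` of an idempotent `e ∈ J`, in `K₀` of the unitization. -/
noncomputable def plusClass (e : A) (he : IsIdempotentElem e) (h : e ∈ J) :
    KZeroUnital (Unitization ℂ (idealAlg J)) :=
  KZeroUnital.ofElem (toPlus J e h) (isIdempotentElem_toPlus J h he)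

@[simp] lemma fst_toPlus (e : A) (h : e ∈ J) : (toPlus J e h).fst = 0 := rfl

lemma fst_one_sub_toPlus (e : A) (h : e ∈ J) : (1 - toPlus J e h).fst = 1 :=
  sub_zero (1 : ℂ)

@[simp] lemma unitization_toPlus (e : A) (h : e ∈ J) :
    NonUnitalSubalgebra.unitization (idealAlg J) (toPlus J e h) = e := by
  simp [toPlus]

@[simp] lemma matFst_single (i j : ι) (x : Unitization ℂ (idealAlg J)) :
    matFst J ι (Matrix.single i j x) = Matrix.single i j x.fst := by
  simp [matFst]

@[simp] lemma matVal_single (i j : ι) (x : Unitization ℂ (idealAlg J)) :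
    matVal J ι (Matrix.single i j x) =
      Matrix.single i j (NonUnitalSubalgebra.unitization (idealAlg J) x) := by
  simp [matVal]

lemma plusClass_congr {e f : A} (he : IsIdempotentElem e) (h : e ∈ J) (hef : e = f) :
    plusClass J e he h = plusClass J f (hef ▸ he) (hef ▸ h) := by
  subst hef; rfl

end PairClasses
end VNSpectralFlow

namespace VNSpectralFlow

open Matrix

/-! ### The relative index of partial isometries that are unitary modulo `J` -/

section RelativeIndex

set_option linter.unusedSectionVars false

variable {A : Type*} [NormedRing A] [NormedAlgebra ℂ A] [StarRing A] (J : Ideal A) [J.IsTwoSided]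

/-- A partial isometry from `p` to `q` that is unitary modulo `J`. -/
structure IsRelUnitary (p q V : A) : Prop where
  source : IsStarProjection p
  target : IsStarProjection q
  left_mul : q * V = V
  mul_right : V * p = V
  isometry : V * star V * V = V
  source_defect : p - star V * V ∈ J
  target_defect : q - V * star V ∈ J

namespace IsRelUnitary

variable {J} {p q r V W Z : A}

lemma mul_star_left (h : IsRelUnitary J p q V) : p * star V = star V := by
  have := congrArg star h.mul_right
  rwa [star_mul, h.source.isSelfAdjoint.star_eq] at this

lemma star_mul_right (h : IsRelUnitary J p q V) : star V * q = star V := by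
  have := congrArg star h.left_mul
  rwa [star_mul, h.target.isSelfAdjoint.star_eq] at this

lemma star_isometry (h : IsRelUnitary J p q V) : star V * V * star V = star V := by
  have := congrArg star h.isometry
  rwa [star_mul, star_mul, star_star, ← mul_assoc] at this

lemma mul_defect (h : IsRelUnitary J p q V) : V * (p - star V * V) = 0 := by
  rw [mul_sub, h.mul_right, ← mul_assoc, h.isometry, sub_self]

lemma defect_mul_star (h : IsRelUnitary J p q V) : (p - star V * V) * star V = 0 := by
  rw [sub_mul, h.mul_star_left, h.star_isometry, sub_self]

lemma source_idem (h : IsRelUnitary J p q V) : IsIdempotentElem (p - star V * V) := by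
  unfold IsIdempotentElem
  nth_rewrite 1 [sub_mul]
  rw [mul_assoc (star V), h.mul_defect, mul_zero, sub_zero, mul_sub, h.source.isIdempotentElem.eq,
    ← mul_assoc, h.mul_star_left]

lemma symm (h : IsRelUnitary J p q V) : IsRelUnitary J q p (star V) where
  source := h.target
  target := h.source
  left_mul := h.mul_star_left
  mul_right := h.star_mul_right
  isometry := by rw [star_star, h.star_isometry]
  source_defect := by rw [star_star]; exact h.target_defect
  target_defect := by rw [star_star]; exact h.source_defect

lemma target_idem (h : IsRelUnitary J p q V) : IsIdempotentElem (q - V * star V) := by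
  simpa using h.symm.source_idem

/-- The index `[p - V* V] - [q - V V*]`, in `K₀` of the unitization. -/
noncomputable def index (h : IsRelUnitary J p q V) : KZeroUnital (Unitization ℂ (idealAlg J)) :=
  plusClass J _ h.source_idem h.source_defect - plusClass J _ h.target_idem h.target_defect

lemma source_mul_defect (h : IsRelUnitary J p q V) :
    p * (p - star V * V) = p - star V * V := by
  rw [mul_sub, h.source.isIdempotentElem.eq, ← mul_assoc, h.mul_star_left]

lemma defect_mul_source (h : IsRelUnitary J p q V) :
    (p - star V * V) * p = p - star V * V := by
  rw [sub_mul, h.source.isIdempotentElem.eq, mul_assoc, h.mul_right]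

end IsRelUnitary

variable {J} {p q r V W Z : A}

lemma mk_star_mul_self (h : IsRelUnitary J p q V) :
    Ideal.Quotient.mk J (star V) * Ideal.Quotient.mk J V = Ideal.Quotient.mk J p := by
  rw [← map_mul]; exact (Ideal.Quotient.eq.2 h.source_defect).symm

lemma mk_mul_star_self (h : IsRelUnitary J p q V) :
    Ideal.Quotient.mk J V * Ideal.Quotient.mk J (star V) = Ideal.Quotient.mk J q := by
  rw [← map_mul]; exact (Ideal.Quotient.eq.2 h.target_defect).symm

lemma matPi_eq_single_iff {x : Matrix (Fin 3) (Fin 3) A} :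
    matPi J (Fin 3) x = matPi J (Fin 3) (scal A (Fin 3) (Matrix.single 0 0 1)) ↔
      matPi J (Fin 3) x = Matrix.single 0 0 1 := by
  have h : matPi J (Fin 3) (scal A (Fin 3) (Matrix.single 0 0 1)) = Matrix.single 0 0 1 := by
    simp [matPi, scal]
  rw [h]

lemma isIdempotentElem_single_one : IsIdempotentElem (Matrix.single 0 0 1 : Matrix (Fin 3) (Fin 3) ℂ) :=
  isIdempotentElem_single 0 IsIdempotentElem.one

/-- The idempotent `diag(1 - (q - V V*), p - V* V)`, with the second entry in position `i`. -/
lemma mk_single_defects (h : IsRelUnitary J p q V) {i : Fin 3} (hi : i ≠ 0)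
    (e : Matrix (Fin 3) (Fin 3) A)
    (he : e = Matrix.single 0 0 (1 - (q - V * star V)) + Matrix.single i i (p - star V * V))
    (h1 : matPi J (Fin 3) e = matPi J (Fin 3) (scal A (Fin 3) (Matrix.single 0 0 1)))
    (h2 : IsIdempotentElem (pairMat J (Matrix.single 0 0 1) e h1)) :
    KZeroUnital.mk (pairMat J (Matrix.single 0 0 1) e h1) h2 =
      KZeroUnital.ofElem 1 IsIdempotentElem.one + h.index := by
  have hs := isIdempotentElem_toPlus J h.source_defect h.source_idem
  have ht := (isIdempotentElem_toPlus J h.target_defect h.target_idem).one_sub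
  have h3 : pairMat J (Matrix.single 0 0 1) e h1 =
      Matrix.single 0 0 (1 - toPlus J _ h.target_defect) +
        Matrix.single i i (toPlus J _ h.source_defect) := by
    apply matPair_ext
    · simp [fst_one_sub_toPlus]
    · rw [matVal_pairMat, he, map_add, matVal_single, matVal_single, map_sub, map_one,
        unitization_toPlus, unitization_toPlus]
  have h4 : (Matrix.single 0 0 (1 - toPlus J _ h.target_defect) : Matrix (Fin 3) (Fin 3) _) *
      Matrix.single i i (toPlus J _ h.source_defect) = 0 := by
    rw [Matrix.single_mul_single_of_ne _ _ _ _ hi.symm]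
  have h5 : Matrix.single i i (toPlus J _ h.source_defect) *
      (Matrix.single 0 0 (1 - toPlus J _ h.target_defect) : Matrix (Fin 3) (Fin 3) _) = 0 := by
    rw [Matrix.single_mul_single_of_ne _ _ _ _ hi]
  rw [KZeroUnital.mk_congr h2 (h3 ▸ h2) h3,
    KZeroUnital.mk_add (isIdempotentElem_single 0 ht) (isIdempotentElem_single i hs) h4 h5,
    KZeroUnital.mk_single 0 ht, KZeroUnital.mk_single i hs, KZeroUnital.ofElem_one_sub
      (isIdempotentElem_toPlus J h.target_defect h.target_idem)]
  unfold IsRelUnitary.index plusClass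
  abel

/-- Modulo `J` the column and the row have only their entry at `0`, so their product is `r` in the
corner, and adding `1 - r` there gives the scalar idempotent. This lets all four products in
`index_comp` be lifted to the unitization with the same scalar part. -/
lemma matPi_vecMulVec_add {c d : Fin 3 → A} {a b : A ⧸ J}
    (hc : ∀ i, Ideal.Quotient.mk J (c i) = (Pi.single 0 a : Fin 3 → A ⧸ J) i)
    (hd : ∀ i, Ideal.Quotient.mk J (d i) = (Pi.single 0 b : Fin 3 → A ⧸ J) i)
    (hab : a * b = Ideal.Quotient.mk J r) :
    matPi J (Fin 3) (vecMulVec c d + Matrix.single 0 0 (1 - r)) =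
      matPi J (Fin 3) (scal A (Fin 3) (Matrix.single 0 0 1)) := by
  rw [matPi_eq_single_iff]
  have h1 : matPi J (Fin 3) (vecMulVec c d) = Matrix.single 0 0 (a * b) := by
    ext i j
    simp only [matPi, RingHom.mapMatrix_apply, Matrix.map_apply, vecMulVec_apply, map_mul, hc, hd]
    fin_cases i <;> fin_cases j <;> simp [Matrix.single]
  rw [map_add, h1, hab]
  simp only [matPi, RingHom.mapMatrix_apply]
  rw [Matrix.map_single, ← Matrix.single_add]
  simp

/-- The idempotent `a b` over `J`, for a column `a` and a row `b` over `J`, is equivalent to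
`b a`. -/
lemma mk_vecMulVec_eq_plusClass {δ : A} {a b : Fin 3 → A} (ha : ∀ i, a i ∈ J) (hb : ∀ i, b i ∈ J)
    (hδ : δ ∈ J) (hδi : IsIdempotentElem δ) (hba : b ⬝ᵥ a = δ)
    (h : IsIdempotentElem
      (vecMulVec (fun i => toPlus J (a i) (ha i)) (fun i => toPlus J (b i) (hb i)))) :
    KZeroUnital.mk _ h = plusClass J δ hδi hδ := by
  refine KZeroUnital.mk_eq_of_matEquiv _ _ ⟨replicateCol (Fin 1) fun i => toPlus J (a i) (ha i),
    replicateRow (Fin 1) fun i => toPlus J (b i) (hb i), (vecMulVec_eq (Fin 1) _ _).symm, ?_⟩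
  apply matPair_ext
  · ext i j
    fin_cases i; fin_cases j
    simp [matFst, Matrix.mul_apply, Fin.sum_univ_three]
  · ext i j
    fin_cases i; fin_cases j
    refine Eq.trans ?_ (hba.trans (unitization_toPlus J δ hδ).symm)
    simp only [matVal, Matrix.mul_apply, Fin.sum_univ_three, RingHom.mapMatrix_apply,
      Matrix.map_apply, map_add, map_mul, replicateCol_apply, replicateRow_apply, RingHom.coe_coe,
      unitization_toPlus, dotProduct]

lemma ext_single_three {M : Matrix (Fin 3) (Fin 3) A} {x y z : A} (h00 : M 0 0 = x)
    (h01 : M 0 1 = 0) (h02 : M 0 2 = 0) (h10 : M 1 0 = 0) (h11 : M 1 1 = y) (h12 : M 1 2 = 0)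
    (h20 : M 2 0 = 0) (h21 : M 2 1 = 0) (h22 : M 2 2 = z) :
    M = Matrix.single 0 0 x + Matrix.single 2 2 z + Matrix.single 1 1 y := by
  ext i j
  fin_cases i <;> fin_cases j <;> simp [Matrix.single, *]

set_option maxHeartbeats 1000000 in
/-- Additivity of the index under composition up to `J`. -/
theorem index_comp (hV : IsRelUnitary J p q V) (hW : IsRelUnitary J q r W)
    (hZ : IsRelUnitary J p r Z) (hZWV : Z - W * V ∈ J) : hZ.index = hV.index + hW.index := by
  have hzero : ∀ {x : A}, x ∈ J → Ideal.Quotient.mk J x = 0 :=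
    fun hx => Ideal.Quotient.eq_zero_iff_mem.2 hx
  have hpiZ : Ideal.Quotient.mk J Z = Ideal.Quotient.mk J (W * V) := Ideal.Quotient.eq.2 hZWV
  set E : Matrix (Fin 3) (Fin 3) A := Matrix.single 0 0 (1 - r) with hE
  have hEi : IsIdempotentElem E := isIdempotentElem_single 0 hW.target.isIdempotentElem.one_sub
  -- Each column is completed by defects so that `d c = d' c' = p` holds exactly, not just modulo
  -- `J`. Then `c d + E` and `c' d' + E` are equivalent through `c d' + E` and `c' d + E`. The first
  -- is diagonal and carries the index of `Z`; the second involves only `V` and `W`.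
  let c : Fin 3 → A := ![Z, p - star Z * Z, 0]
  let d : Fin 3 → A := ![star Z, p - star Z * Z, 0]
  let c' : Fin 3 → A := ![W * V, p - star V * V, (q - star W * W) * V]
  let d' : Fin 3 → A := ![star V * star W, p - star V * V, star V * (q - star W * W)]
  have hdc : d ⬝ᵥ c = p := by
    simp only [d, c, dotProduct, Fin.sum_univ_three, Matrix.cons_val]
    rw [hZ.source_idem.eq]
    simp
  have hmid : star V * (q - star W * W) * ((q - star W * W) * V) = star V * V - star V * star W * (W * V) := by
    rw [← mul_assoc, mul_assoc (star V), hW.source_idem.eq, mul_sub, hV.star_mul_right, sub_mul]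
    simp only [mul_assoc]
  have hdc' : d' ⬝ᵥ c' = p := by
    simp only [d', c', dotProduct, Fin.sum_univ_three, Matrix.cons_val]
    rw [hV.source_idem.eq, hmid]
    abel
  have hpd : p • d = d := by
    ext i
    fin_cases i
    · exact hZ.mul_star_left
    · exact hZ.source_mul_defect
    · simp [d]
  have hpd' : p • d' = d' := by
    ext i
    fin_cases i
    · change p * (star V * star W) = _
      rw [← mul_assoc, hV.mul_star_left]; rfl
    · exact hV.source_mul_defect
    · change p * (star V * (q - star W * W)) = _
      rw [← mul_assoc, hV.mul_star_left]; rfl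
  have hEv : ∀ v : Fin 3 → A, r * v 0 = v 0 → E *ᵥ v = 0 := by
    intro v hv
    rw [hE, Matrix.single_mulVec, sub_mul, hv]
    simp
  have hvE : ∀ v : Fin 3 → A, v 0 * r = v 0 → v ᵥ* E = 0 := by
    intro v hv
    rw [hE]
    ext j
    fin_cases j <;>
      simp [Matrix.vecMul, dotProduct, Matrix.single, mul_sub, hv]
  have hEc : E *ᵥ c = 0 := hEv _ hZ.left_mul
  have hEc' : E *ᵥ c' = 0 := hEv _ (by
    change r * (W * V) = W * V
    rw [← mul_assoc, hW.left_mul])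
  have hdE : d ᵥ* E = 0 := hvE _ hZ.star_mul_right
  have hdE' : d' ᵥ* E = 0 := hvE _ (by
    change star V * star W * r = star V * star W
    rw [mul_assoc, hW.star_mul_right])
  have hxy := vecMulVec_add_mul (c := c) hEi hdc' hpd hEc' hdE'
  have hyx := vecMulVec_add_mul (c := c') hEi hdc hpd' hEc hdE
  have pc : ∀ i, Ideal.Quotient.mk J (c i) =
      (Pi.single 0 (Ideal.Quotient.mk J Z) : Fin 3 → A ⧸ J) i := by
    intro i
    fin_cases i
    · rfl
    · exact hzero hZ.source_defect
    · exact map_zero _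
  have pd : ∀ i, Ideal.Quotient.mk J (d i) =
      (Pi.single 0 (Ideal.Quotient.mk J (star Z)) : Fin 3 → A ⧸ J) i := by
    intro i
    fin_cases i
    · rfl
    · exact hzero hZ.source_defect
    · exact map_zero _
  have pc' : ∀ i, Ideal.Quotient.mk J (c' i) =
      (Pi.single 0 (Ideal.Quotient.mk J (W * V)) : Fin 3 → A ⧸ J) i := by
    intro i
    fin_cases i
    · rfl
    · exact hzero hV.source_defect
    · exact hzero (J.mul_mem_right _ hW.source_defect)
  have pd' : ∀ i, Ideal.Quotient.mk J (d' i) =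
      (Pi.single 0 (Ideal.Quotient.mk J (star V * star W)) : Fin 3 → A ⧸ J) i := by
    intro i
    fin_cases i
    · rfl
    · exact hzero hV.source_defect
    · exact hzero (J.mul_mem_left _ hW.source_defect)
  have hWV : Ideal.Quotient.mk J (W * V) * Ideal.Quotient.mk J (star V * star W) =
      Ideal.Quotient.mk J r := by
    rw [map_mul, map_mul, mul_assoc, ← mul_assoc (Ideal.Quotient.mk J V), mk_mul_star_self hV,
      ← map_mul, hW.mul_star_left, mk_mul_star_self hW]
  have hZZ := mk_mul_star_self hZ
  -- `J` is not assumed to be stable under `*`, so adjoints cannot be taken in `Z - W V ∈ J`.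
  -- Instead, modulo `J`, both `Z*` and `V* W*` invert `Z = W V` between `p` and `r`, and inverses
  -- are unique.
  have hZ' : Ideal.Quotient.mk J (star Z) = Ideal.Quotient.mk J (star V * star W) := by
    calc Ideal.Quotient.mk J (star Z)
        = Ideal.Quotient.mk J (star Z) * (Ideal.Quotient.mk J (W * V) *
            Ideal.Quotient.mk J (star V * star W)) := by
          rw [hWV, ← map_mul, hZ.star_mul_right]
      _ = Ideal.Quotient.mk J (star V * star W) := by
          rw [← hpiZ, ← mul_assoc, mk_star_mul_self hZ, ← map_mul, ← mul_assoc, hV.mul_star_left]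
  have mcd := matPi_vecMulVec_add (r := r) pc pd hZZ
  have mcd' := matPi_vecMulVec_add (r := r) pc pd' (by rw [hpiZ, hWV])
  have mc'd := matPi_vecMulVec_add (r := r) pc' pd (by rw [← hpiZ, hZZ])
  have mc'd' := matPi_vecMulVec_add pc' pd' hWV
  have i1 := isIdempotentElem_pairMat J mcd isIdempotentElem_single_one
    (vecMulVec_add_mul (c := c) hEi hdc hpd hEc hdE)
  have i2 := isIdempotentElem_pairMat J mc'd' isIdempotentElem_single_one
    (vecMulVec_add_mul (c := c') hEi hdc' hpd' hEc' hdE')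
  have e1 := mk_pairMat_eq J isIdempotentElem_single_one mcd' mc'd mcd mc'd' hxy hyx i1 i2
  have e0 : vecMulVec c d + E =
      Matrix.single 0 0 (1 - (r - Z * star Z)) + Matrix.single 1 1 (p - star Z * Z) := by
    ext i j
    fin_cases i <;> fin_cases j <;>
      simp [vecMulVec, c, d, E, Matrix.single, hZ.mul_defect, hZ.defect_mul_star, hZ.source_idem.eq]
    abel
  rw [mk_single_defects hZ (i := 1) (by decide) _ e0 mcd i1] at e1
  set δ := q - V * star V with hδ
  have hδi : IsIdempotentElem δ := hV.target_idem
  have hδJ : δ ∈ J := hV.target_defect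
  -- The column `w` completes `W` so that `w' w = q`. Cutting by `δ = q - V V*` gives `G = w δ w'`,
  -- an idempotent equivalent to `δ` and orthogonal to `c' d' + E`; adding it fills in what is
  -- missing from a diagonal matrix.
  let w : Fin 3 → A := ![W, 0, q - star W * W]
  let w' : Fin 3 → A := ![star W, 0, q - star W * W]
  let a : Fin 3 → A := fun i => w i * δ
  let b : Fin 3 → A := fun i => δ * w' i
  have ha : ∀ i, a i ∈ J := fun i => J.mul_mem_left _ hδJ
  have hb : ∀ i, b i ∈ J := fun i => J.mul_mem_right _ hδJ
  have hVδ : star V * δ = 0 := by rw [hδ, mul_sub, hV.star_mul_right, ← mul_assoc, hV.star_isometry, sub_self]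
  have hδV : δ * V = 0 := by rw [hδ, sub_mul, hV.left_mul, hV.isometry, sub_self]
  have hqδ : q * δ = δ := by rw [hδ, mul_sub, hV.target.isIdempotentElem.eq, ← mul_assoc, hV.left_mul]
  have hwq : ∀ i, w i * q = w i := by
    intro i
    fin_cases i
    · exact hW.mul_right
    · exact zero_mul _
    · exact hW.defect_mul_source
  have hww : ∀ x y : A, x * star W * (W * y) + x * (q - star W * W) * ((q - star W * W) * y) = x * q * y := by
    intro x y
    rw [← mul_assoc (x * (q - star W * W)), mul_assoc x (q - star W * W), hW.source_idem.eq]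
    noncomm_ring
  have hba : b ⬝ᵥ a = δ := by
    simp only [b, a, w, w', dotProduct, Fin.sum_univ_three, Matrix.cons_val, mul_zero, zero_mul, add_zero]
    rw [hww, mul_assoc, hqδ, hδi.eq]
  have hd'a : d' ⬝ᵥ a = 0 := by
    simp only [d', a, w, dotProduct, Fin.sum_univ_three, Matrix.cons_val, mul_zero, zero_mul, add_zero]
    rw [hww, mul_assoc, hqδ, hVδ]
  have hbc' : b ⬝ᵥ c' = 0 := by
    simp only [c', b, w', dotProduct, Fin.sum_univ_three, Matrix.cons_val, mul_zero, zero_mul, add_zero]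
    rw [hww, mul_assoc, hV.left_mul, hδV]
  have hEa : E *ᵥ a = 0 := hEv _ (by
    change r * (W * δ) = W * δ
    rw [← mul_assoc, hW.left_mul])
  have hbE : b ᵥ* E = 0 := hvE _ (by
    change δ * star W * r = δ * star W
    rw [mul_assoc, hW.star_mul_right])
  let G := vecMulVec (fun i => toPlus J (a i) (ha i)) (fun i => toPlus J (b i) (hb i))
  have hGf : matFst J (Fin 3) G = 0 := by
    ext i j
    simp [matFst, G, vecMulVec]
  have hGv : matVal J (Fin 3) G = vecMulVec a b := by
    ext i j
    simp only [matVal, G, vecMulVec_apply, RingHom.mapMatrix_apply, Matrix.map_apply, map_mul,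
      RingHom.coe_coe, unitization_toPlus]
  have haδ : δ • b = b := by
    ext i
    change δ * (δ * w' i) = δ * w' i
    rw [← mul_assoc, hδi.eq]
  have hGi : IsIdempotentElem G := by
    apply matPair_ext
    · rw [map_mul, hGf, mul_zero]
    · rw [map_mul, hGv, vecMulVec_mul_vecMulVec, hba, haδ]
  set X := pairMat J _ _ mc'd' with hX
  have hXG : X * G = 0 := by
    apply matPair_ext
    · rw [map_mul, hGf, mul_zero, map_zero]
    · rw [map_mul, hGv, hX, matVal_pairMat, add_mul, vecMulVec_mul_vecMulVec, hd'a,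
        mul_vecMulVec, hEa]
      simp
  have hGX : G * X = 0 := by
    apply matPair_ext
    · rw [map_mul, hGf, zero_mul, map_zero]
    · rw [map_mul, hGv, hX, matVal_pairMat, mul_add, vecMulVec_mul_vecMulVec, hbc',
        vecMulVec_mul, hbE]
      simp
  have hT := IsIdempotentElem.add_of_orthogonal i2 hGi hXG hGX
  have e2 := KZeroUnital.mk_add i2 hGi hXG hGX hT
  rw [mk_vecMulVec_eq_plusClass ha hb hδJ hδi hba hGi] at e2
  have hDi : IsIdempotentElem
      (Matrix.single 0 0 (1 - (r - W * star W)) + Matrix.single 2 2 (q - star W * W) :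
        Matrix (Fin 3) (Fin 3) A) :=
    IsIdempotentElem.add_of_orthogonal (isIdempotentElem_single 0 hW.target_idem.one_sub)
      (isIdempotentElem_single 2 hW.source_idem)
      (Matrix.single_mul_single_of_ne _ _ _ _ (by decide) _)
      (Matrix.single_mul_single_of_ne _ _ _ _ (by decide) _)
  have mD : matPi J (Fin 3)
      (Matrix.single 0 0 (1 - (r - W * star W)) + Matrix.single 2 2 (q - star W * W)) =
      matPi J (Fin 3) (scal A (Fin 3) (Matrix.single 0 0 1)) := by
    rw [matPi_eq_single_iff, map_add]
    simp only [matPi, RingHom.mapMatrix_apply, Matrix.map_single]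
    rw [map_sub, hzero hW.target_defect, hzero hW.source_defect]
    simp
  have i3 := isIdempotentElem_pairMat J mD isIdempotentElem_single_one hDi
  have e3 := mk_single_defects hW (i := 2) (by decide) _ rfl mD i3
  have hs := isIdempotentElem_single (1 : Fin 3)
    (isIdempotentElem_toPlus J hV.source_defect hV.source_idem)
  have o1 : pairMat J _ _ mD * Matrix.single 1 1 (toPlus J _ hV.source_defect) = 0 := by
    apply matPair_ext
    · simp
    · rw [map_mul, matVal_pairMat, matVal_single, add_mul,
        Matrix.single_mul_single_of_ne _ _ _ _ (by decide),
        Matrix.single_mul_single_of_ne _ _ _ _ (by decide), map_zero, add_zero]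
  have o2 : Matrix.single 1 1 (toPlus J _ hV.source_defect) * pairMat J _ _ mD = 0 := by
    apply matPair_ext
    · simp
    · rw [map_mul, matVal_pairMat, matVal_single, mul_add,
        Matrix.single_mul_single_of_ne _ _ _ _ (by decide),
        Matrix.single_mul_single_of_ne _ _ _ _ (by decide), map_zero, add_zero]
  have e4 := KZeroUnital.mk_add i3 hs o1 o2 (IsIdempotentElem.add_of_orthogonal i3 hs o1 o2)
  rw [e3, KZeroUnital.mk_single 1 (isIdempotentElem_toPlus J hV.source_defect hV.source_idem)] at e4
  have hsum : X + G = pairMat J _ _ mD + Matrix.single 1 1 (toPlus J _ hV.source_defect) := by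
    apply matPair_ext
    · rw [map_add, hGf, map_add, hX, matFst_pairMat, matFst_pairMat, matFst_single]
      simp
    · rw [map_add, hGv, map_add, hX, matVal_pairMat, matVal_pairMat, matVal_single,
        unitization_toPlus]
      -- `V V* + δ = q`: the contributions of `c' d'` and of `G` to each entry combine into an entry
      -- of `w q w'`, where the defect identities of `W` apply.
      have hmerge : ∀ x y : A, x * V * (star V * y) + x * δ * (δ * y) = x * q * y := by
        intro x y
        rw [← mul_assoc (x * δ), mul_assoc x δ, hδi.eq, hδ]
        noncomm_ring
      have k00 : W * V * (star V * star W) + W * δ * (δ * star W) = W * star W := by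
        rw [hmerge, hW.mul_right]
      have k02 : W * V * (star V * (q - star W * W)) + W * δ * (δ * (q - star W * W)) = 0 := by
        rw [hmerge, hW.mul_right, hW.mul_defect]
      have k20 : (q - star W * W) * V * (star V * star W) +
          (q - star W * W) * δ * (δ * star W) = 0 := by
        rw [hmerge, hW.defect_mul_source, hW.defect_mul_star]
      have k22 : (q - star W * W) * V * (star V * (q - star W * W)) +
          (q - star W * W) * δ * (δ * (q - star W * W)) = q - star W * W := by
        rw [hmerge, hW.defect_mul_source, hW.source_idem.eq]
      have k01 : W * V * (p - star V * V) = 0 := by rw [mul_assoc, hV.mul_defect, mul_zero]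
      have k21 : (q - star W * W) * V * (p - star V * V) = 0 := by
        rw [mul_assoc, hV.mul_defect, mul_zero]
      have k10 : (p - star V * V) * (star V * star W) = 0 := by
        rw [← mul_assoc, hV.defect_mul_star, zero_mul]
      have k12 : (p - star V * V) * (star V * (q - star W * W)) = 0 := by
        rw [← mul_assoc, hV.defect_mul_star, zero_mul]
      have hfin : vecMulVec c' d' + vecMulVec a b =
          Matrix.single 0 0 (W * star W) + Matrix.single 2 2 (q - star W * W) +
            Matrix.single 1 1 (p - star V * V) := by
        refine ext_single_three k00 ?_ k02 ?_ ?_ ?_ k20 ?_ k22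
        · change W * V * (p - star V * V) + W * δ * (δ * 0) = 0
          simp only [k01, mul_zero, add_zero]
        · change (p - star V * V) * (star V * star W) + 0 * δ * (δ * star W) = 0
          simp only [k10, zero_mul, add_zero]
        · change (p - star V * V) * (p - star V * V) + 0 * δ * (δ * 0) = p - star V * V
          simp only [hV.source_idem.eq, mul_zero, zero_mul, add_zero]
        · change (p - star V * V) * (star V * (q - star W * W)) + 0 * δ * (δ * (q - star W * W)) = 0
          simp only [k12, zero_mul, add_zero]
        · change (q - star W * W) * V * (p - star V * V) + (q - star W * W) * δ * (δ * 0) = 0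
          simp only [k21, mul_zero, add_zero]
      have hsplit : (Matrix.single 0 0 (1 - (r - W * star W)) : Matrix (Fin 3) (Fin 3) A) =
          Matrix.single 0 0 (W * star W) + Matrix.single 0 0 (1 - r) := by
        rw [← Matrix.single_add]
        congr 1
        abel
      rw [add_right_comm, hfin, hsplit]
      abel
  have e5 := KZeroUnital.mk_congr hT (IsIdempotentElem.add_of_orthogonal i3 hs o1 o2) hsum
  rw [e2, e4] at e5
  have e6 : hV.index = plusClass J _ hV.source_idem hV.source_defect - plusClass J δ hδi hδJ := rfl
  have e7 : KZeroUnital.ofElem (toPlus J _ hV.source_defect)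
    (isIdempotentElem_toPlus J hV.source_defect hV.source_idem) =
    plusClass J _ hV.source_idem hV.source_defect := rfl
  -- At this point `e5` becomes `[1] + ind Z + [q - V V*] = [1] + ind W + [p - V* V]`, which
  -- rearranges to the claim.
  rw [e7, ← e1] at e5
  rw [e6, ← sub_eq_zero]
  rw [← sub_eq_zero] at e5
  rw [← e5]
  abel

end RelativeIndex
end VNSpectralFlow

namespace VNSpectralFlow

open Matrix

/-! ### The boundary map on partial isometries, and compressions of unitaries -/

section BoundaryIndex

set_option linter.unusedSectionVars false

variable {A : Type*} [NormedRing A] [NormedAlgebra ℂ A] [StarRing A] {J : Ideal A} [J.IsTwoSided]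

lemma matPi_scalar (e : A) : matPi J (Fin 1) (Matrix.scalar (Fin 1) e) =
    Matrix.scalar (Fin 1) (Ideal.Quotient.mk J e) := by
  ext i j
  fin_cases i; fin_cases j
  simp [matPi]

lemma matFst_scalar (x : Unitization ℂ (idealAlg J)) :
    matFst J (Fin 1) (Matrix.scalar (Fin 1) x) = Matrix.scalar (Fin 1) x.fst := by
  ext i j
  fin_cases i; fin_cases j
  simp [matFst]

lemma matVal_scalar (x : Unitization ℂ (idealAlg J)) :
    matVal J (Fin 1) (Matrix.scalar (Fin 1) x) =
      Matrix.scalar (Fin 1) (NonUnitalSubalgebra.unitization (idealAlg J) x) := by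
  ext i j
  fin_cases i; fin_cases j
  simp [matVal]

lemma mk_pairMat_scalar_zero {e : A} (he : IsIdempotentElem e) (hJ : e ∈ J)
    (h : matPi J (Fin 1) (Matrix.scalar (Fin 1) e) = matPi J (Fin 1) (scal A (Fin 1) 0))
    (hi : IsIdempotentElem (pairMat J 0 (Matrix.scalar (Fin 1) e) h)) :
    KZeroUnital.mk _ hi = plusClass J e he hJ := by
  refine KZeroUnital.mk_congr _ _ ?_
  apply matPair_ext
  · rw [matFst_pairMat, matFst_scalar, fst_toPlus, map_zero]
  · rw [matVal_pairMat, matVal_scalar, unitization_toPlus]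

lemma mk_pairMat_scalar_one {e : A} (he : IsIdempotentElem e) (hJ : e ∈ J)
    (h : matPi J (Fin 1) (Matrix.scalar (Fin 1) (1 - e)) = matPi J (Fin 1) (scal A (Fin 1) 1))
    (hi : IsIdempotentElem (pairMat J 1 (Matrix.scalar (Fin 1) (1 - e)) h)) :
    KZeroUnital.mk _ hi =
      KZeroUnital.ofElem 1 IsIdempotentElem.one - plusClass J e he hJ := by
  rw [plusClass, ← KZeroUnital.ofElem_one_sub]
  refine KZeroUnital.mk_congr _ _ ?_
  apply matPair_ext
  · rw [matFst_pairMat, matFst_scalar, fst_one_sub_toPlus, map_one]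
  · rw [matVal_pairMat, matVal_scalar, map_sub (NonUnitalSubalgebra.unitization _), map_one,
      unitization_toPlus]

lemma matPi_eq_of_sub_mem {e : A} {z : Matrix (Fin 1) (Fin 1) ℂ}
    (h : e - algebraMap ℂ A (z 0 0) ∈ J) :
    matPi J (Fin 1) (Matrix.scalar (Fin 1) e) = matPi J (Fin 1) (scal A (Fin 1) z) := by
  ext i j
  fin_cases i; fin_cases j
  simpa [matPi, scal] using Ideal.Quotient.eq.2 h

/-- The index of the class of a partial isometry `Y` that is unitary modulo `J`. -/
theorem indexAux_scalar {Y : A} (h : IsRelUnitary J 1 1 Y) (a : (A ⧸ J)ˣ)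
    (ha : (a : A ⧸ J) = Ideal.Quotient.mk J Y) :
    indexAux J (Units.map (Matrix.scalar (Fin 1) : A ⧸ J →+* Matrix (Fin 1) (Fin 1) (A ⧸ J)).toMonoidHom a) =
      h.index := by
  have hs : (1 - star Y * Y) * (1 - star Y * Y) = 1 - star Y * Y := h.source_idem
  have ht : (1 - Y * star Y) * (1 - Y * star Y) = 1 - Y * star Y := h.target_idem
  have h1 : Y * (1 - star Y * Y) = 0 := h.mul_defect
  have h2 : (1 - star Y * Y) * star Y = 0 := h.defect_mul_star
  have h3 : star Y * (1 - Y * star Y) = 0 := by simpa using h.symm.mul_defect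
  have h4 : (1 - Y * star Y) * Y = 0 := by simpa using h.symm.defect_mul_star
  have hbs : Ideal.Quotient.mk J (1 - star Y * Y) = 0 :=
    Ideal.Quotient.eq_zero_iff_mem.2 h.source_defect
  have hbt : Ideal.Quotient.mk J (1 - Y * star Y) = 0 :=
    Ideal.Quotient.eq_zero_iff_mem.2 h.target_defect
  have hinv : ((a⁻¹ : (A ⧸ J)ˣ) : A ⧸ J) = Ideal.Quotient.mk J (star Y) := by
    refine Units.inv_eq_of_mul_eq_one_right ?_
    rw [ha, mk_mul_star_self h, map_one]
  let s := (Matrix.scalar (Fin 1) : A →+* Matrix (Fin 1) (Fin 1) A)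
  -- For a partial isometry, this matrix built from `Y`, `Y*` and the two defects is invertible on
  -- the nose, and the off-diagonal defects vanish modulo `J`. It conjugates `diag(1, 0)` to `diag(Y
  -- Y*, 1 - Y* Y)`, which is already diagonal.
  let W : (Matrix (Fin 1 ⊕ Fin 1) (Fin 1 ⊕ Fin 1) A)ˣ :=
    ⟨fromBlocks (s Y) (s (1 - Y * star Y)) (s (1 - star Y * Y)) (s (star Y)),
     fromBlocks (s (star Y)) (s (1 - star Y * Y)) (s (1 - Y * star Y)) (s Y), by
      rw [fromBlocks_multiply]
      simp only [← map_mul, ← map_add, hs, ht, h1, h2, h3, h4]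
      simp, by
      rw [fromBlocks_multiply]
      simp only [← map_mul, ← map_add, hs, ht, h1, h2, h3, h4]
      simp⟩
  have hW : IsLift J (Units.map (Matrix.scalar (Fin 1) : A ⧸ J →+* Matrix (Fin 1) (Fin 1) (A ⧸ J)).toMonoidHom a) W := by
    apply Units.ext
    refine (Matrix.fromBlocks_map ..).trans ?_
    change fromBlocks (matPi J (Fin 1) (s Y)) (matPi J (Fin 1) (s _)) (matPi J (Fin 1) (s _))
      (matPi J (Fin 1) (s (star Y))) = fromBlocks (Matrix.scalar (Fin 1) (a : A ⧸ J)) 0 0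
        (Matrix.scalar (Fin 1) ((a⁻¹ : (A ⧸ J)ˣ) : A ⧸ J))
    simp only [s, matPi_scalar, hbs, hbt, map_zero, ha, hinv]
  have hconj : W.val * scal A (Fin 1 ⊕ Fin 1) (pOne (Fin 1)) * (W⁻¹).val =
      fromBlocks (s (1 - (1 - Y * star Y))) 0 0 (s (1 - star Y * Y)) := by
    rw [scal_pOne]
    change fromBlocks _ _ _ _ * _ * fromBlocks _ _ _ _ = _
    rw [fromBlocks_multiply, fromBlocks_multiply]
    simp only [mul_one, mul_zero, add_zero, zero_mul, ← map_mul, hs, h1, h2, sub_sub_cancel,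
      map_zero]
  have m1 : matPi J (Fin 1) (s (1 - (1 - Y * star Y))) = matPi J (Fin 1) (scal A (Fin 1) 1) :=
    matPi_eq_of_sub_mem (by
      have := neg_mem h.target_defect
      simpa using this)
  have m2 : matPi J (Fin 1) (s (1 - star Y * Y)) = matPi J (Fin 1) (scal A (Fin 1) 0) :=
    matPi_eq_of_sub_mem (by simpa using h.source_defect)
  have j1 := isIdempotentElem_pairMat J m1 IsIdempotentElem.one (h.target_idem.one_sub.map s)
  have j2 := isIdempotentElem_pairMat J m2 IsIdempotentElem.zero (h.source_idem.map s)
  have m12 : matPi J (Fin 1 ⊕ Fin 1) (fromBlocks (s (1 - (1 - Y * star Y))) 0 0 (s (1 - star Y * Y))) =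
      matPi J (Fin 1 ⊕ Fin 1) (scal A (Fin 1 ⊕ Fin 1) (fromBlocks 1 0 0 0)) := by
    rw [← hconj]; exact hW.conj hW
  have j12 := isIdempotentElem_pairMat J m12 (isIdempotentElem_pOne (ι := Fin 1))
    (isIdempotentElem_fromBlocks (h.target_idem.one_sub.map s) (h.source_idem.map s))
  have e1 : liftClass J hW = KZeroUnital.mk _ j12 := by
    refine KZeroUnital.mk_congr _ _ ?_
    apply matPair_ext
    · rw [matFst_pairMat, matFst_pairMat]; rfl
    · rw [matVal_pairMat, matVal_pairMat, hconj]
  -- The scalar projection is written as `diag(1 - 0, 0)`, so that the lemmas used for the defects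
  -- apply to it with both defects equal to `0`.
  have n1 : matPi J (Fin 1) (s (1 - 0)) = matPi J (Fin 1) (scal A (Fin 1) 1) :=
    matPi_eq_of_sub_mem (by simp)
  have n2 : matPi J (Fin 1) (s 0) = matPi J (Fin 1) (scal A (Fin 1) 0) :=
    matPi_eq_of_sub_mem (by simp)
  have hz : IsIdempotentElem (0 : A) := IsIdempotentElem.zero
  have k1 := isIdempotentElem_pairMat J n1 IsIdempotentElem.one (hz.one_sub.map s)
  have k2 := isIdempotentElem_pairMat J n2 IsIdempotentElem.zero (hz.map s)
  have hsc : scal A (Fin 1 ⊕ Fin 1) (pOne (Fin 1)) = fromBlocks (s (1 - 0)) 0 0 (s 0) := by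
    rw [scal_pOne, sub_zero, map_one, map_zero]
  have n12 : matPi J (Fin 1 ⊕ Fin 1) (fromBlocks (s (1 - 0)) 0 0 (s 0)) =
      matPi J (Fin 1 ⊕ Fin 1) (scal A (Fin 1 ⊕ Fin 1) (fromBlocks 1 0 0 0)) := by
    rw [← hsc]; rfl
  have k12 := isIdempotentElem_pairMat J n12 (isIdempotentElem_pOne (ι := Fin 1))
    (isIdempotentElem_fromBlocks (hz.one_sub.map s) (hz.map s))
  have e2 : scalarClass J (Fin 1) = KZeroUnital.mk _ k12 := by
    refine KZeroUnital.mk_congr _ _ ?_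
    apply matPair_ext
    · rw [matFst_pairMat, matFst_pairMat]; rfl
    · rw [matVal_pairMat, matVal_pairMat, hsc]
  have z0 : plusClass J (0 : A) hz J.zero_mem + plusClass J (0 : A) hz J.zero_mem =
      plusClass J (0 : A) hz J.zero_mem :=
    (KZeroUnital.ofElem_add _ _ (by rw [← (isIdempotentElem_toPlus J J.zero_mem hz).eq]; ext <;> simp [toPlus]) (by
      ext <;> simp [toPlus]) _ (by ext <;> simp [toPlus])).symm
  rw [indexAux_eq J hW, e1, e2, mk_pairMat_block J m1 m2 m12 j1 j2 j12,
    mk_pairMat_block J n1 n2 n12 k1 k2 k12, mk_pairMat_scalar_one h.target_idem h.target_defect,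
    mk_pairMat_scalar_zero h.source_idem h.source_defect, mk_pairMat_scalar_one hz J.zero_mem,
    mk_pairMat_scalar_zero hz J.zero_mem]
  unfold IsRelUnitary.index
  abel

/-- Adding the identity on the complement of `p` turns `V` into a partial isometry over the whole
algebra with the same two defects, the form in which the boundary map is computed. -/
lemma IsRelUnitary.add_one_sub {p V : A} (h : IsRelUnitary J p p V) :
    IsRelUnitary J 1 1 (V + (1 - p)) ∧ 1 - star (V + (1 - p)) * (V + (1 - p)) = p - star V * V ∧
      1 - (V + (1 - p)) * star (V + (1 - p)) = p - V * star V := by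
  have hst : star (V + (1 - p)) = star V + (1 - p) := by
    rw [star_add, star_sub, star_one, h.source.isSelfAdjoint.star_eq]
  have hp := h.source.isIdempotentElem.eq
  have h1 := h.mul_right
  have h2 := h.left_mul
  have h3 := h.mul_star_left
  have h4 := h.star_mul_right
  have e1 : 1 - star (V + (1 - p)) * (V + (1 - p)) = p - star V * V := by
    rw [hst, add_mul, mul_add, mul_add, mul_sub (star V), sub_mul 1 p V, sub_mul 1 p (1 - p),
      mul_sub p, h4, h2, hp]
    simp
    abel
  have e2 : 1 - (V + (1 - p)) * star (V + (1 - p)) = p - V * star V := by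
    rw [hst, add_mul, mul_add, mul_add, mul_sub V, sub_mul 1 p (star V), sub_mul 1 p (1 - p),
      mul_sub p, h1, h3, hp]
    simp
    abel
  refine ⟨⟨.one _, .one _, one_mul _, mul_one _, ?_, ?_, ?_⟩, e1, e2⟩
  · have e3 : (V + (1 - p)) * star (V + (1 - p)) = 1 - (p - V * star V) := by rw [← e2]; abel
    have hd : (p - V * star V) * V = 0 := by rw [sub_mul, h2, h.isometry, sub_self]
    have hd' : (p - V * star V) * p = p - V * star V := by
      rw [sub_mul, hp, mul_assoc, h4]
    rw [e3, sub_mul, one_mul, mul_add, hd, mul_sub, hd', mul_one]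
    abel
  · rw [e1]; exact h.source_defect
  · rw [e2]; exact h.target_defect

lemma boundary_ofUnit [CompleteSpace A] (a : (A ⧸ J)ˣ) : (boundary J (KOne.ofUnit a) :
    KZeroUnital (Unitization ℂ (idealAlg J))) =
      indexAux J (Units.map (Matrix.scalar (Fin 1) :
        A ⧸ J →+* Matrix (Fin 1) (Fin 1) (A ⧸ J)).toMonoidHom a) := by
  change ((FreeAbelianGroup.lift _ (FreeAbelianGroup.of _) : KZero (idealAlg J)) :
    KZeroUnital (Unitization ℂ (idealAlg J))) = _
  rw [FreeAbelianGroup.lift_apply_of]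

lemma boundary_eq_index [CompleteSpace A] {p V : A} (h : IsRelUnitary J p p V) (a : (A ⧸ J)ˣ)
    (ha : (a : A ⧸ J) = Ideal.Quotient.mk J V + Ideal.Quotient.mk J (1 - p)) :
    (boundary J (KOne.ofUnit a) : KZeroUnital (Unitization ℂ (idealAlg J))) = h.index := by
  obtain ⟨h1, h2, h3⟩ := h.add_one_sub
  rw [boundary_ofUnit, indexAux_scalar h1 a (by rw [ha, map_add])]
  unfold IsRelUnitary.index
  rw [plusClass_congr J h1.source_idem h1.source_defect h2,
    plusClass_congr J h1.target_idem h1.target_defect h3]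


lemma boundary_eq_index_of_sub_mem [CompleteSpace A] {p V S : A} (h : IsRelUnitary J p p V)
    (hVS : V - S ∈ J) (a : (A ⧸ J)ˣ)
    (ha : (a : A ⧸ J) = Ideal.Quotient.mk J S + Ideal.Quotient.mk J (1 - p)) :
    (boundary J (KOne.ofUnit a) : KZeroUnital (Unitization ℂ (idealAlg J))) = h.index :=
  boundary_eq_index h a (by rw [ha, Ideal.Quotient.eq.2 hVS])

lemma mul_compression_of_commute {R : Type*} [Ring R] {P X Y : R} (hP : P * P = P)
    (hX : P * X = X * P) (hYX : Y * X = 1) : P * Y * P * (P * X * P) = P := by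
  calc P * Y * P * (P * X * P) = P * Y * (P * P) * X * P := by simp only [mul_assoc]
    _ = P * Y * (P * X) * P := by rw [hP]; simp only [mul_assoc]
    _ = P * (Y * X) * (P * P) := by rw [hX]; simp only [mul_assoc]
    _ = P := by rw [hYX, mul_one, hP, hP]

lemma mul_compression_of_commute' {R : Type*} [Ring R] {P X Y : R} (hP : P * P = P)
    (hX : P * X = X * P) (hXY : X * Y = 1) : P * X * P * (P * Y * P) = P := by
  calc P * X * P * (P * Y * P) = P * X * (P * P) * Y * P := by simp only [mul_assoc]
    _ = P * (X * P) * Y * P := by rw [hP]; simp only [mul_assoc]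
    _ = P * (P * X) * Y * P := by rw [hX]
    _ = P * P * (X * Y) * P := by simp only [mul_assoc]
    _ = P := by rw [hXY, mul_one, hP, hP]

section Commuting

variable {p U V W : A} (hp : IsStarProjection p) (hU : U ∈ unitary A) (hpU : p * U - U * p ∈ J)
include hp hU hpU

lemma mk_compression_unitary :
    Ideal.Quotient.mk J (star (p * U * p)) * Ideal.Quotient.mk J (p * U * p) =
      Ideal.Quotient.mk J p ∧
    Ideal.Quotient.mk J (p * U * p) * Ideal.Quotient.mk J (star (p * U * p)) =
      Ideal.Quotient.mk J p := by
  have hpp := hp.isIdempotentElem.eq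
  have hmkpp : Ideal.Quotient.mk J p * Ideal.Quotient.mk J p = Ideal.Quotient.mk J p := by
    rw [← map_mul, hpp]
  have hc : Ideal.Quotient.mk J p * Ideal.Quotient.mk J U =
      Ideal.Quotient.mk J U * Ideal.Quotient.mk J p := by
    rw [← map_mul, ← map_mul]; exact Ideal.Quotient.eq.2 hpU
  have hUU : Ideal.Quotient.mk J (star U) * Ideal.Quotient.mk J U = 1 := by
    rw [← map_mul, (Unitary.mem_iff.1 hU).1, map_one]
  have hUU' : Ideal.Quotient.mk J U * Ideal.Quotient.mk J (star U) = 1 := by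
    rw [← map_mul, (Unitary.mem_iff.1 hU).2, map_one]
  have hst : star (p * U * p) = p * star U * p := by
    rw [star_mul, star_mul, hp.isSelfAdjoint.star_eq, mul_assoc]
  rw [hst]
  simp only [map_mul]
  exact ⟨mul_compression_of_commute hmkpp hc hUU, mul_compression_of_commute' hmkpp hc hUU'⟩

/-- The class `π(p U p) + π(1 - p)` is invertible. -/
lemma exists_unit_compression : ∃ a : (A ⧸ J)ˣ,
    (a : A ⧸ J) = Ideal.Quotient.mk J (p * U * p) + Ideal.Quotient.mk J (1 - p) := by
  obtain ⟨h1, h2⟩ := mk_compression_unitary hp hU hpU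
  have hpp := hp.isIdempotentElem.eq
  have k1 : (1 - p) * (p * U * p) = 0 := by
    rw [sub_mul, one_mul, mul_assoc p U p, ← mul_assoc p p, hpp, sub_self]
  have k2 : p * U * p * (1 - p) = 0 := by rw [mul_sub, mul_one, mul_assoc (p * U), hpp, sub_self]
  have k3 : (1 - p) * star (p * U * p) = 0 := by
    have := congrArg star k2
    rwa [star_mul, star_sub, star_one, hp.isSelfAdjoint.star_eq, star_zero] at this
  have k4 : star (p * U * p) * (1 - p) = 0 := by
    have := congrArg star k1
    rwa [star_mul (1 - p), star_sub, star_one, hp.isSelfAdjoint.star_eq, star_zero] at this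
  have k5 : (1 - p) * (1 - p) = 1 - p := hp.isIdempotentElem.one_sub
  refine ⟨⟨_, Ideal.Quotient.mk J (star (p * U * p)) + Ideal.Quotient.mk J (1 - p), ?_, ?_⟩, rfl⟩
  · rw [add_mul, mul_add, mul_add, h2]
    simp only [← map_mul, k2, k3, k5, map_zero, add_zero, zero_add]
    rw [← map_add, add_sub_cancel, map_one]
  · rw [add_mul, mul_add, mul_add, h1]
    simp only [← map_mul, k1, k4, k5, map_zero, add_zero, zero_add]
    rw [← map_add, add_sub_cancel, map_one]

lemma compression_sub_mem : star (p * U * p) * (p * U * p) - p ∈ J ∧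
    p * U * p * star (p * U * p) - p ∈ J := by
  obtain ⟨h1, h2⟩ := mk_compression_unitary hp hU hpU
  rw [← map_mul] at h1 h2
  exact ⟨Ideal.Quotient.eq.1 h1, Ideal.Quotient.eq.1 h2⟩

lemma isStarProjection_conj_of_commute :
    IsStarProjection (star U * p * U) ∧ p - star U * p * U ∈ J := by
  have hpp := hp.isIdempotentElem.eq
  have hU2 := (Unitary.mem_iff.1 hU).2
  refine ⟨⟨?_, ?_⟩, ?_⟩
  · unfold IsIdempotentElem
    calc _ = star U * p * (U * star U) * p * U := by noncomm_ring
      _ = star U * (p * p) * U := by rw [hU2]; noncomm_ring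
      _ = _ := by rw [hpp]
  · unfold IsSelfAdjoint
    rw [star_mul, star_mul, star_star, hp.isSelfAdjoint.star_eq, mul_assoc]
  · have e : p - star U * p * U = -(star U * (p * U - U * p)) := by
      rw [mul_sub, ← mul_assoc, ← mul_assoc, (Unitary.mem_iff.1 hU).1, one_mul, neg_sub]
    rw [e]
    exact neg_mem (J.mul_mem_left _ hpU)

lemma sub_mem_of_sub_mul_mem (hW : W - star U * p * U * p ∈ J) : W - p ∈ J := by
  have h := J.mul_mem_right p (isStarProjection_conj_of_commute hp hU hpU).2
  rw [sub_mul, hp.isIdempotentElem.eq] at h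
  have := J.sub_mem hW h
  rwa [sub_sub_sub_cancel_right] at this

/-- `U* p` is a partial isometry from `p` onto `U* p U` with zero defects, hence of index `0`.
Modulo `J`, `U* p V = U* p U p = p = W`, so additivity gives the index of `W` as the index of `V`
plus `0`. -/
lemma index_conj (hV : IsRelUnitary J p p V) (hVS : V - p * U * p ∈ J)
    (hW : IsRelUnitary J p (star U * p * U) W) (hWp : W - p ∈ J) : hW.index = hV.index := by
  have hpp := hp.isIdempotentElem.eq
  have hU2 := (Unitary.mem_iff.1 hU).2
  obtain ⟨hq, hpq⟩ := isStarProjection_conj_of_commute hp hU hpU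
  have hst : star (star U * p) = p * U := by
    rw [star_mul, star_star, hp.isSelfAdjoint.star_eq]
  have e1 : star (star U * p) * (star U * p) = p := by
    rw [hst, mul_assoc, ← mul_assoc U, hU2, one_mul, hpp]
  have e2 : star U * p * star (star U * p) = star U * p * U := by
    rw [hst, ← mul_assoc, mul_assoc (star U), hpp]
  have hR : IsRelUnitary J p (star U * p * U) (star U * p) := by
    refine ⟨hp, hq, ?_, ?_, ?_, ?_, ?_⟩
    · rw [mul_assoc, ← mul_assoc U, hU2, one_mul, mul_assoc, hpp]
    · rw [mul_assoc, hpp]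
    · rw [mul_assoc, e1, mul_assoc, hpp]
    · rw [e1, sub_self]; exact J.zero_mem
    · rw [e2, sub_self]; exact J.zero_mem
  have hR0 : hR.index = 0 := by
    unfold IsRelUnitary.index
    rw [plusClass_congr J hR.source_idem hR.source_defect (f := 0) (by rw [e1, sub_self]),
      plusClass_congr J hR.target_idem hR.target_defect (f := 0) (by rw [e2, sub_self]), sub_self]
  rw [index_comp hV hR hW, hR0, add_zero]
  have e3 : W - star U * p * V = (W - p) - star U * p * (V - p * U * p) +
      (p - star U * p * U) * p := by
    rw [mul_sub, sub_mul, hpp, ← mul_assoc (star U * p), ← mul_assoc (star U * p),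
      mul_assoc (star U) p p, hpp]
    abel
  rw [e3]
  exact J.add_mem (J.sub_mem hWp (J.mul_mem_left _ hVS)) (J.mul_mem_right _ hpq)

end Commuting

end BoundaryIndex
end VNSpectralFlow

namespace VNSpectralFlow

/-! ### Kernel projections and polar decomposition in `B(H)` -/

section Polar

variable {H : Type*} [NormedAddCommGroup H] [InnerProductSpace ℂ H] [CompleteSpace H]

lemma isStarProjection_kerProj (S : H →L[ℂ] H) : IsStarProjection (kerProj S) :=
  isStarProjection_starProjection

lemma kerProj_apply_eq_self_iff {S : H →L[ℂ] H} {x : H} : kerProj S x = x ↔ S x = 0 :=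
  Submodule.starProjection_eq_self_iff

lemma mul_kerProj (S : H →L[ℂ] H) : S * kerProj S = 0 := by
  ext x
  exact (LinearMap.ker (S : H →ₗ[ℂ] H)).starProjection_apply_mem x

lemma kerProj_mul_eq_self {S T : H →L[ℂ] H} (h : S * T = 0) : kerProj S * T = T := by
  ext x
  exact kerProj_apply_eq_self_iff.2 (congrArg (fun f : H →L[ℂ] H => f x) h)

/-- Star projections with the same fixed points agree. -/
lemma IsStarProjection.eq_of_mul_eq {R : Type*} [Ring R] [StarRing R] {e f : R}
    (he : IsStarProjection e) (hf : IsStarProjection f) (hef : e * f = f) (hfe : f * e = e) :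
    e = f := by
  have := congrArg star hfe
  rw [star_mul, he.isSelfAdjoint.star_eq, hf.isSelfAdjoint.star_eq, hef] at this
  exact this.symm

lemma kerProj_eq {S e : H →L[ℂ] H} (he : IsStarProjection e) (h : ∀ x, S x = 0 ↔ e x = x) :
    kerProj S = e := by
  refine IsStarProjection.eq_of_mul_eq (isStarProjection_kerProj S) he ?_ ?_
  · refine kerProj_mul_eq_self ?_
    ext x
    exact (h _).2 (congrArg (fun f : H →L[ℂ] H => f x) he.isIdempotentElem.eq)
  · ext x
    exact (h _).1 (congrArg (fun f : H →L[ℂ] H => f x) (mul_kerProj S))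

omit [CompleteSpace H] in
lemma mul_left_cancel_of_injective {e X Y : H →L[ℂ] H} (he : Function.Injective e)
    (h : e * X = e * Y) : X = Y := by
  ext x
  exact he (congrArg (fun f : H →L[ℂ] H => f x) h)

/-- A self-adjoint injective operator has dense range, so it can also be cancelled on the right;
here this follows from left cancellation by passing to adjoints. It replaces composition with
unbounded inverses such as `(1 + D²)^{1/2}` below. -/
lemma mul_right_cancel_of_injective {e X Y : H →L[ℂ] H} (he : Function.Injective e)
    (hsa : IsSelfAdjoint e) (h : X * e = Y * e) : X = Y := by
  refine star_injective (mul_left_cancel_of_injective he ?_)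
  have := congrArg star h
  rwa [star_mul, star_mul, hsa.star_eq] at this

lemma denseRange_of_injective {e : H →L[ℂ] H} (he : Function.Injective e)
    (hsa : IsSelfAdjoint e) : DenseRange e := by
  have h : (LinearMap.range (e : H →ₗ[ℂ] H)).topologicalClosure = ⊤ := by
    rw [Submodule.topologicalClosure_eq_top_iff]
    have h1 := ContinuousLinearMap.orthogonal_range e
    rw [ContinuousLinearMap.isSelfAdjoint_iff'.1 hsa] at h1
    exact h1.trans (LinearMap.ker_eq_bot.2 he)
  exact (Submodule.dense_iff_topologicalClosure_eq_top).2 h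

lemma inner_star_mul_self (S : H →L[ℂ] H) (x : H) :
    inner ℂ ((star S * S) x) x = ((‖S x‖ ^ 2 : ℝ) : ℂ) := by
  change inner ℂ ((ContinuousLinearMap.adjoint S) (S x)) x = _
  rw [ContinuousLinearMap.adjoint_inner_left, inner_self_eq_norm_sq_to_K]
  norm_cast

lemma norm_apply_eq_of_star_mul_self_eq {S T : H →L[ℂ] H} (h : star S * S = star T * T) (x : H) :
    ‖S x‖ = ‖T x‖ := by
  have h1 := inner_star_mul_self S x
  rw [h, inner_star_mul_self] at h1
  have h2 : ‖T x‖ ^ 2 = ‖S x‖ ^ 2 := by exact_mod_cast h1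
  exact ((sq_eq_sq₀ (norm_nonneg _) (norm_nonneg _)).1 h2).symm

/-- Polar decomposition of a bounded operator. -/
lemma exists_polar (S : H →L[ℂ] H) : ∃ V A : H →L[ℂ] H, 0 ≤ A ∧ A * A = star S * S ∧
    V * A = S ∧ star V * V = 1 - kerProj S ∧ V * star V = 1 - kerProj (star S) ∧
    (∀ y, Commute y S → Commute y (star S * S) → Commute y (kerProj S) → Commute y V) := by
  set A := CFC.sqrt (star S * S) with hA
  have hA0 : 0 ≤ A := CFC.sqrt_nonneg _
  have hAA : A * A = star S * S := CFC.sqrt_mul_sqrt_self _ (star_mul_self_nonneg S)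
  have hAsa : IsSelfAdjoint A := hA0.isSelfAdjoint
  set P := kerProj S with hP
  have hPsa : IsSelfAdjoint P := (isStarProjection_kerProj S).isSelfAdjoint
  have hPP : P * P = P := (isStarProjection_kerProj S).isIdempotentElem
  have hnorm : ∀ x, ‖A x‖ = ‖S x‖ := fun x =>
    norm_apply_eq_of_star_mul_self_eq (by rw [hAsa.star_eq, hAA]) x
  have hAP : A * P = 0 := by
    ext x
    have h1 : S (P x) = 0 := congrArg (fun f : H →L[ℂ] H => f x) (mul_kerProj S)
    have h2 := hnorm (P x)
    rw [h1, norm_zero, norm_eq_zero] at h2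
    exact h2
  have hPA : P * A = 0 := by
    have := congrArg star hAP
    rwa [star_mul, hPsa.star_eq, hAsa.star_eq, star_zero] at this
  -- `A = |S|` may have a kernel. Adding the projection `P` onto the kernel of `S`, which is
  -- orthogonal to `A`, makes the operator injective, so that its range is dense.
  set e := A + P with he
  have hesa : IsSelfAdjoint e := hAsa.add hPsa
  have heP : P * e = P := by rw [he, mul_add, hPA, hPP, zero_add]
  have heA : A * e = A * A := by rw [he, mul_add, hAP, add_zero]
  have einj : Function.Injective e := by
    rw [injective_iff_map_eq_zero]
    intro x hx
    have h1 : P x = 0 := by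
      have := congrArg (fun f : H →L[ℂ] H => f x) heP
      change P (e x) = P x at this
      rw [← this, hx, map_zero]
    have h2 : A x = 0 := by
      have : A x + P x = 0 := hx
      rwa [h1, add_zero] at this
    have h3 : S x = 0 := by rw [← norm_eq_zero, ← hnorm, h2, norm_zero]
    rw [← kerProj_apply_eq_self_iff.2 h3]
    exact h1
  have hle : ∀ x, ‖S x‖ ≤ 1 * ‖e x‖ := by
    intro x
    rw [one_mul, ← hnorm]
    have h0 : inner ℂ (A x) (P x) = 0 := by
      have h1 := ContinuousLinearMap.adjoint_inner_left P x (A x)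
      rw [ContinuousLinearMap.isSelfAdjoint_iff'.1 hPsa] at h1
      have h2 : P (A x) = 0 := congrArg (fun f : H →L[ℂ] H => f x) hPA
      rw [← h1, h2, inner_zero_left]
    have h1 := norm_add_sq_eq_norm_sq_add_norm_sq_of_inner_eq_zero _ _ h0
    have h2 : e x = A x + P x := rfl
    rw [h2]
    nlinarith [norm_nonneg (A x), norm_nonneg (A x + P x), mul_self_nonneg ‖P x‖]
  -- `V` is the continuous extension of `e x ↦ S x`, bounded because `‖S x‖ = ‖A x‖ ≤ ‖e x‖`. It
  -- vanishes on the range of `P`, which makes it the polar part of `S`.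
  let V : H →L[ℂ] H := (S : H →ₗ[ℂ] H).extendOfNorm (e : H →ₗ[ℂ] H)
  have hVe : V * e = S := by
    ext x
    exact LinearMap.extendOfNorm_eq (f := (S : H →ₗ[ℂ] H)) (e := (e : H →ₗ[ℂ] H))
      (denseRange_of_injective einj hesa) ⟨1, hle⟩ x
  have hVP : V * P = 0 := by
    have h1 : e * P = P := by rw [he, add_mul, hAP, hPP, zero_add]
    rw [← h1, ← mul_assoc, hVe, mul_kerProj]
  have hVA : V * A = S := by
    rw [← hVe, he, mul_add, hVP, add_zero]
  have hVV : star V * V = 1 - P := by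
    refine mul_right_cancel_of_injective einj hesa ?_
    have h1 : star V * S = A := by
      refine mul_left_cancel_of_injective einj ?_
      rw [← mul_assoc]
      have h2 : e * star V = star S := by rw [← hVe, star_mul, hesa.star_eq]
      rw [h2, ← hAA, he, add_mul, hPA, add_zero]
    rw [mul_assoc, hVe, h1, sub_mul, one_mul, heP, he, add_sub_cancel_right]
  have hVVV : V * star V * V = V := by
    rw [mul_assoc, hVV, mul_sub, mul_one, hVP, sub_zero]
  refine ⟨V, A, hA0, hAA, hVA, hVV, ?_, ?_⟩
  · have h1 : IsStarProjection (1 - V * star V) := by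
      refine IsStarProjection.one_sub ⟨?_, ?_⟩
      · unfold IsIdempotentElem
        rw [← mul_assoc, hVVV]
      · exact IsSelfAdjoint.mul_star_self V
    rw [kerProj_eq h1, sub_sub_cancel]
    intro x
    have h2 : (1 - V * star V) x = x ↔ V (star V x) = 0 := by
      change x - V (star V x) = x ↔ _
      exact sub_eq_self
    rw [h2]
    constructor
    · intro hx
      have h3 : A (star V x) = 0 := by
        have : star S = A * star V := by rw [← hVA, star_mul, hAsa.star_eq]
        rw [this] at hx
        exact hx
      have h4 : S (star V x) = 0 := by rw [← norm_eq_zero, ← hnorm, h3, norm_zero]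
      have h5 := kerProj_apply_eq_self_iff.2 h4
      rw [← h5]
      exact congrArg (fun f : H →L[ℂ] H => f (star V x)) hVP
    · intro hx
      have h3 : star S * (V * star V) = star S := by
        rw [← hVA, star_mul, mul_assoc, ← mul_assoc (star V), hVV, sub_mul, one_mul]
        have : P * star V = 0 := by
          have := congrArg star hVP
          rwa [star_mul, hPsa.star_eq, star_zero] at this
        rw [this, sub_zero]
      rw [← h3]
      change star S (V (star V x)) = 0
      rw [hx, map_zero]
  -- `V` is determined by `V e = S` with `e` cancellable, so whatever commutes with `S` and `e`
  -- commutes with `V`. This is how `V` is seen to lie in a von Neumann algebra containing `S`.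
  · intro y hy hyS hyP
    have hyA : Commute y A := by
      rw [hA, CFC.sqrt_eq_real_sqrt _ (star_mul_self_nonneg S)]
      exact (hyS.symm.cfcₙ_real _).symm
    have hye : Commute y e := hyA.add_right hyP
    refine mul_right_cancel_of_injective einj hesa ?_
    rw [mul_assoc, hVe, hy.eq, mul_assoc, hye.eq, ← mul_assoc, hVe]

end Polar
end VNSpectralFlow

namespace VNSpectralFlow

/-! ### Polar decomposition in a von Neumann algebra, modulo `J` -/

section RelativePolar

variable {H : Type*} [NormedAddCommGroup H] [InnerProductSpace ℂ H] [CompleteSpace H]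
  {N : VonNeumannAlgebra H}

lemma isStarProjection_coe {e : Elts N} : IsStarProjection (e : H →L[ℂ] H) ↔ IsStarProjection e :=
  ⟨fun h => ⟨Subtype.ext h.isIdempotentElem, Subtype.ext h.isSelfAdjoint⟩,
    fun h => ⟨congrArg Subtype.val h.isIdempotentElem.eq, congrArg Subtype.val h.isSelfAdjoint.star_eq⟩⟩

lemma isStarProjection_nullProj (S : Elts N) : IsStarProjection (nullProj S) :=
  isStarProjection_coe.1 (isStarProjection_kerProj _)

lemma isStarProjection_chi (S : Elts N) : IsStarProjection (chi S) :=
  isStarProjection_coe.1 (isStarProjection_kerProj _)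

lemma isStarProjection_cap (p q : Elts N) : IsStarProjection (cap p q) :=
  isStarProjection_coe.1 isStarProjection_starProjection

lemma cap_mul_eq_self {p q x : Elts N} (hp : p * x = x) (hq : q * x = x) : cap p q * x = x := by
  apply Subtype.ext
  ext v
  refine Submodule.starProjection_eq_self_iff.2 ⟨?_, ?_⟩
  · change (x : H →L[ℂ] H) v - (p : H →L[ℂ] H) ((x : H →L[ℂ] H) v) = 0
    rw [sub_eq_zero]
    exact (congrArg (fun f : Elts N => (f : H →L[ℂ] H) v) hp).symm
  · change (x : H →L[ℂ] H) v - (q : H →L[ℂ] H) ((x : H →L[ℂ] H) v) = 0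
    rw [sub_eq_zero]
    exact (congrArg (fun f : Elts N => (f : H →L[ℂ] H) v) hq).symm

lemma nullProj_mul_eq_self {S x : Elts N} (h : S * x = 0) : nullProj S * x = x :=
  Subtype.ext (kerProj_mul_eq_self (congrArg Subtype.val h))

lemma eq_cap_iff {e p q : Elts N} (he : IsStarProjection e) (hp : p * e = e) (hq : q * e = e)
    (h : ∀ x, p * x = x → q * x = x → e * x = x) : cap p q = e :=
  IsStarProjection.eq_of_mul_eq (isStarProjection_cap p q) he (cap_mul_eq_self hp hq)
    (h _ (mul_cap_left p q) (mul_cap_right p q))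

/-- The inverse commutes with everything its element commutes with, so it stays in the double
commutant. Thus denominators such as `1 + A` with `A ≥ 0` can be divided out inside `N`, hence
inside `J`. -/
lemma exists_inv_of_isUnit {x : Elts N} (hx : IsUnit (x : H →L[ℂ] H)) :
    ∃ y : Elts N, x * y = 1 ∧ y * x = 1 := by
  obtain ⟨w, hw⟩ := hx
  have hm : (w⁻¹ : (H →L[ℂ] H)ˣ).val ∈ N := by
    rw [← VonNeumannAlgebra.commutant_commutant N, VonNeumannAlgebra.mem_commutant_iff]
    intro y hy
    have h : Commute (w : H →L[ℂ] H) y := by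
      rw [hw]
      exact VonNeumannAlgebra.mem_commutant_iff.1 hy x x.2
    exact (h.units_inv_left).eq.symm
  refine ⟨⟨_, hm⟩, Subtype.ext ?_, Subtype.ext ?_⟩
  · change (x : H →L[ℂ] H) * (w⁻¹ : (H →L[ℂ] H)ˣ).val = 1
    rw [← hw, Units.mul_inv]
  · change (w⁻¹ : (H →L[ℂ] H)ˣ).val * (x : H →L[ℂ] H) = 1
    rw [← hw, Units.inv_mul]

lemma isUnit_one_add {A : H →L[ℂ] H} (hA : 0 ≤ A) : IsUnit (1 + A) :=
  CStarAlgebra.isUnit_of_le (1 : H →L[ℂ] H) (le_add_of_nonneg_right hA)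

lemma commute_of_mem_commutant {y : H →L[ℂ] H} (hy : y ∈ N.commutant) (x : Elts N) :
    Commute y (x : H →L[ℂ] H) :=
  (VonNeumannAlgebra.mem_commutant_iff.1 hy x x.2).symm

/-- Polar decomposition in a von Neumann algebra. -/
lemma exists_polar_elts (S : Elts N) : ∃ V A : Elts N, 0 ≤ (A : H →L[ℂ] H) ∧ A * A = star S * S ∧
    V * A = S ∧ star V * V = 1 - nullProj S ∧ V * star V = 1 - nullProj (star S) := by
  obtain ⟨V, A, hA0, hAA, hVA, h1, h2, hc⟩ := exists_polar (S : H →L[ℂ] H)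
  have hV : V ∈ N := by
    rw [← VonNeumannAlgebra.commutant_commutant N, VonNeumannAlgebra.mem_commutant_iff]
    intro y hy
    exact (hc y (commute_of_mem_commutant hy S) (commute_of_mem_commutant hy (star S * S))
      (commute_of_mem_commutant hy (nullProj S))).eq
  have hVS : star V * S = A := by
    rw [← hVA, ← mul_assoc, h1, sub_mul, one_mul, sub_eq_self]
    have h3 : A * A * kerProj (S : H →L[ℂ] H) = 0 := by rw [hAA, mul_assoc, mul_kerProj, mul_zero]
    have h4 : star (A * kerProj (S : H →L[ℂ] H)) * (A * kerProj (S : H →L[ℂ] H)) = 0 := by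
      rw [star_mul, hA0.isSelfAdjoint.star_eq, mul_assoc, ← mul_assoc A, h3, mul_zero]
    have h5 := congrArg star (CStarRing.star_mul_self_eq_zero_iff _ |>.1 h4)
    rwa [star_mul, hA0.isSelfAdjoint.star_eq, (isStarProjection_kerProj _).isSelfAdjoint.star_eq,
      star_zero] at h5
  -- The absolute value is taken in the form `V* S`, which is visibly an element of `N`.
  refine ⟨⟨V, hV⟩, star ⟨V, hV⟩ * S, ?_, ?_, ?_, Subtype.ext h1, Subtype.ext h2⟩
  · exact hA0.trans_eq hVS.symm
  · apply Subtype.ext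
    change star V * S * (star V * S) = star (S : H →L[ℂ] H) * S
    rw [hVS, hAA]
  · apply Subtype.ext
    change V * (star V * S) = (S : H →L[ℂ] H)
    rw [hVS, hVA]

variable {J : Ideal (Elts N)} [J.IsTwoSided] {p q S : Elts N}

/-- The partial isometry in the polar decomposition of an element of `q N p` that is unitary
modulo `J`. -/
lemma exists_isRelUnitary (hp : IsStarProjection p) (hq : IsStarProjection q) (hS : q * S * p = S)
    (h1 : star S * S - p ∈ J) (h2 : S * star S - q ∈ J) :
    ∃ V, IsRelUnitary J p q V ∧ V - S ∈ J ∧ p - star V * V = cap (nullProj S) p ∧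
      q - V * star V = cap (nullProj (star S)) q := by
  obtain ⟨V, A, hA0, hAA, hVA, hVV, hVV'⟩ := exists_polar_elts S
  have hpp := hp.isIdempotentElem.eq
  have hqq := hq.isIdempotentElem.eq
  have hSp : S * p = S := by rw [← hS, mul_assoc, hpp]
  have hqS : q * S = S := by rw [← hS, mul_assoc, ← mul_assoc q, hqq]
  have hSq : star S * q = star S := by
    have := congrArg star hqS
    rwa [star_mul, hq.isSelfAdjoint.star_eq] at this
  -- `T r = T` says that `1 - r` lies under the kernel projection of `T`. The two projections
  -- therefore commute, and their product is the meet.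
  have hcap : ∀ (T r : Elts N), IsStarProjection r → T * r = T →
      r - (1 - nullProj T) = cap (nullProj T) r ∧ (1 - nullProj T) * r = 1 - nullProj T := by
    intro T r hr hT
    have hrr := hr.isIdempotentElem.eq
    have hnn := (isStarProjection_nullProj T).isIdempotentElem.eq
    have e1 : nullProj T * (1 - r) = 1 - r := nullProj_mul_eq_self (by rw [mul_sub, hT, mul_one, sub_self])
    have e1' : (1 - r) * nullProj T = 1 - r := by
      have := congrArg star e1
      rwa [star_mul, star_sub, star_one, hr.isSelfAdjoint.star_eq,
        (isStarProjection_nullProj T).isSelfAdjoint.star_eq] at this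
    have e2 : nullProj T * r = r - (1 - nullProj T) := by
      rw [mul_sub, mul_one] at e1
      rw [← sub_eq_zero]
      rw [← sub_eq_zero] at e1
      rw [← neg_eq_zero, ← e1]
      abel
    have e3 : r * nullProj T = nullProj T * r := by
      rw [e2]
      rw [sub_mul, one_mul] at e1'
      rw [← sub_eq_zero]
      rw [← sub_eq_zero] at e1'
      rw [← neg_eq_zero, ← e1']
      abel
    constructor
    · rw [← e2]
      refine (eq_cap_iff ?_ ?_ ?_ ?_).symm
      · refine ⟨?_, ?_⟩
        · unfold IsIdempotentElem
          rw [mul_assoc, ← mul_assoc r, e3, mul_assoc _ r r, hrr, ← mul_assoc, hnn]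
        · unfold IsSelfAdjoint
          rw [star_mul, hr.isSelfAdjoint.star_eq,
            (isStarProjection_nullProj T).isSelfAdjoint.star_eq, e3]
      · rw [← mul_assoc, hnn]
      · rw [← e3, ← mul_assoc, hrr]
      · intro x hx hx'
        rw [mul_assoc, hx', hx]
    · rw [sub_mul, one_mul, e2]
      abel
  have hP := hcap S p hp hSp
  have hQ := hcap (star S) q hq hSq
  have hVVV : V * star V * V = V := by
    rw [mul_assoc, hVV, mul_sub, mul_one, sub_eq_self]
    have h3 : star (V * nullProj S) * (V * nullProj S) = 0 := by
      rw [star_mul, mul_assoc, ← mul_assoc (star V), hVV, sub_mul, one_mul,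
        (isStarProjection_nullProj S).isIdempotentElem.eq, sub_self, mul_zero]
    have h4 := congrArg Subtype.val h3
    exact Subtype.ext ((CStarRing.star_mul_self_eq_zero_iff _).1 h4)
  have hVp : V * p = V := by
    nth_rewrite 1 [← hVVV]
    rw [mul_assoc V, hVV, mul_assoc, hP.2, ← hVV, ← mul_assoc, hVVV]
  have hqV : q * V = V := by
    have h3 : q * (V * star V) = V * star V := by
      have := congrArg star hQ.2
      rwa [← hVV', star_mul, star_mul, star_star, hq.isSelfAdjoint.star_eq] at this
    rw [← hVVV, ← mul_assoc, h3]
  have hAsa : star A = A := Subtype.ext hA0.isSelfAdjoint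
  have hpA : p * A = A := by
    have h3 : star V * S = A := by
      rw [← hVA, ← mul_assoc, hVV, sub_mul, one_mul, sub_eq_self]
      have h4 : star (A * nullProj S) * (A * nullProj S) = 0 := by
        rw [star_mul, mul_assoc, hAsa, ← mul_assoc A A, hAA, mul_assoc (star S), mul_nullProj,
          mul_zero, mul_zero]
      have h5 := congrArg Subtype.val h4
      have h6 := congrArg star (Subtype.ext ((CStarRing.star_mul_self_eq_zero_iff _).1 h5) : A * nullProj S = 0)
      rwa [star_mul, hAsa, (isStarProjection_nullProj S).isSelfAdjoint.star_eq, star_zero] at h6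
    have h4 := congrArg star hVp
    rw [star_mul, hp.isSelfAdjoint.star_eq] at h4
    rw [← h3, ← mul_assoc, h4]
  have hAp : A * p = A := by
    have := congrArg star hpA
    rwa [star_mul, hp.isSelfAdjoint.star_eq, hAsa] at this
  -- As `p A = A`, one has `(A - p)(1 + A) = A² - p = S* S - p`, and `1 + A` is invertible because
  -- `A ≥ 0`. So `|S|` agrees with `p` modulo `J`, which gives `V = V p = V A = S` modulo `J`.
  have hApJ : A - p ∈ J := by
    obtain ⟨y, hy, -⟩ := exists_inv_of_isUnit (x := 1 + A) (isUnit_one_add hA0)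
    have h3 : (A - p) * (1 + A) = star S * S - p := by
      rw [mul_add, mul_one, sub_mul, hpA, ← hAA]
      abel
    have h4 : A - p = (star S * S - p) * y := by rw [← h3, mul_assoc, hy, mul_one]
    rw [h4]
    exact J.mul_mem_right _ h1
  have hVS : V - S ∈ J := by
    have h3 : V - S = -(V * (A - p)) := by rw [mul_sub, hVA, hVp]; abel
    rw [h3]
    exact neg_mem (J.mul_mem_left _ hApJ)
  have hcapJ : ∀ T r : Elts N, star T * T - r ∈ J → cap (nullProj T) r ∈ J := by
    intro T r h
    have h3 : cap (nullProj T) r = -((star T * T - r) * cap (nullProj T) r) := by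
      rw [sub_mul, mul_cap_right, mul_assoc, ← mul_cap_left (nullProj T) r, ← mul_assoc T,
        mul_nullProj, zero_mul, mul_zero, zero_sub, neg_neg]
    rw [h3]
    exact neg_mem (J.mul_mem_right _ h)
  have hsd : p - star V * V ∈ J := by
    rw [hVV, hP.1]
    exact hcapJ S p h1
  have htd : q - V * star V ∈ J := by
    rw [hVV', hQ.1]
    exact hcapJ (star S) q (by rwa [star_star])
  refine ⟨V, ⟨hp, hq, hqV, hVp, hVVV, hsd, htd⟩, hVS, ?_, ?_⟩
  · rw [hVV]; exact hP.1
  · rw [hVV']; exact hQ.1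

end RelativePolar
end VNSpectralFlow

namespace VNSpectralFlow

/-! ### Spectral flow and the Fredholm index as relative indices -/

section IndexFlow

variable {H : Type*} [NormedAddCommGroup H] [InnerProductSpace ℂ H] [CompleteSpace H]
  {N : VonNeumannAlgebra H} {J : Ideal (Elts N)} [J.IsTwoSided] {p q r S V W Z : Elts N}

lemma cap_congr_left {a b : Elts N} (h : ∀ x, p * x = x → (a * x = x ↔ b * x = x)) :
    cap a p = cap b p :=
  IsStarProjection.eq_of_mul_eq (isStarProjection_cap a p) (isStarProjection_cap b p)
    (cap_mul_eq_self ((h _ (mul_cap_right b p)).2 (mul_cap_left b p)) (mul_cap_right b p))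
    (cap_mul_eq_self ((h _ (mul_cap_right a p)).1 (mul_cap_left a p)) (mul_cap_right a p))

lemma nullProj_mul_eq_self_iff {x : Elts N} : nullProj S * x = x ↔ S * x = 0 := by
  refine ⟨fun h => ?_, nullProj_mul_eq_self⟩
  rw [← h, ← mul_assoc, mul_nullProj, zero_mul]

lemma cap_nullProj_mul : cap (nullProj (q * p)) p = cap (1 - q) p := by
  refine cap_congr_left fun x hx => ?_
  rw [nullProj_mul_eq_self_iff, mul_assoc, hx, sub_mul, one_mul, sub_eq_self]

lemma index_eq_coe {a b : Elts N} (h : IsRelUnitary J p q V) (ha : p - star V * V = a)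
    (hb : q - V * star V = b) (hai : IsIdempotentElem a) (hbi : IsIdempotentElem b)
    (haJ : a ∈ J) (hbJ : b ∈ J) :
    h.index = ((idemClass J a hai haJ - idemClass J b hbi hbJ : KZero (idealAlg J)) :
      KZeroUnital (Unitization ℂ (idealAlg J))) := by
  subst ha hb
  rfl

/-- For projections `p`, `q` that agree modulo `J`, the partial isometry in the polar decomposition
of `q p` has index `[(1 - q) ∩ p] - [(1 - p) ∩ q]`. -/
lemma exists_isRelUnitary_of_sub_mem (hp : IsStarProjection p) (hq : IsStarProjection q)
    (h : p - q ∈ J) : ∃ V, IsRelUnitary J p q V ∧ V - q * p ∈ J ∧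
      p - star V * V = cap (1 - q) p ∧ q - V * star V = cap (1 - p) q := by
  have hpp := hp.isIdempotentElem.eq
  have hqq := hq.isIdempotentElem.eq
  have hst : star (q * p) = p * q := by
    rw [star_mul, hp.isSelfAdjoint.star_eq, hq.isSelfAdjoint.star_eq]
  obtain ⟨V, h1, h2, h3, h4⟩ := exists_isRelUnitary (J := J) (S := q * p) hp hq
    (by rw [← mul_assoc, hqq, mul_assoc, hpp]) (by
      have e : star (q * p) * (q * p) - p = -(p * (p - q) * p) := by
        rw [hst, mul_assoc, ← mul_assoc q, hqq, mul_sub, sub_mul, hpp, hpp]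
        noncomm_ring
      rw [e]
      exact neg_mem (J.mul_mem_right _ (J.mul_mem_left _ h))) (by
      have e : q * p * star (q * p) - q = q * (p - q) * q := by
        rw [hst, mul_assoc, ← mul_assoc p, hpp, mul_sub, sub_mul, hqq, hqq]
        noncomm_ring
      rw [e]
      exact J.mul_mem_right _ (J.mul_mem_left _ h))
  refine ⟨V, h1, h2, ?_, ?_⟩
  · rw [h3, cap_nullProj_mul]
  · rw [h4, hst, cap_nullProj_mul]

lemma sum_succ_sub_castSucc {G : Type*} [AddCommGroup G] (n : ℕ) (φ : Fin (n + 1) → G) :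
    ∑ i : Fin n, (φ i.succ - φ i.castSucc) = φ (Fin.last n) - φ 0 := by
  induction n with
  | zero => simp
  | succ n ih =>
    rw [Fin.sum_univ_castSucc]
    have h := ih (fun i => φ i.castSucc)
    simp only [← Fin.succ_castSucc] at h
    rw [h, Fin.castSucc_zero, Fin.succ_last]
    abel

/-- The spectral flow of a path whose spectral projections are constant modulo `J`. -/
lemma flow_eq_index [IsClosed (J : Set (Elts N))] {B : unitInterval → Elts N}
    (hB : ∀ t, chi (B t) - chi (B 0) ∈ J) (P : AdmissiblePartition J B)
    (h : IsRelUnitary J (chi (B 0)) (chi (B 1)) V) (hV : V - chi (B 0) ∈ J) :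
    (P.flow : KZeroUnital (Unitization ℂ (idealAlg J))) = h.index := by
  have hsub : ∀ s t, chi (B s) - chi (B t) ∈ J := by
    intro s t
    have := J.sub_mem (hB s) (hB t)
    rwa [sub_sub_sub_cancel_right] at this
  have hmk : ∀ s t, Ideal.Quotient.mk J (chi (B s)) = Ideal.Quotient.mk J (chi (B t)) :=
    fun s t => Ideal.Quotient.eq.2 (hsub s t)
  -- `V' s t` is the polar part of `χ(B_t) χ(B_s)`; its two defects are the projections that enter
  -- the spectral flow from `s` to `t`.
  choose V' hV' hVs hVa hVb using fun s t => exists_isRelUnitary_of_sub_mem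
    (isStarProjection_chi (B s)) (isStarProjection_chi (B t)) (hsub s t)
  have hmkV : ∀ s t, Ideal.Quotient.mk J (V' s t) = Ideal.Quotient.mk J (chi (B 0)) := by
    intro s t
    rw [Ideal.Quotient.eq.2 (hVs s t), map_mul, hmk s 0, hmk t 0, ← map_mul,
      (isStarProjection_chi _).isIdempotentElem.eq]
  have hidem : Ideal.Quotient.mk J (chi (B 0)) * Ideal.Quotient.mk J (chi (B 0)) =
      Ideal.Quotient.mk J (chi (B 0)) := by
    rw [← map_mul, (isStarProjection_chi _).isIdempotentElem.eq]
  -- All `V' s t` equal `χ(B_0)` modulo `J`, so `V' s t * V' 0 s` agrees with `V' 0 t` modulo `J`.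
  -- Additivity makes the index a difference of a function of the endpoints, and the flow
  -- telescopes.
  have hcomp : ∀ s t, (hV' s t).index = (hV' 0 t).index - (hV' 0 s).index := by
    intro s t
    rw [eq_sub_iff_add_eq']
    refine (index_comp (hV' 0 s) (hV' s t) (hV' 0 t) ?_).symm
    rw [← Ideal.Quotient.eq, map_mul, hmkV, hmkV, hmkV, hidem]
  have h00 : (hV' 0 0).index = 0 := by rw [hcomp, sub_self]
  -- Composing with the index-zero `V' 0 0` shows that the index depends only on the class modulo
  -- `J`, so the given `V` may be traded for `V' 0 1`.
  have h01 : h.index = (hV' 0 1).index := by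
    rw [index_comp (hV' 0 0) h (hV' 0 1), h00, zero_add]
    rw [← Ideal.Quotient.eq, map_mul, hmkV, hmkV, Ideal.Quotient.eq.2 hV, hidem]
  have hflow : (P.flow : KZeroUnital (Unitization ℂ (idealAlg J))) =
      ∑ i : Fin P.n, (hV' (P.t i.castSucc) (P.t i.succ)).index := by
    unfold AdmissiblePartition.flow
    rw [AddSubgroup.val_finsetSum]
    refine Finset.sum_congr rfl fun i _ => ?_
    exact (index_eq_coe _ (hVa _ _) (hVb _ _) _ _ _ _).symm
  rw [hflow, h01]
  simp only [hcomp (P.t _)]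
  rw [sum_succ_sub_castSucc P.n (fun i => (hV' 0 (P.t i)).index), P.first, P.last, h00, sub_zero]

variable {U : Elts N}

section Commuting

variable (hp : IsStarProjection p) (hU : U ∈ unitary (Elts N)) (hpU : p * U - U * p ∈ J)
include hp hU hpU

lemma isFredholm_compression : IsFredholm J p p (p * U * p) := by
  obtain ⟨h1, h2⟩ := compression_sub_mem hp hU hpU
  have hpp := hp.isIdempotentElem.eq
  have hst : p * star (p * U * p) * p = star (p * U * p) := by
    rw [star_mul, star_mul, hp.isSelfAdjoint.star_eq, ← mul_assoc p p, hpp, mul_assoc p,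
      mul_assoc (star U), hpp]
  refine ⟨hp, hp, ?_, ⟨_, hst, Ideal.Quotient.eq.2 h1⟩, ⟨_, hst, Ideal.Quotient.eq.2 h2⟩⟩
  rw [mul_assoc p U, ← mul_assoc p p, hpp, mul_assoc p, mul_assoc U, hpp]

/-- The polar part of `p U p` agrees with it modulo `J`, so it has the same boundary, and its
defects are exactly the kernel and cokernel projections of the Fredholm index. -/
lemma boundary_eq_fredholmIndex (a : (Elts N ⧸ J)ˣ)
    (ha : (a : Elts N ⧸ J) = Ideal.Quotient.mk J (p * U * p) + Ideal.Quotient.mk J (1 - p))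
    (hF : IsFredholm J p p (p * U * p)) : boundary J (KOne.ofUnit a) = fredholmIndex hF := by
  obtain ⟨h1, h2⟩ := compression_sub_mem hp hU hpU
  obtain ⟨V, hV, hVS, hVa, hVb⟩ := exists_isRelUnitary hp hp hF.corner h1 h2
  apply Subtype.ext
  rw [boundary_eq_index_of_sub_mem hV hVS a ha]
  exact index_eq_coe hV hVa hVb _ _ _ _

lemma index_conj_eq_boundary (hV : IsRelUnitary J p p V)
    (hVS : V - p * U * p ∈ J) (hW : IsRelUnitary J p (star U * p * U) W) (hWp : W - p ∈ J)
    (a : (Elts N ⧸ J)ˣ)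
    (ha : (a : Elts N ⧸ J) = Ideal.Quotient.mk J (p * U * p) + Ideal.Quotient.mk J (1 - p)) :
    hW.index = (boundary J (KOne.ofUnit a)).1 :=
  (index_conj hp hU hpU hV hVS hW hWp).trans (boundary_eq_index_of_sub_mem hV hVS a ha).symm

set_option maxHeartbeats 1000000 in
/-- The boundary of `π(p U p) + π(1 - p)` is the index of the pair `(p, U* p U)`. -/
lemma exists_index_eq_boundary (a : (Elts N ⧸ J)ˣ)
    (ha : (a : Elts N ⧸ J) = Ideal.Quotient.mk J (p * U * p) + Ideal.Quotient.mk J (1 - p)) :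
    ∃ (W : Elts N) (h : IsRelUnitary J p (star U * p * U) W), W - p ∈ J ∧
      h.index = (boundary J (KOne.ofUnit a)).1 := by
  obtain ⟨h1, h2⟩ := compression_sub_mem hp hU hpU
  obtain ⟨V, hV, hVS, -, -⟩ := exists_isRelUnitary hp hp
    (isFredholm_compression hp hU hpU).corner h1 h2
  obtain ⟨hq, hpq⟩ := isStarProjection_conj_of_commute hp hU hpU
  obtain ⟨W, hW, hWS, -, -⟩ := exists_isRelUnitary_of_sub_mem hp hq hpq
  have hWp := sub_mem_of_sub_mul_mem hp hU hpU hWS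
  exact ⟨W, hW, hWp, index_conj_eq_boundary hp hU hpU hV hVS hW hWp a ha⟩

end Commuting

end IndexFlow
end VNSpectralFlow

namespace VNSpectralFlow

/-! ### The bounded transform characterized by its graph, and bounded perturbations -/

section Transform

variable {H : Type*} [NormedAddCommGroup H] [InnerProductSpace ℂ H] [CompleteSpace H]

/-- Commuting self-adjoint operators with `F² + R² = 1`, where `R` is positive and injective. -/
structure IsTransformPair (F R : H →L[ℂ] H) : Prop where
  nonneg : 0 ≤ R
  selfAdjoint : IsSelfAdjoint F
  commute : F * R = R * F
  sq_add_sq : F * F + R * R = 1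
  injective : Function.Injective R

/-- `F` and `R` behave as `D (1 + D²)^{-1/2}` and `(1 + D²)^{-1/2}`. -/
structure IsTransform (D : H →ₗ.[ℂ] H) (F R : H →L[ℂ] H) : Prop extends IsTransformPair F R where
  mem_graph : ∀ x, (R x, F x) ∈ D.graph
  apply_eq : ∀ x y, (x, y) ∈ D.graph → R y = F x

lemma inner_eq_of_mem_graph {D : H →ₗ.[ℂ] H} (hD : IsSelfAdjoint D) {x y x' y' : H}
    (h : (x, y) ∈ D.graph) (h' : (x', y') ∈ D.graph) : inner ℂ y x' = inner ℂ x y' := by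
  have hf := LinearPMap.adjoint_isFormalAdjoint (T := D) hD.dense_domain
  have hs : D.adjoint = D := hD
  rw [hs] at hf
  obtain ⟨a, rfl, rfl⟩ := D.mem_graph_iff.1 h
  obtain ⟨b, rfl, rfl⟩ := D.mem_graph_iff.1 h'
  exact hf a b

lemma isSelfAdjoint_of_inner {T : H →L[ℂ] H} (h : ∀ x y, inner ℂ (T x) y = inner ℂ x (T y)) :
    IsSelfAdjoint T :=
  ContinuousLinearMap.isSelfAdjoint_iff_isSymmetric.2 h

lemma inner_apply_of_isSelfAdjoint {T : H →L[ℂ] H} (hT : IsSelfAdjoint T) (x y : H) :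
    inner ℂ (T x) y = inner ℂ x (T y) :=
  ContinuousLinearMap.isSelfAdjoint_iff_isSymmetric.1 hT x y

lemma mulInvOneAddSq_mem_graph (D : H →ₗ.[ℂ] H) (hD : IsSelfAdjoint D) (y : H) :
    (mulInvOneAddSq D hD y, y - invOneAddSq D hD y) ∈ D.graph := by
  obtain ⟨h, h', h2⟩ := invOneAddSq_spec D hD y
  obtain ⟨a, ha1, ha2⟩ := D.mem_graph_iff.1 (invOneAddSq_mem_graph D hD y)
  have h3 : (⟨invOneAddSq D hD y, h⟩ : D.domain) = a := Subtype.ext ha1.symm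
  refine D.mem_graph_iff.2 ⟨⟨_, h'⟩, ?_, ?_⟩
  · exact (congrArg D h3).trans ha2
  · exact eq_sub_of_add_eq' h2

/-- With `K = (1 + D²)⁻¹` and `M = D K`, all points `(K y, M y)` and `(M y, y - K y)` lie on the
graph. Symmetry of `D` on them yields that `M` is self-adjoint and commutes with `K`, and that `M² =
K - K²`. Since `R² = K` and `F R = M`, the identities for `F` and `R` follow after cancelling the
injective `R`. -/
lemma isTransform_boundedTransform (D : H →ₗ.[ℂ] H) (hD : IsSelfAdjoint D) :
    IsTransform D (boundedTransform D hD) (invSqrtOneAddSq D hD) := by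
  set K := invOneAddSq D hD with hK
  set M := mulInvOneAddSq D hD with hM
  set R := invSqrtOneAddSq D hD with hR
  set F := boundedTransform D hD with hF
  have hK0 : 0 ≤ K := invOneAddSq_nonneg D hD
  have hR0 : 0 ≤ R := CFC.sqrt_nonneg _
  have hRsa : IsSelfAdjoint R := hR0.isSelfAdjoint
  have hRR : R * R = K := CFC.sqrt_mul_sqrt_self _ hK0
  have g1 : ∀ y, (K y, M y) ∈ D.graph := invOneAddSq_mem_graph D hD
  have g2 : ∀ y, (M y, y - K y) ∈ D.graph := mulInvOneAddSq_mem_graph D hD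
  have hMsa : IsSelfAdjoint M := by
    refine isSelfAdjoint_of_inner fun x y => ?_
    have h1 := inner_eq_of_mem_graph hD (g1 x) (g1 y)
    have h2 := inner_eq_of_mem_graph hD (g2 x) (g2 y)
    rw [inner_sub_left, inner_sub_right, h1] at h2
    have h3 := inner_eq_of_mem_graph hD (g1 x) (g2 y)
    have h4 := inner_eq_of_mem_graph hD (g2 x) (g1 y)
    linear_combination -h2
  have hKD : ∀ x y, (x, y) ∈ D.graph → K y = M x := by
    intro x y h
    refine ext_inner_right ℂ fun z => ?_
    rw [inner_apply_of_isSelfAdjoint hK0.isSelfAdjoint, inner_apply_of_isSelfAdjoint hMsa]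
    exact inner_eq_of_mem_graph hD h (g1 z)
  have hMK : M * K = K * M := by
    ext x
    exact (hKD _ _ (g1 x)).symm
  have hMM : M * M = K - K * K := by
    ext x
    have := (hKD _ _ (g2 x)).symm
    rwa [map_sub] at this
  have hRM : R * M = M * R := by
    have : Commute R M := by
      rw [hR]
      unfold invSqrtOneAddSq
      rw [CFC.sqrt_eq_real_sqrt _ hK0]
      exact (show Commute K M from hMK.symm).cfcₙ_real _
    exact this
  have g3 : ∀ x, (R x, F x) ∈ D.graph := fun x => D.mem_graph ⟨_, invSqrt_mem_domain D hD x⟩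
  have hFR : F * R = M := by
    ext x
    refine D.mem_graph_snd_inj (g3 (R x)) (g1 x) ?_
    exact congrArg (fun T : H →L[ℂ] H => T x) hRR
  have hRinj : Function.Injective R := by
    rw [injective_iff_map_eq_zero]
    intro x hx
    have h1 : K x = 0 := by
      rw [← hRR]
      change R (R x) = 0
      rw [hx, map_zero]
    have h2 : M x = 0 := by
      have h := g1 x
      rw [h1] at h
      exact D.graph_fst_eq_zero_snd h rfl
    have h := g2 x
    rw [h1, h2, sub_zero] at h
    exact D.graph_fst_eq_zero_snd h rfl
  have hcomm : F * R = R * F := by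
    refine mul_right_cancel_of_injective hRinj hRsa ?_
    rw [mul_assoc R, hFR, hRM]
  have hFsa : IsSelfAdjoint F := by
    refine mul_left_cancel_of_injective hRinj ?_
    have h1 := congrArg star hFR
    rw [star_mul, hRsa.star_eq, hMsa.star_eq] at h1
    rw [h1, ← hcomm, hFR]
  refine ⟨⟨hR0, hFsa, hcomm, ?_, hRinj⟩, g3, ?_⟩
  · refine mul_right_cancel_of_injective hRinj hRsa (mul_left_cancel_of_injective hRinj ?_)
    have : R * ((F * F + R * R) * R) = (R * F) * (F * R) + R * R * (R * R) := by noncomm_ring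
    rw [this, ← hcomm, hFR, hMM, hRR, one_mul, hRR, sub_add_cancel]
  · intro x y h
    apply hRinj
    have h1 : R (R y) = K y := congrArg (fun T : H →L[ℂ] H => T y) hRR
    have h2 : R (F x) = M x := by rw [← hFR, hcomm]; rfl
    rw [h1, h2, hKD x y h]

/-- The basic relation between the transforms of `D` and of the bounded perturbation `D + A`. -/
lemma IsTransform.relation {D₀ D₁ : H →ₗ.[ℂ] H} {F₀ R₀ F₁ R₁ A : H →L[ℂ] H}
    (h₀ : IsTransform D₀ F₀ R₀) (h₁ : IsTransform D₁ F₁ R₁)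
    (hD : D₁ = D₀ + LinearMap.toPMap (A : H →ₗ[ℂ] H) ⊤) :
    F₁ * R₀ - R₁ * F₀ = R₁ * A * R₀ := by
  ext x
  -- `R₀ x` lies in the common domain and `D₁ R₀ x = F₀ x + A R₀ x`; applying `R₁` and using `R₁ D₁
  -- ⊆ F₁` gives the relation.
  have hg : (R₀ x, F₀ x + A (R₀ x)) ∈ D₁.graph := by
    rw [hD]
    obtain ⟨a, ha1, ha2⟩ := D₀.mem_graph_iff.1 (h₀.mem_graph x)
    refine (LinearPMap.mem_graph_iff _).2 ⟨⟨a, a.2, trivial⟩, ha1, ?_⟩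
    exact congrArg₂ (· + ·) ha2 (congrArg A ha1)
  have h := h₁.apply_eq _ _ hg
  rw [map_add] at h
  change F₁ (R₀ x) - R₁ (F₀ x) = R₁ (A (R₀ x))
  rw [← h, add_sub_cancel_left]

lemma mem_graph_of_inner {D : H →ₗ.[ℂ] H} (hD : IsSelfAdjoint D) {x y : H}
    (h : ∀ a b, (a, b) ∈ D.graph → inner ℂ y a = inner ℂ x b) : (x, y) ∈ D.graph := by
  have hs : D.adjoint = D := hD
  have h1 : ∀ a : D.domain, inner ℂ y (a : H) = inner ℂ x (D a) := fun a => h _ _ (D.mem_graph a)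
  have hx : x ∈ D.adjoint.domain := LinearPMap.mem_adjoint_domain_of_exists _ ⟨y, h1⟩
  have h2 : D.adjoint ⟨x, hx⟩ = y := LinearPMap.adjoint_apply_eq hD.dense_domain _ h1
  rw [← hs]
  exact (LinearPMap.mem_graph_iff _).2 ⟨⟨x, hx⟩, rfl, h2⟩

omit [CompleteSpace H] in
lemma mem_graph_add_toPMap {D : H →ₗ.[ℂ] H} {A : H →L[ℂ] H} {x y : H} :
    (x, y) ∈ (D + LinearMap.toPMap (A : H →ₗ[ℂ] H) ⊤).graph ↔ (x, y - A x) ∈ D.graph := by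
  constructor
  · intro h
    obtain ⟨a, ha1, ha2⟩ := (LinearPMap.mem_graph_iff _).1 h
    have hb : (a : H) ∈ D.domain := a.2.1
    refine (LinearPMap.mem_graph_iff _).2 ⟨⟨a, hb⟩, ha1, ?_⟩
    change D ⟨a, hb⟩ = y - A x
    rw [← show _ = y from ha2, eq_sub_iff_add_eq, ← show (a : H) = x from ha1]
    rfl
  · intro h
    obtain ⟨a, ha1, ha2⟩ := (LinearPMap.mem_graph_iff _).1 h
    refine (LinearPMap.mem_graph_iff _).2 ⟨⟨a, a.2, trivial⟩, ha1, ?_⟩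
    have : D a + A a = y := by rw [ha2, show (a : H) = x from ha1, sub_add_cancel]
    exact this

/-- The domain is unchanged and `A` can be moved across the inner product, so a vector in the
adjoint graph of `D + A`, shifted by `A`, is in the adjoint graph of `D`, which is the graph of `D`.
The converse is symmetry. -/
lemma add_toPMap_isSelfAdjoint {D : H →ₗ.[ℂ] H} (hD : IsSelfAdjoint D) {A : H →L[ℂ] H}
    (hA : IsSelfAdjoint A) : IsSelfAdjoint (D + LinearMap.toPMap (A : H →ₗ[ℂ] H) ⊤) := by
  set E := D + LinearMap.toPMap (A : H →ₗ[ℂ] H) ⊤ with hE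
  have hmemE : ∀ x y, (x, y) ∈ E.graph ↔ (x, y - A x) ∈ D.graph :=
    fun x y => mem_graph_add_toPMap
  have hdense : Dense (E.domain : Set H) := by
    have hdom : E.domain = D.domain := inf_top_eq _
    rw [hdom]
    exact hD.dense_domain
  rw [LinearPMap.isSelfAdjoint_def]
  refine le_antisymm ?_ ?_
  · refine LinearPMap.le_of_le_graph ?_
    rintro ⟨x, y⟩ hxy
    rw [hmemE]
    refine mem_graph_of_inner hD fun a b hab => ?_
    obtain ⟨c, rfl, rfl⟩ := (LinearPMap.mem_graph_iff _).1 hxy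
    have h1 : (a, b + A a) ∈ E.graph := (hmemE _ _).2 (by rwa [add_sub_cancel_right])
    obtain ⟨d, rfl, hd⟩ := (LinearPMap.mem_graph_iff _).1 h1
    have h2 := LinearPMap.adjoint_isFormalAdjoint hdense c d
    rw [hd] at h2
    rw [inner_sub_left, h2, inner_add_right, inner_apply_of_isSelfAdjoint hA, add_sub_cancel_right]
  · refine LinearPMap.IsFormalAdjoint.le_adjoint hdense ?_
    intro x y
    have h1 := (hmemE _ _).1 (E.mem_graph x)
    have h2 := (hmemE _ _).1 (E.mem_graph y)
    have h3 := inner_eq_of_mem_graph hD h1 h2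
    rw [inner_sub_left, inner_sub_right, inner_apply_of_isSelfAdjoint hA] at h3
    exact sub_left_injective h3

lemma isAffiliated_add_toPMap {D : H →ₗ.[ℂ] H} {N : VonNeumannAlgebra H} (hN : IsAffiliated D N)
    {A : H →L[ℂ] H} (hA : A ∈ N) :
    IsAffiliated (D + LinearMap.toPMap (A : H →ₗ[ℂ] H) ⊤) N := by
  intro y hy x
  have h := (D + LinearMap.toPMap (A : H →ₗ[ℂ] H) ⊤).mem_graph x
  have h2 := hN.mem_graph hy (mem_graph_add_toPMap.1 h)
  rw [map_sub, ← commutant_apply hA hy] at h2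
  obtain ⟨a, ha, ha'⟩ := (LinearPMap.mem_graph_iff _).1 (mem_graph_add_toPMap.2 h2)
  have hd : y x ∈ (D + LinearMap.toPMap (A : H →ₗ[ℂ] H) ⊤).domain := by
    have := a.2
    rwa [show (a : H) = y x from ha] at this
  refine ⟨hd, ?_⟩
  rw [← show _ = y _ from ha']
  congr 1
  exact Subtype.ext ha.symm

/-- A bounded operator `A` with `u* D u = D + A`. -/
def IsConjPerturbation (D : H →ₗ.[ℂ] H) (U A : H →L[ℂ] H) : Prop :=
  ∀ x y, (x, y) ∈ (D + LinearMap.toPMap (A : H →ₗ[ℂ] H) ⊤).graph ↔ (U x, U y) ∈ D.graph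

/-! ### Conjugation of `D` by a unitary as a bounded perturbation -/

section Conj

variable {D : H →ₗ.[ℂ] H} {U A F R : H →L[ℂ] H} {N : VonNeumannAlgebra H}

lemma unitary_star_apply (hU : U ∈ unitary (H →L[ℂ] H)) (x : H) : star U (U x) = x :=
  congrArg (fun T : H →L[ℂ] H => T x) (Unitary.star_mul_self_of_mem hU)

lemma unitary_apply_star (hU : U ∈ unitary (H →L[ℂ] H)) (x : H) : U (star U x) = x :=
  congrArg (fun T : H →L[ℂ] H => T x) (Unitary.mul_star_self_of_mem hU)

lemma unitary_cancel (hU : U ∈ unitary (H →L[ℂ] H)) {x y : H} (h : U x = U y) : x = y := by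
  rw [← unitary_star_apply hU x, h, unitary_star_apply hU]

lemma unitary_star_cancel (hU : U ∈ unitary (H →L[ℂ] H)) {x y : H} (h : star U x = star U y) :
    x = y := by
  rw [← unitary_apply_star hU x, h, unitary_apply_star hU]

lemma inner_unitary_apply (hU : U ∈ unitary (H →L[ℂ] H)) (x y : H) :
    inner ℂ (U x) (U y) = inner ℂ x y := by
  rw [← ContinuousLinearMap.adjoint_inner_right]
  exact congrArg (inner ℂ x) (unitary_star_apply hU y)

omit [CompleteSpace H] in
lemma IsConjPerturbation.mem_graph (hA : IsConjPerturbation D U A) {x y : H}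
    (h : (x, y) ∈ D.graph) : (U x, U (y + A x)) ∈ D.graph :=
  (hA _ _).1 (mem_graph_add_toPMap.2 (by rwa [add_sub_cancel_right]))

/-- On the domain of `D`, `A` is the difference of the symmetric operators `u* D u` and `D`. As `R`
maps into that domain, `R A R` is self-adjoint, and `R` can be cancelled on both sides. -/
lemma IsConjPerturbation.isSelfAdjoint (hA : IsConjPerturbation D U A) (hD : IsSelfAdjoint D)
    (hU : U ∈ unitary (H →L[ℂ] H)) (hT : IsTransform D F R) : IsSelfAdjoint A := by
  have hR : IsSelfAdjoint R := hT.nonneg.isSelfAdjoint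
  have h : IsSelfAdjoint (R * A * R) := by
    refine isSelfAdjoint_of_inner fun x y => ?_
    change inner ℂ (R (A (R x))) y = inner ℂ x (R (A (R y)))
    rw [inner_apply_of_isSelfAdjoint hR, ← inner_apply_of_isSelfAdjoint hR x]
    have h1 := inner_eq_of_mem_graph hD (hA.mem_graph (hT.mem_graph x))
      (hA.mem_graph (hT.mem_graph y))
    rw [inner_unitary_apply hU, inner_unitary_apply hU, inner_add_left, inner_add_right,
      inner_eq_of_mem_graph hD (hT.mem_graph x) (hT.mem_graph y)] at h1
    exact add_left_cancel h1
  refine mul_right_cancel_of_injective hT.injective hR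
    (mul_left_cancel_of_injective hT.injective ?_)
  have h1 := h.star_eq
  rwa [star_mul, star_mul, hR.star_eq, mul_assoc R A] at h1

/-- An element `z` of the commutant preserves the graph of `D` and commutes with `U`. Evaluating `D`
at `U z R x = z U R x` in two ways gives `A z R = z A R`, and `R` is cancelled. -/
lemma IsConjPerturbation.mem (hA : IsConjPerturbation D U A)
    (hU : U ∈ unitary (H →L[ℂ] H)) (hUN : U ∈ N) (hN : IsAffiliated D N)
    (hT : IsTransform D F R) : A ∈ N := by
  have hR : IsSelfAdjoint R := hT.nonneg.isSelfAdjoint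
  rw [← VonNeumannAlgebra.commutant_commutant N, VonNeumannAlgebra.mem_commutant_iff]
  intro z hz
  refine mul_right_cancel_of_injective hT.injective hR ?_
  ext x
  have h1 := hA.mem_graph (hN.mem_graph hz (hT.mem_graph x))
  have h2 := hN.mem_graph hz (hA.mem_graph (hT.mem_graph x))
  rw [← commutant_apply hUN hz, ← commutant_apply hUN hz] at h2
  have h3 := unitary_cancel hU (D.mem_graph_snd_inj h1 h2 rfl)
  rw [map_add] at h3
  exact (add_left_cancel h3).symm

lemma IsConjPerturbation.isTransform (hA : IsConjPerturbation D U A)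
    (hU : U ∈ unitary (H →L[ℂ] H)) (hT : IsTransform D F R) :
    IsTransform (D + LinearMap.toPMap (A : H →ₗ[ℂ] H) ⊤) (star U * F * U) (star U * R * U) := by
  have hUU := Unitary.mul_star_self_of_mem hU
  have hUU' := Unitary.star_mul_self_of_mem hU
  have hm : ∀ X Y : H →L[ℂ] H, star U * X * U * (star U * Y * U) = star U * (X * Y) * U := by
    intro X Y
    calc _ = star U * X * (U * star U) * Y * U := by noncomm_ring
      _ = _ := by rw [hUU]; noncomm_ring
  refine ⟨⟨star_left_conjugate_nonneg hT.nonneg U, ?_, ?_, ?_, ?_⟩, ?_, ?_⟩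
  · exact hT.selfAdjoint.conjugate' U
  · rw [hm, hm, hT.commute]
  · rw [hm, hm, ← add_mul, ← mul_add, hT.sq_add_sq, mul_one, hUU']
  · intro x y hxy
    exact unitary_cancel hU (hT.injective (unitary_star_cancel hU hxy))
  · intro x
    rw [hA]
    change (U (star U (R (U x))), U (star U (F (U x)))) ∈ D.graph
    rw [unitary_apply_star hU, unitary_apply_star hU]
    exact hT.mem_graph _
  · intro x y hxy
    exact congrArg (fun v => star U v) (hT.apply_eq _ _ ((hA _ _).1 hxy))

lemma IsConjPerturbation.conjPath_eq (hA : IsConjPerturbation D U A)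
    (hU : U ∈ unitary (H →L[ℂ] H)) (t : unitInterval) :
    conjPath D U t = D + LinearMap.toPMap ((((t : ℝ) : ℂ) • A : H →L[ℂ] H) : H →ₗ[ℂ] H) ⊤ := by
  refine LinearPMap.ext ?_ ?_
  · ext x
    constructor
    · exact fun h => ⟨h.1, trivial⟩
    -- A priori the linear combination is defined only on the intersection of both domains, for
    -- every `t` including the endpoints; this intersection is the domain of `D` because `U`
    -- preserves it.
    · intro h
      refine ⟨h.1, ?_⟩
      exact D.mem_domain_of_mem_graph (hA.mem_graph (D.mem_graph ⟨x, h.1⟩))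
  · intro x h1 h2
    have g1 := hA.mem_graph (D.mem_graph ⟨x, h1.1⟩)
    have g2 := D.mem_graph ⟨U x, h1.2⟩
    have h3 : star U (D ⟨U x, h1.2⟩) = D ⟨x, h1.1⟩ + A x := by
      rw [D.mem_graph_snd_inj g2 g1 rfl, unitary_star_apply hU]
    change (((1 - t : ℝ) : ℂ)) • D ⟨x, h1.1⟩ + ((t : ℝ) : ℂ) • star U (D ⟨U x, h1.2⟩) =
      D ⟨x, h1.1⟩ + ((t : ℝ) : ℂ) • A x
    rw [h3]
    push_cast
    module

/-- A unitary `U` such that `U` and `U*` preserve the domain of `D` and `[D, U]` extends to a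
bounded operator conjugates `D` to a bounded perturbation. -/
lemma isConjPerturbation_of_commutator (hU : U ∈ unitary (H →L[ℂ] H))
    (h1 : ∀ x : D.domain, U x ∈ D.domain) (h2 : ∀ x : D.domain, star U x ∈ D.domain)
    {C : H →L[ℂ] H} (hC : ∀ x : D.domain, C x = D ⟨U x, h1 x⟩ - U (D x)) :
    IsConjPerturbation D U (star U * C) := by
  have key : ∀ x : D.domain, D ⟨U x, h1 x⟩ = U (D x + star U (C x)) := by
    intro x
    rw [map_add, unitary_apply_star hU, hC, add_sub_cancel]
  intro x y
  rw [mem_graph_add_toPMap]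
  constructor
  · intro h
    obtain ⟨a, rfl, ha⟩ := (LinearPMap.mem_graph_iff _).1 h
    refine (LinearPMap.mem_graph_iff _).2 ⟨⟨_, h1 a⟩, rfl, ?_⟩
    rw [key, ha]
    congr 1
    exact sub_add_cancel _ _
  · intro h
    obtain ⟨b, hb, hb'⟩ := (LinearPMap.mem_graph_iff _).1 h
    have hx : x ∈ D.domain := by
      have := h2 b
      rwa [show (b : H) = U x from hb, unitary_star_apply hU] at this
    refine (LinearPMap.mem_graph_iff _).2 ⟨⟨x, hx⟩, rfl, ?_⟩
    have h3 := key ⟨x, hx⟩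
    have h4 : D ⟨U x, h1 ⟨x, hx⟩⟩ = U y := by
      rw [← show _ = U y from hb']
      congr 1
      exact Subtype.ext hb.symm
    rw [h4] at h3
    exact eq_sub_of_add_eq (unitary_cancel hU h3).symm

end Conj

end Transform
end VNSpectralFlow

namespace VNSpectralFlow

/-! ### Operator inequalities and the Sylvester equation for transform pairs -/

section Estimate

variable {H : Type*} [NormedAddCommGroup H] [InnerProductSpace ℂ H] [CompleteSpace H]
  {F R F₀ R₀ F₁ R₁ A : H →L[ℂ] H}

lemma norm_le_one_of_sq_add_sq {X Y : H →L[ℂ] H} (hX : IsSelfAdjoint X) (hY : IsSelfAdjoint Y)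
    (h : X * X + Y * Y = 1) : ‖X‖ ≤ 1 := by
  refine X.opNorm_le_bound zero_le_one fun x => ?_
  have h1 := inner_star_mul_self X x
  have h2 := inner_star_mul_self Y x
  rw [hX.star_eq] at h1
  rw [hY.star_eq] at h2
  have h3 : inner ℂ ((X * X + Y * Y) x) x = ((‖x‖ ^ 2 : ℝ) : ℂ) := by
    rw [h, one_apply_eq_self, inner_self_eq_norm_sq_to_K]
    norm_cast
  rw [add_apply, inner_add_left, h1, h2] at h3
  have h4 : ‖X x‖ ^ 2 + ‖Y x‖ ^ 2 = ‖x‖ ^ 2 := by exact_mod_cast h3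
  rw [one_mul]
  exact le_of_sq_le_sq (by nlinarith [sq_nonneg ‖Y x‖]) (norm_nonneg _)

omit [CompleteSpace H] in
lemma re_inner_nonneg {T : H →L[ℂ] H} (hT : 0 ≤ T) (x : H) : 0 ≤ (inner ℂ (T x) x).re :=
  (ContinuousLinearMap.nonneg_iff_isPositive T |>.1 hT).re_inner_nonneg_left x

lemma re_inner_le {S T : H →L[ℂ] H} (h : S ≤ T) (x : H) :
    (inner ℂ (S x) x).re ≤ (inner ℂ (T x) x).re := by
  have := re_inner_nonneg (sub_nonneg.2 h) x
  rw [sub_apply, inner_sub_left, Complex.sub_re] at this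
  linarith

lemma im_inner_eq_zero {T : H →L[ℂ] H} (hT : IsSelfAdjoint T) (x : H) :
    (inner ℂ x (T x)).im = 0 := by
  rw [← Complex.conj_eq_iff_im, inner_conj_symm]
  exact inner_apply_of_isSelfAdjoint hT x x

lemma IsTransformPair.norm_le_one (h : IsTransformPair F R) : ‖F‖ ≤ 1 :=
  norm_le_one_of_sq_add_sq h.selfAdjoint h.nonneg.isSelfAdjoint h.sq_add_sq

lemma IsTransformPair.norm_right_le_one (h : IsTransformPair F R) : ‖R‖ ≤ 1 :=
  norm_le_one_of_sq_add_sq h.nonneg.isSelfAdjoint h.selfAdjoint (by rw [add_comm, h.sq_add_sq])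

/-- `0 ≤ R ≤ 1` gives `R² ≤ R`. This is what lets the linear terms in `R` on the left of the
Sylvester estimate absorb the squares produced on its right. -/
lemma IsTransformPair.norm_sq_right_le (h : IsTransformPair F R) (x : H) :
    ‖R x‖ ^ 2 ≤ (inner ℂ (R x) x).re := by
  have hR1 : R ≤ 1 := (CStarAlgebra.norm_le_one_iff_of_nonneg R h.nonneg).1 h.norm_right_le_one
  have h2 : R * R ≤ R := by
    have := CStarAlgebra.pow_antitone h.nonneg hR1 (show 1 ≤ 2 by norm_num)
    simpa [pow_two] using this
  have h3 := re_inner_le h2 x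
  have h4 := inner_star_mul_self R x
  rw [h.nonneg.isSelfAdjoint.star_eq] at h4
  rwa [h4, Complex.ofReal_re] at h3

/-- A cutoff away from the kernel of `R`. -/
lemma IsTransformPair.exists_cutoff (h : IsTransformPair F R) {c : ℝ} (hc : 0 < c) :
    ∃ G : H →L[ℂ] H, IsSelfAdjoint G ∧ ‖G‖ ≤ 1 ∧ G * R = R * G ∧ G * F = F * G ∧
      ‖(1 - G) * R‖ ≤ 2 * c ∧ ∀ x, c * ‖G x‖ ^ 2 ≤ (inner ℂ (R (G x)) (G x)).re := by
  -- `g` is `0` on `x ≤ c` and `1` on `x ≥ 2 c`: then `(1 - g(x)) x ≤ 2 c` on the spectrum of `R`,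
  -- while `R ≥ c` on the range of `g(R)`.
  set g : ℝ → ℝ := fun x => max 0 (min 1 (c⁻¹ * x - 1)) with hg
  have hgc : Continuous g := by fun_prop
  have hRsa := h.nonneg.isSelfAdjoint
  have hg0 : ∀ x, 0 ≤ g x := fun x => le_max_left _ _
  have hg1 : ∀ x, g x ≤ 1 := fun x => max_le zero_le_one (min_le_left _ _)
  have hGsa : IsSelfAdjoint (cfc g R) := cfc_predicate g R
  have hGR : Commute (cfc g R) R := (Commute.refl R).cfc_real g
  refine ⟨cfc g R, hGsa, ?_, hGR.eq, ?_, ?_, ?_⟩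
  · refine norm_cfc_le zero_le_one fun x _ => ?_
    rw [Real.norm_of_nonneg (hg0 x)]
    exact hg1 x
  · exact ((show Commute R F from h.commute.symm).cfc_real g).eq
  · have e : (1 - cfc g R) * R = cfc (fun x => (1 - g x) * x) R := by
      rw [cfc_mul (fun x => 1 - g x) (fun x => x) R (by fun_prop) (by fun_prop),
        cfc_sub (fun _ => 1) g R (by fun_prop) (by fun_prop), cfc_const_one ℝ R, cfc_id' ℝ R]
    rw [e]
    refine norm_cfc_le (by positivity) fun x hx => ?_
    have hx0 : 0 ≤ x := spectrum_nonneg_of_nonneg h.nonneg hx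
    rw [Real.norm_of_nonneg (mul_nonneg (by linarith [hg1 x]) hx0)]
    by_cases hxc : x ≤ 2 * c
    · nlinarith [hg0 x, hg1 x]
    · have : g x = 1 := by
        have : 1 ≤ c⁻¹ * x - 1 := by
          have : c⁻¹ * (2 * c) = 2 := by field_simp
          have h4 : c⁻¹ * (2 * c) ≤ c⁻¹ * x :=
            mul_le_mul_of_nonneg_left (le_of_not_ge hxc) (by positivity)
          linarith
        simp only [hg]
        rw [min_eq_left this, max_eq_right zero_le_one]
      rw [this]
      simp only [sub_self, zero_mul]
      positivity
  · intro x
    have e : cfc g R * R * cfc g R - c • (cfc g R * cfc g R) =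
        cfc (fun x => (x - c) * (g x * g x)) R := by
      rw [cfc_mul (fun x => x - c) (fun x => g x * g x) R (by fun_prop) (by fun_prop),
        cfc_sub (fun x => x) (fun _ => c) R (by fun_prop) (by fun_prop),
        cfc_mul g g R (by fun_prop) (by fun_prop), cfc_id' ℝ R, cfc_const c R, hGR.eq,
        Algebra.algebraMap_eq_smul_one]
      rw [sub_mul, mul_assoc, smul_mul_assoc, one_mul]
    have h5 : 0 ≤ cfc g R * R * cfc g R - c • (cfc g R * cfc g R) := by
      rw [e]
      refine cfc_nonneg fun x hx => ?_
      by_cases hxc : c ≤ x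
      · exact mul_nonneg (by linarith) (mul_self_nonneg _)
      · have : g x = 0 := by
          have : c⁻¹ * x - 1 ≤ 0 := by
            have : c⁻¹ * c = 1 := by field_simp
            have h4 : c⁻¹ * x ≤ c⁻¹ * c :=
              mul_le_mul_of_nonneg_left (le_of_not_ge hxc) (by positivity)
            linarith
          exact max_eq_left ((min_le_right _ _).trans this)
        rw [this]
        simp
    have h6 := re_inner_nonneg h5 x
    have h7 := inner_star_mul_self (cfc g R) x
    rw [hGsa.star_eq] at h7
    have h8 : inner ℂ ((cfc g R * R * cfc g R) x) x = inner ℂ (R (cfc g R x)) (cfc g R x) :=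
      inner_apply_of_isSelfAdjoint hGsa _ _
    rw [sub_apply, inner_sub_left, h8, smul_apply,
      ← Complex.coe_smul, inner_smul_left, h7, Complex.conj_ofReal, ← Complex.ofReal_mul,
      Complex.sub_re, Complex.ofReal_re] at h6
    linarith

/-- The Cayley-type unitaries `F + i R` satisfy a Sylvester equation. -/
lemma IsTransformPair.sylvester (h₀ : IsTransformPair F₀ R₀) (h₁ : IsTransformPair F₁ R₁)
    (hrel : F₁ * R₀ - R₁ * F₀ = R₁ * A * R₀) :
    (R₁ + Complex.I • F₁) * ((F₁ + Complex.I • R₁) - (F₀ + Complex.I • R₀)) +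
      ((F₁ + Complex.I • R₁) - (F₀ + Complex.I • R₀)) * (R₀ + Complex.I • F₀) =
      (2 : ℂ) • (R₁ * A * R₀) := by
  have e1 := h₀.sq_add_sq
  have e2 := h₁.sq_add_sq
  have e3 := h₀.commute
  have e4 := h₁.commute
  -- Besides `2 (F₁ R₀ - R₁ F₀)` only the commutators of `R_j` with `F_j` and the difference of the
  -- two sums `F_j² + R_j²` remain, and these vanish.
  have key : (R₁ + Complex.I • F₁) * ((F₁ + Complex.I • R₁) - (F₀ + Complex.I • R₀)) +
      ((F₁ + Complex.I • R₁) - (F₀ + Complex.I • R₀)) * (R₀ + Complex.I • F₀) =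
      (2 : ℂ) • (F₁ * R₀ - R₁ * F₀) + (R₁ * F₁ - F₁ * R₁) - (F₀ * R₀ - R₀ * F₀)
      + Complex.I • ((F₁ * F₁ + R₁ * R₁) - (F₀ * F₀ + R₀ * R₀)) := by
    simp only [mul_add, add_mul, mul_sub, sub_mul, smul_mul_assoc, mul_smul_comm, smul_smul,
      Complex.I_mul_I, smul_add, smul_sub]
    module
  rw [key, hrel, e1, e2, e3, e4]
  simp

end Estimate
-- The Lipschitz estimate for the bounded transform
section NormEstimate

variable {H : Type*} [NormedAddCommGroup H] [InnerProductSpace ℂ H] [CompleteSpace H]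
  {F R F₀ R₀ F₁ R₁ A : H →L[ℂ] H}

/-- A vector that almost attains the norm of `T` is almost an eigenvector of `T* T` for `‖T‖²`:
expand the square and use `‖T* T x‖ ≤ ‖T‖ ‖T x‖`. -/
lemma norm_star_mul_self_apply_sub_sq_le (T : H →L[ℂ] H) {x : H} (hx : ‖x‖ ≤ 1) :
    ‖star T (T x) - ((‖T‖ ^ 2 : ℝ) : ℂ) • x‖ ^ 2 ≤ ‖T‖ ^ 2 * (‖T‖ ^ 2 - ‖T x‖ ^ 2) := by
  have h1 := norm_sub_sq (𝕜 := ℂ) (star T (T x)) (((‖T‖ ^ 2 : ℝ) : ℂ) • x)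
  have h2 : inner ℂ (star T (T x)) (((‖T‖ ^ 2 : ℝ) : ℂ) • x) = ((‖T‖ ^ 2 * ‖T x‖ ^ 2 : ℝ) : ℂ) := by
    have := inner_star_mul_self T x
    rw [inner_smul_right, show inner ℂ (star T (T x)) x = _ from this, ← Complex.ofReal_mul]
  rw [h2, norm_smul, Complex.norm_real, Real.norm_of_nonneg (sq_nonneg _)] at h1
  have h3 : ‖star T (T x)‖ ≤ ‖T‖ * ‖T x‖ := by
    have := (star T).le_opNorm (T x)
    rwa [norm_star] at this
  have h4 : ‖star T (T x)‖ ^ 2 ≤ ‖T‖ ^ 2 * ‖T x‖ ^ 2 := by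
    rw [← mul_pow]
    exact pow_le_pow_left₀ (norm_nonneg _) h3 2
  have h5 : (‖T‖ ^ 2 * ‖x‖) ^ 2 ≤ ‖T‖ ^ 2 * ‖T‖ ^ 2 := by
    rw [mul_pow, ← pow_two]
    exact mul_le_of_le_one_right (by positivity) (pow_le_one₀ (norm_nonneg _) hx)
  rw [h1, show RCLike.re ((‖T‖ ^ 2 * ‖T x‖ ^ 2 : ℝ) : ℂ) = ‖T‖ ^ 2 * ‖T x‖ ^ 2 from
    Complex.ofReal_re _]
  linarith

/-- The estimate at an almost norming vector. -/
lemma IsTransformPair.sylvester_estimate (h₀ : IsTransformPair F₀ R₀) (h₁ : IsTransformPair F₁ R₁)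
    {G T : H →L[ℂ] H} (hG : IsSelfAdjoint G) (hG1 : ‖G‖ ≤ 1) (hGR : G * R₁ = R₁ * G)
    (hT : (R₁ + Complex.I • F₁) * T + T * (R₀ + Complex.I • F₀) =
      (2 : ℂ) • (G * (R₁ * A * R₀))) {x : H} (hx : ‖x‖ ≤ 1) :
    (inner ℂ (T x) (R₁ (T x))).re + ‖T‖ ^ 2 * (inner ℂ x (R₀ x)).re ≤
      2 * ‖A‖ * (‖R₁ (T x)‖ * ‖R₀ x‖) +
        2 * ‖star T (T x) - ((‖T‖ ^ 2 : ℝ) : ℂ) • x‖ := by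
  set z := R₀ x + Complex.I • F₀ x with hz
  set d := star T (T x) - ((‖T‖ ^ 2 : ℝ) : ℂ) • x with hd
  have e1 : R₁ (T x) + Complex.I • F₁ (T x) + T z = (2 : ℂ) • G (R₁ (A (R₀ x))) :=
    congrArg (fun S : H →L[ℂ] H => S x) hT
  -- In the real part of the pairing with `T x`, the term with `i F₁` drops out because `F₁` is
  -- self-adjoint. In `⟨T x, T z⟩`, `T* T x` is then replaced by `‖T‖² x` up to the error `d`, and
  -- the term with `i F₀` drops out as well.
  have e2 := congrArg (fun v => (inner ℂ (T x) v).re) e1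
  simp only [inner_add_right, inner_smul_right, Complex.add_re, Complex.mul_re, Complex.I_re,
    Complex.I_im, zero_mul, one_mul, im_inner_eq_zero h₁.selfAdjoint, sub_zero, add_zero,
    Complex.re_ofNat, Complex.im_ofNat] at e2
  have e3 : inner ℂ (T x) (T z) = inner ℂ d z + ((‖T‖ ^ 2 : ℝ) : ℂ) * inner ℂ x z := by
    have h1 : inner ℂ (T x) (T z) = inner ℂ (star T (T x)) z :=
      (ContinuousLinearMap.adjoint_inner_left T z (T x)).symm
    rw [h1, hd, inner_sub_left, inner_smul_left, Complex.conj_ofReal, sub_add_cancel]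
  have e4 : (inner ℂ x z).re = (inner ℂ x (R₀ x)).re := by
    simp [hz, im_inner_eq_zero h₀.selfAdjoint]
  have hz2 : ‖z‖ ≤ 2 := by
    refine (norm_add_le _ _).trans ?_
    rw [norm_smul, Complex.norm_I, one_mul]
    have a1 := R₀.le_of_opNorm_le h₀.norm_right_le_one x
    have a2 := F₀.le_of_opNorm_le h₀.norm_le_one x
    linarith
  have e5 : -(2 * ‖d‖) ≤ (inner ℂ d z).re := by
    have a1 := (abs_le.1 ((Complex.abs_re_le_norm _).trans (norm_inner_le_norm (𝕜 := ℂ) d z))).1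
    nlinarith [norm_nonneg d]
  have e6 : (inner ℂ (T x) (G (R₁ (A (R₀ x))))).re ≤ ‖A‖ * (‖R₁ (T x)‖ * ‖R₀ x‖) := by
    rw [← inner_apply_of_isSelfAdjoint hG, ← inner_apply_of_isSelfAdjoint h₁.nonneg.isSelfAdjoint]
    have a0 : R₁ (G (T x)) = G (R₁ (T x)) :=
      congrArg (fun S : H →L[ℂ] H => S (T x)) hGR.symm
    rw [a0]
    have a1 : ‖G (R₁ (T x))‖ ≤ ‖R₁ (T x)‖ := by simpa using G.le_of_opNorm_le hG1 (R₁ (T x))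
    have a2 := A.le_opNorm (R₀ x)
    calc _ ≤ ‖G (R₁ (T x))‖ * ‖A (R₀ x)‖ :=
          (Complex.re_le_norm _).trans (norm_inner_le_norm _ _)
      _ ≤ ‖R₁ (T x)‖ * (‖A‖ * ‖R₀ x‖) := by gcongr
      _ = _ := by ring
  rw [e3, Complex.add_re, Complex.re_ofReal_mul, e4] at e2
  linarith

/-- If `m = ‖T‖` exceeded `a = ‖A‖`, the estimate at almost norming vectors would force `⟨R₁ T x, T
x⟩` to tend to `0`. The cutoff excludes this, since it bounds that quantity below by `c ‖T x‖²`,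
which tends to `c m²`. -/
lemma IsTransformPair.norm_cutoff_le (h₀ : IsTransformPair F₀ R₀) (h₁ : IsTransformPair F₁ R₁)
    {G Y : H →L[ℂ] H} (hG : IsSelfAdjoint G) (hG1 : ‖G‖ ≤ 1) (hGR : G * R₁ = R₁ * G)
    {c : ℝ} (hc : 0 < c) (hGc : ∀ x, c * ‖G x‖ ^ 2 ≤ (inner ℂ (R₁ (G x)) (G x)).re)
    (hT : (R₁ + Complex.I • F₁) * (G * Y) + (G * Y) * (R₀ + Complex.I • F₀) =
      (2 : ℂ) • (G * (R₁ * A * R₀))) : ‖G * Y‖ ≤ ‖A‖ := by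
  by_contra! hlt
  set T := G * Y with hTdef
  set m := ‖T‖ with hm
  set a := ‖A‖ with ha
  have ha0 : 0 ≤ a := norm_nonneg _
  have hm0 : 0 < m := ha0.trans_lt hlt
  have hk : 0 < m ^ 2 - a ^ 2 := by nlinarith
  have key : ∀ r : ℝ, 0 ≤ r → r < m →
      ((m ^ 2 - a ^ 2) * (c * r ^ 2)) ^ 2 ≤ (2 * m ^ 2) ^ 2 * (m ^ 2 * (m ^ 2 - r ^ 2)) := by
    intro r hr0 hr
    obtain ⟨x, hx, hrx⟩ := T.exists_lt_apply_of_lt_opNorm hr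
    have e1 := h₀.sylvester_estimate h₁ hG hG1 hGR hT hx.le
    have e2 := norm_star_mul_self_apply_sub_sq_le T hx.le
    set d := ‖star T (T x) - ((m ^ 2 : ℝ) : ℂ) • x‖ with hd
    have e3 : ‖R₁ (T x)‖ ^ 2 ≤ (inner ℂ (T x) (R₁ (T x))).re := by
      rw [← inner_apply_of_isSelfAdjoint h₁.nonneg.isSelfAdjoint]
      exact h₁.norm_sq_right_le _
    have e4 : ‖R₀ x‖ ^ 2 ≤ (inner ℂ x (R₀ x)).re := by
      rw [← inner_apply_of_isSelfAdjoint h₀.nonneg.isSelfAdjoint]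
      exact h₀.norm_sq_right_le _
    have e5 : c * ‖T x‖ ^ 2 ≤ (inner ℂ (T x) (R₁ (T x))).re := by
      rw [← inner_apply_of_isSelfAdjoint h₁.nonneg.isSelfAdjoint]
      exact hGc (Y x)
    set α := (inner ℂ (T x) (R₁ (T x))).re
    set β := (inner ℂ x (R₀ x)).re
    -- Multiply the estimate by `m²` and split the cross term by `2 (a X)(m² Y) ≤ a² X² + m⁴ Y²`,
    -- with `X = ‖R₁ T x‖` and `Y = ‖R₀ x‖`. The terms in `β` cancel, leaving `m² - a²` in front of
    -- `α`.
    have e6 : (m ^ 2 - a ^ 2) * α ≤ 2 * m ^ 2 * d := by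
      have b1 : m ^ 2 * (2 * a * (‖R₁ (T x)‖ * ‖R₀ x‖)) ≤
          a ^ 2 * ‖R₁ (T x)‖ ^ 2 + m ^ 2 * (m ^ 2 * ‖R₀ x‖ ^ 2) := by
        nlinarith [sq_nonneg (a * ‖R₁ (T x)‖ - m ^ 2 * ‖R₀ x‖)]
      have b2 := mul_le_mul_of_nonneg_left e3 (sq_nonneg a)
      have b3 := mul_le_mul_of_nonneg_left e4 (mul_nonneg (sq_nonneg m) (sq_nonneg m))
      have b4 := mul_le_mul_of_nonneg_left e1 (sq_nonneg m)
      linarith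
    have e7 : (m ^ 2 - a ^ 2) * (c * r ^ 2) ≤ 2 * m ^ 2 * d := by
      refine le_trans (mul_le_mul_of_nonneg_left ?_ hk.le) e6
      refine le_trans (mul_le_mul_of_nonneg_left ?_ hc.le) e5
      exact pow_le_pow_left₀ hr0 hrx.le 2
    calc _ ≤ (2 * m ^ 2 * d) ^ 2 := pow_le_pow_left₀ (by positivity) e7 2
      _ = (2 * m ^ 2) ^ 2 * d ^ 2 := by ring
      _ ≤ (2 * m ^ 2) ^ 2 * (m ^ 2 * (m ^ 2 - ‖T x‖ ^ 2)) :=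
          mul_le_mul_of_nonneg_left e2 (by positivity)
      _ ≤ _ := by
          have : r ^ 2 ≤ ‖T x‖ ^ 2 := pow_le_pow_left₀ hr0 hrx.le 2
          gcongr
  -- Let `r` increase to `m` in `key`: the right side tends to `0` and the left side to a positive
  -- number.
  have hlim : ((m ^ 2 - a ^ 2) * (c * m ^ 2)) ^ 2 ≤ (2 * m ^ 2) ^ 2 * (m ^ 2 * (m ^ 2 - m ^ 2)) := by
    have c1 : Continuous fun r : ℝ => ((m ^ 2 - a ^ 2) * (c * r ^ 2)) ^ 2 := by fun_prop
    have c2 : Continuous fun r : ℝ => (2 * m ^ 2) ^ 2 * (m ^ 2 * (m ^ 2 - r ^ 2)) := by fun_prop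
    refine le_of_tendsto_of_tendsto (c1.continuousAt.tendsto.mono_left nhdsWithin_le_nhds)
      (c2.continuousAt.tendsto.mono_left (nhdsWithin_le_nhds (s := Set.Iio m))) ?_
    filter_upwards [Ioo_mem_nhdsLT hm0] with r hr
    exact key r hr.1.le hr.2
  rw [sub_self, mul_zero, mul_zero] at hlim
  have : 0 < ((m ^ 2 - a ^ 2) * (c * m ^ 2)) ^ 2 := by positivity
  linarith

/-- The bounded transform is `1`-Lipschitz under bounded perturbations. -/
theorem IsTransformPair.norm_sub_le (h₀ : IsTransformPair F₀ R₀) (h₁ : IsTransformPair F₁ R₁)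
    (hrel : F₁ * R₀ - R₁ * F₀ = R₁ * A * R₀) : ‖F₁ - F₀‖ ≤ ‖A‖ := by
  set Y := (F₁ + Complex.I • R₁) - (F₀ + Complex.I • R₀) with hY
  have hYA : ‖Y‖ ≤ ‖A‖ := by
    refine Y.opNorm_le_bound (norm_nonneg _) fun x => ?_
    refine le_of_forall_pos_le_add fun ε hε => ?_
    obtain ⟨v, hv⟩ := (denseRange_of_injective h₁.injective h₁.nonneg.isSelfAdjoint).exists_dist_lt
      (Y x) (show 0 < ε / 3 by positivity)
    -- `G` commutes with `R₁` and `F₁`, so `G Y` again solves a Sylvester equation and its norm is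
    -- at most `‖A‖`. For the rest, `Y x` is approximated by `R₁ v`; the constant is chosen so that
    -- `‖(1 - G) R₁ v‖ ≤ ε / 3`, the other two thirds being the approximation error and its image
    -- under `G`.
    obtain ⟨G, hG, hG1, hGR, hGF, hGs, hGc⟩ :=
      h₁.exists_cutoff (c := ε / (6 * (‖v‖ + 1))) (by positivity)
    have hGY : ‖G * Y‖ ≤ ‖A‖ := by
      refine h₀.norm_cutoff_le h₁ hG hG1 hGR (by positivity) hGc ?_
      have hs := congrArg (G * ·) (h₀.sylvester h₁ hrel)
      rw [mul_smul_comm, mul_add, ← mul_assoc G, mul_add G, mul_smul_comm, hGR, hGF,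
        ← hY] at hs
      rw [← hs, add_mul R₁, add_mul (R₁ * G), smul_mul_assoc, smul_mul_assoc]
      simp only [mul_assoc]
    rw [dist_eq_norm] at hv
    have hs := ((1 - G) * R₁).le_of_opNorm_le hGs v
    have e1 : Y x = (Y x - R₁ v) + ((1 - G) * R₁) v - G (Y x - R₁ v) + (G * Y) x := by
      change _ = (Y x - R₁ v) + (R₁ v - G (R₁ v)) - G (Y x - R₁ v) + G (Y x)
      rw [map_sub]
      abel
    have e2 : ‖G (Y x - R₁ v)‖ ≤ ‖Y x - R₁ v‖ := by simpa using G.le_of_opNorm_le hG1 (Y x - R₁ v)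
    have e3 := (G * Y).le_of_opNorm_le hGY x
    have e4 : 2 * (ε / (6 * (‖v‖ + 1))) * ‖v‖ ≤ ε / 3 := by
      rw [div_eq_mul_inv, mul_inv]
      have : (‖v‖ + 1)⁻¹ * ‖v‖ ≤ 1 := by
        rw [inv_mul_le_iff₀ (by positivity)]
        linarith
      nlinarith
    have e5 : ‖Y x‖ ≤ ‖Y x - R₁ v‖ + ‖((1 - G) * R₁) v‖ + ‖G (Y x - R₁ v)‖ + ‖(G * Y) x‖ := by
      conv_lhs => rw [e1]
      refine (norm_add_le _ _).trans (add_le_add_left ?_ _)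
      exact (_root_.norm_sub_le _ _).trans (add_le_add_left (norm_add_le _ _) _)
    linarith
  -- `F₁ - F₀` is the self-adjoint part of `Y`, so its norm is at most that of `Y`.
  have hsum : (2 : ℂ) • (F₁ - F₀) = Y + star Y := by
    rw [hY]
    simp only [star_sub, star_add, star_smul, h₀.selfAdjoint.star_eq, h₁.selfAdjoint.star_eq,
      h₀.nonneg.isSelfAdjoint.star_eq, h₁.nonneg.isSelfAdjoint.star_eq, Complex.star_def,
      Complex.conj_I]
    module
  have h2 := congrArg norm hsum
  rw [norm_smul, Complex.norm_ofNat] at h2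
  have h3 := norm_add_le Y (star Y)
  rw [norm_star] at h3
  linarith

/-- Two transforms of the same operator are related by the perturbation `0`, so the Lipschitz
estimate identifies them. It serves to recognize `star U * F * U` as the bounded transform at the
end of the path. -/
lemma IsTransform.eq_of_isTransform {D : H →ₗ.[ℂ] H} (h₀ : IsTransform D F₀ R₀)
    (h₁ : IsTransform D F₁ R₁) : F₁ = F₀ := by
  have hrel : F₁ * R₀ - R₁ * F₀ = R₁ * 0 * R₀ := by
    rw [mul_zero, zero_mul, sub_eq_zero]
    ext x
    exact (h₁.apply_eq _ _ (h₀.mem_graph x)).symm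
  have h := h₀.norm_sub_le h₁.toIsTransformPair hrel
  rw [norm_zero] at h
  exact sub_eq_zero.1 (norm_le_zero_iff.1 h)

end NormEstimate
end VNSpectralFlow

namespace VNSpectralFlow

/-! ### Transforms of the scaled operator `ε D` -/

section Scaling

variable {H : Type*} [NormedAddCommGroup H] [InnerProductSpace ℂ H] [CompleteSpace H]
  {F R F₀ R₀ F₁ R₁ A : H →L[ℂ] H} {ε : ℝ}

/-- The operator `(R² + ε² F²)^{-1/2}`, where `F² = 1 - R²`. -/
noncomputable def scaleOp (ε : ℝ) (R : H →L[ℂ] H) : H →L[ℂ] H :=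
  cfc (fun x : ℝ => (√((1 - ε ^ 2) * x ^ 2 + ε ^ 2))⁻¹) R

lemma scale_pos (hε : 0 < ε) (hε1 : ε ≤ 1) (x : ℝ) : 0 < (1 - ε ^ 2) * x ^ 2 + ε ^ 2 := by
  have : 0 ≤ 1 - ε ^ 2 := by nlinarith
  positivity

lemma continuous_scale (hε : 0 < ε) (hε1 : ε ≤ 1) :
    Continuous fun x : ℝ => (√((1 - ε ^ 2) * x ^ 2 + ε ^ 2))⁻¹ :=
  Continuous.inv₀ (by fun_prop) fun x => (Real.sqrt_pos.2 (scale_pos hε hε1 x)).ne'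

lemma scaleOp_nonneg (ε : ℝ) (R : H →L[ℂ] H) : 0 ≤ scaleOp ε R :=
  cfc_nonneg fun _ _ => inv_nonneg.2 (Real.sqrt_nonneg _)

lemma commute_scaleOp {B : H →L[ℂ] H} (h : Commute R B) : Commute (scaleOp ε R) B :=
  h.cfc_real _

lemma scaleOp_spec (hR : IsSelfAdjoint R) (hε : 0 < ε) (hε1 : ε ≤ 1) :
    ((1 - ε ^ 2) • (R * R) + (ε ^ 2) • (1 : H →L[ℂ] H)) * (scaleOp ε R * scaleOp ε R) = 1 := by
  have hc := continuous_scale hε hε1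
  have e1 : (1 - ε ^ 2) • (R * R) + (ε ^ 2) • (1 : H →L[ℂ] H) =
      cfc (fun x : ℝ => (1 - ε ^ 2) * x ^ 2 + ε ^ 2) R := by
    rw [cfc_add R (fun x => (1 - ε ^ 2) * x ^ 2) (fun _ => ε ^ 2) (by fun_prop) (by fun_prop),
      cfc_const_mul (1 - ε ^ 2) (fun x => x ^ 2) R (by fun_prop), cfc_pow_id (R := ℝ) R 2 hR,
      cfc_const (ε ^ 2) R, Algebra.algebraMap_eq_smul_one, pow_two R]
  rw [e1, scaleOp, ← cfc_mul _ _ R hc.continuousOn hc.continuousOn,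
    ← cfc_mul _ _ R (by fun_prop)
    (hc.fun_mul hc).continuousOn, ← cfc_one ℝ R]
  congr 1
  ext x
  have h := scale_pos hε hε1 x
  rw [← mul_inv, Real.mul_self_sqrt h.le, mul_inv_cancel₀ h.ne', Pi.one_apply]

lemma scaleOp_injective (hR : IsSelfAdjoint R) (hε : 0 < ε) (hε1 : ε ≤ 1) :
    Function.Injective (scaleOp ε R) := by
  have h := scaleOp_spec hR hε hε1
  rw [← mul_assoc] at h
  have hc : Commute (scaleOp ε R) ((1 - ε ^ 2) • (R * R) + (ε ^ 2) • (1 : H →L[ℂ] H)) :=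
    commute_scaleOp ((((Commute.refl R).mul_right (Commute.refl R)).smul_right _).add_right
      ((Commute.one_right R).smul_right _))
  intro x y hxy
  have h2 : (((1 - ε ^ 2) • (R * R) + (ε ^ 2) • (1 : H →L[ℂ] H)) * scaleOp ε R) * scaleOp ε R = 1 := h
  have h3 : ∀ z, (((1 - ε ^ 2) • (R * R) + (ε ^ 2) • (1 : H →L[ℂ] H)) * scaleOp ε R)
      (scaleOp ε R z) = z := fun z => congrArg (fun T : H →L[ℂ] H => T z) h2
  rw [← h3 x, hxy, h3]

/-- Formally `1 + ε² D² = R⁻² (R² + ε² F²)`, so with `S = (R² + ε² F²)^{-1/2}` the transform pair of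
`ε D` is `(ε F S, R S)`. -/
lemma IsTransformPair.scale (h : IsTransformPair F R) (hε : 0 < ε) (hε1 : ε ≤ 1) :
    IsTransformPair (ε • (F * scaleOp ε R)) (R * scaleOp ε R) := by
  have hRsa := h.nonneg.isSelfAdjoint
  have hSsa := (scaleOp_nonneg ε R).isSelfAdjoint
  have hRS : scaleOp ε R * R = R * scaleOp ε R := (commute_scaleOp (Commute.refl R)).eq
  have hFS : scaleOp ε R * F = F * scaleOp ε R :=
    (commute_scaleOp (show Commute R F from h.commute.symm)).eq
  have hspec := scaleOp_spec hRsa hε hε1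
  set S := scaleOp ε R with hS
  refine ⟨?_, ?_, ?_, ?_, ?_⟩
  · have : R * S = cfc (fun x : ℝ => x * (√((1 - ε ^ 2) * x ^ 2 + ε ^ 2))⁻¹) R := by
      rw [cfc_mul (fun x => x) _ R (by fun_prop) (continuous_scale hε hε1).continuousOn, cfc_id' ℝ R]
      rfl
    rw [this]
    exact cfc_nonneg fun x hx =>
      mul_nonneg (spectrum_nonneg_of_nonneg h.nonneg hx) (inv_nonneg.2 (Real.sqrt_nonneg _))
  · have : IsSelfAdjoint (F * S) := by
      unfold IsSelfAdjoint
      rw [star_mul, hSsa.star_eq, h.selfAdjoint.star_eq, hFS]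
    exact (IsSelfAdjoint.all ε).smul this
  · rw [smul_mul_assoc, mul_smul_comm]
    congr 1
    calc F * S * (R * S) = F * (S * R) * S := by noncomm_ring
      _ = (F * R) * S * S := by rw [hRS]; simp only [mul_assoc]
      _ = R * (F * S) * S := by rw [h.commute]; simp only [mul_assoc]
      _ = R * (S * F) * S := by rw [hFS]
      _ = _ := by simp only [mul_assoc]
  · rw [smul_mul_assoc, mul_smul_comm, smul_smul]
    have e1 : F * S * (F * S) = F * F * (S * S) := by
      rw [mul_assoc, ← mul_assoc S, hFS]; noncomm_ring
    have e2 : R * S * (R * S) = R * R * (S * S) := by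
      rw [mul_assoc, ← mul_assoc S, hRS]; noncomm_ring
    rw [e1, e2, ← hspec, eq_sub_of_add_eq h.sq_add_sq, ← smul_mul_assoc, ← add_mul]
    congr 1
    module
  · intro x y hxy
    exact scaleOp_injective hRsa hε hε1 (h.injective hxy)

/-- Multiplying the relation on both sides by the scale operators gives the relation for the scaled
pairs, with perturbation `ε A`. -/
lemma IsTransformPair.scale_relation (h₁ : IsTransformPair F₁ R₁)
    (hrel : F₁ * R₀ - R₁ * F₀ = R₁ * A * R₀) :
    (ε • (F₁ * scaleOp ε R₁)) * (R₀ * scaleOp ε R₀) -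
      (R₁ * scaleOp ε R₁) * (ε • (F₀ * scaleOp ε R₀)) =
      (R₁ * scaleOp ε R₁) * (ε • A) * (R₀ * scaleOp ε R₀) := by
  have hRS : scaleOp ε R₁ * R₁ = R₁ * scaleOp ε R₁ := (commute_scaleOp (Commute.refl R₁)).eq
  have hFS : scaleOp ε R₁ * F₁ = F₁ * scaleOp ε R₁ :=
    (commute_scaleOp (show Commute R₁ F₁ from h₁.commute.symm)).eq
  rw [← hFS, ← hRS]
  simp only [smul_mul_assoc, mul_smul_comm, ← smul_sub]
  congr 1
  have := congrArg (fun X => scaleOp ε R₁ * X * scaleOp ε R₀) hrel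
  simp only [mul_sub, sub_mul] at this
  simp only [mul_assoc] at this ⊢
  exact this

lemma IsTransformPair.norm_scale_sub_le (h₀ : IsTransformPair F₀ R₀) (h₁ : IsTransformPair F₁ R₁)
    (hrel : F₁ * R₀ - R₁ * F₀ = R₁ * A * R₀) (hε : 0 < ε) (hε1 : ε ≤ 1) :
    ‖ε • (F₁ * scaleOp ε R₁) - ε • (F₀ * scaleOp ε R₀)‖ ≤ ε * ‖A‖ := by
  have h := (h₀.scale hε hε1).norm_sub_le (h₁.scale hε hε1) (h₁.scale_relation hrel)
  rwa [norm_smul, Real.norm_of_nonneg hε.le] at h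

lemma IsTransformPair.commute_scaleOp_left (h : IsTransformPair F R) :
    scaleOp ε R * F = F * scaleOp ε R :=
  (commute_scaleOp (show Commute R F from h.commute.symm)).eq

lemma IsTransformPair.mul_scale_nonneg (h : IsTransformPair F R) (hε : 0 < ε) :
    0 ≤ F * (ε • (F * scaleOp ε R)) := by
  have e : F * (ε • (F * scaleOp ε R)) = ε • (star F * scaleOp ε R * F) := by
    rw [h.selfAdjoint.star_eq, mul_smul_comm, mul_assoc F, h.commute_scaleOp_left]
  rw [e]
  exact smul_nonneg hε.le (star_left_conjugate_nonneg (scaleOp_nonneg _ _) _)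

/-- For commuting `F` and `E` the product is `F (1 - E²) - E (1 - F²)`. Both brackets are squares of
the `R`-components, and `1 + F E` is invertible since `F E ≥ 0`; so `F - E` lies in any two-sided
ideal of `N` containing `R²`. -/
lemma IsTransformPair.sub_scale_mul (h : IsTransformPair F R) (hε : 0 < ε) (hε1 : ε ≤ 1) :
    (F - ε • (F * scaleOp ε R)) * (1 + F * (ε • (F * scaleOp ε R))) =
      F * (R * scaleOp ε R * (R * scaleOp ε R)) - (ε • (F * scaleOp ε R)) * (R * R) := by
  have h2 := (h.scale hε hε1).sq_add_sq
  have hFE : F * (ε • (F * scaleOp ε R)) = (ε • (F * scaleOp ε R)) * F := by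
    rw [mul_smul_comm, smul_mul_assoc, mul_assoc F _ F, h.commute_scaleOp_left]
  set E := ε • (F * scaleOp ε R) with hE
  rw [eq_sub_of_add_eq' h2, eq_sub_of_add_eq' h.sq_add_sq]
  have h3 : E * (F * E) = F * (E * E) := by rw [← mul_assoc, ← hFE, mul_assoc]
  have h4 : E * (F * F) = F * (F * E) := by rw [← mul_assoc, ← hFE, mul_assoc, hFE]
  rw [sub_mul, mul_add, mul_add, mul_one, mul_one, h3, mul_sub, mul_sub, mul_one, mul_one, h4]
  abel

end Scaling

/-! ### Bounded transforms modulo `J` -/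

section IdealPerturbation

variable {H : Type*} [NormedAddCommGroup H] [InnerProductSpace ℂ H] [CompleteSpace H]
  {N : VonNeumannAlgebra H} {J : Ideal (Elts N)} [J.IsTwoSided] {F R F₀ R₀ F₁ R₁ A : Elts N} {ε : ℝ}

/-- `scaleOp` as an element of the von Neumann algebra. -/
noncomputable def scaleElt (ε : ℝ) (R : Elts N) : Elts N := ⟨scaleOp ε R, cfc_mem R.2 _⟩

lemma sub_scale_mem (h : IsTransformPair (F : H →L[ℂ] H) R) (hR : R * R ∈ J)
    (hε : 0 < ε) (hε1 : ε ≤ 1) : F - (ε : ℂ) • (F * scaleElt ε R) ∈ J := by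
  set S := scaleElt ε R with hS
  set E := (ε : ℂ) • (F * S) with hE
  have hEc : (E : H →L[ℂ] H) = ε • ((F : H →L[ℂ] H) * scaleOp ε (R : H →L[ℂ] H)) := rfl
  have hRS : S * R = R * S := Subtype.ext (commute_scaleOp (Commute.refl (R : H →L[ℂ] H))).eq
  have key : (F - E) * (1 + F * E) = F * (R * S * (R * S)) - E * (R * R) :=
    Subtype.ext (h.sub_scale_mul hε hε1)
  obtain ⟨y, hy, -⟩ := exists_inv_of_isUnit (x := 1 + F * E)
    (isUnit_one_add (h.mul_scale_nonneg hε))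
  have h3 : F - E = (F * (R * S * (R * S)) - E * (R * R)) * y := by
    rw [← key, mul_assoc, hy, mul_one]
  rw [h3]
  refine J.mul_mem_right _ (J.sub_mem (J.mul_mem_left _ ?_) (J.mul_mem_left _ hR))
  have h4 : R * S * (R * S) = S * (R * R) * S := by rw [← hRS]; simp only [mul_assoc]; rw [hRS]
  rw [h4]
  exact J.mul_mem_right _ (J.mul_mem_left _ hR)

-- The relation reads `R₁ F₀ = (F₁ - R₁ A) R₀`. Inserting `1 = F₀² + R₀²` into `R₁² · 1` exhibits
-- `R₁²` as a left combination of `F₀ R₀` and `R₀²`.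
omit [J.IsTwoSided] in
lemma sq_mem_of_relation (h₀ : IsTransformPair (F₀ : H →L[ℂ] H) R₀)
    (hrel : F₁ * R₀ - R₁ * F₀ = R₁ * A * R₀) (hFR : F₀ * R₀ ∈ J) (hRR : R₀ * R₀ ∈ J) :
    R₁ * R₁ ∈ J := by
  have h1 : F₀ * F₀ + R₀ * R₀ = 1 := Subtype.ext h₀.sq_add_sq
  have h2 : R₀ * F₀ = F₀ * R₀ := Subtype.ext h₀.commute.symm
  have h3 : R₁ * F₀ = (F₁ - R₁ * A) * R₀ := by
    rw [sub_mul, ← hrel]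
    abel
  have h4 : R₁ * R₁ = R₁ * (F₁ - R₁ * A) * (F₀ * R₀) + R₁ * R₁ * (R₀ * R₀) := by
    calc R₁ * R₁ = R₁ * R₁ * (F₀ * F₀ + R₀ * R₀) := by rw [h1, mul_one]
      _ = R₁ * (R₁ * F₀) * F₀ + R₁ * R₁ * (R₀ * R₀) := by noncomm_ring
      _ = _ := by rw [h3, ← h2]; noncomm_ring
  rw [h4]
  exact J.add_mem (J.mul_mem_left _ hFR) (J.mul_mem_left _ hRR)

/-- Bounded transforms of perturbations agree modulo `J`. -/
theorem sub_mem_of_relation [hJ : IsClosed (J : Set (Elts N))]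
    (h₀ : IsTransformPair (F₀ : H →L[ℂ] H) R₀) (h₁ : IsTransformPair (F₁ : H →L[ℂ] H) R₁)
    (hrel : F₁ * R₀ - R₁ * F₀ = R₁ * A * R₀) (hRR₀ : R₀ * R₀ ∈ J) (hRR₁ : R₁ * R₁ ∈ J) :
    F₁ - F₀ ∈ J := by
  have hrel' : (F₁ : H →L[ℂ] H) * R₀ - R₁ * F₀ = R₁ * A * R₀ := congrArg Subtype.val hrel
  have hcl : F₁ - F₀ ∈ closure (J : Set (Elts N)) := by
    rw [Metric.mem_closure_iff]
    intro δ hδ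
    -- With this scale the transforms of `ε D` and `ε (D + A)` differ by at most `ε ‖A‖ < δ`, while
    -- `F₁` and `F₀` differ from them by elements of `J`.
    set ε := min 1 (δ / (‖(A : H →L[ℂ] H)‖ + 1)) with hεdef
    have hε : 0 < ε := lt_min one_pos (by positivity)
    have hε1 : ε ≤ 1 := min_le_left _ _
    have hb := h₀.norm_scale_sub_le h₁ hrel' hε hε1
    refine ⟨(F₁ - (ε : ℂ) • (F₁ * scaleElt ε R₁)) - (F₀ - (ε : ℂ) • (F₀ * scaleElt ε R₀)),
      J.sub_mem (sub_scale_mem h₁ hRR₁ hε hε1) (sub_scale_mem h₀ hRR₀ hε hε1), ?_⟩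
    rw [dist_eq_norm]
    have e : F₁ - F₀ - ((F₁ - (ε : ℂ) • (F₁ * scaleElt ε R₁)) -
        (F₀ - (ε : ℂ) • (F₀ * scaleElt ε R₀))) =
        (ε : ℂ) • (F₁ * scaleElt ε R₁) - (ε : ℂ) • (F₀ * scaleElt ε R₀) := by abel
    rw [e]
    refine lt_of_le_of_lt hb ?_
    have h2 : ε * (‖(A : H →L[ℂ] H)‖ + 1) ≤ δ := by
      rw [← le_div_iff₀ (by positivity)]
      exact min_le_right _ _
    linarith
  rwa [hJ.closure_eq] at hcl

end IdealPerturbation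
end VNSpectralFlow

namespace VNSpectralFlow

/-! ### Spectral projections modulo `J` -/

section Chi

variable {H : Type*} [NormedAddCommGroup H] [InnerProductSpace ℂ H] [CompleteSpace H]

/-- `χ(B)` is the projection onto the kernel of the negative part, so it fixes the positive part and
annihilates the negative one. Hence `2 χ(B) - 1` is a sign of `B`, equal to `1` on the kernel of
`B`. -/
lemma chiOp_abs {B : H →L[ℂ] H} (hB : IsSelfAdjoint B) :
    (2 * chiOp B - 1) * cfc (fun x : ℝ => |x|) B = B := by
  set P := cfc (fun x : ℝ => max x 0) B with hP
  set M := cfc (fun x : ℝ => max (-x) 0) B with hM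
  have h1 : cfc (fun x : ℝ => |x|) B = P + M := by
    rw [hP, hM, ← cfc_add B _ _ (by fun_prop) (by fun_prop)]
    congr 1
    ext x
    rcases le_total 0 x with h | h
    · rw [abs_of_nonneg h, max_eq_left h, max_eq_right (by linarith), add_zero]
    · rw [abs_of_nonpos h, max_eq_right h, max_eq_left (by linarith), zero_add]
  have h2 : B = P - M := by
    rw [hP, hM, ← cfc_sub _ _ B (by fun_prop) (by fun_prop)]
    conv_lhs => rw [← cfc_id' ℝ B]
    congr 1
    ext x
    rcases le_total 0 x with h | h
    · rw [max_eq_left h, max_eq_right (by linarith), sub_zero]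
    · rw [max_eq_right h, max_eq_left (by linarith), zero_sub, neg_neg]
  have h3 : M * P = 0 := by
    rw [hP, hM, ← cfc_mul _ _ B (by fun_prop) (by fun_prop), ← cfc_zero ℝ B]
    congr 1
    ext x
    rcases le_total 0 x with h | h
    · rw [max_eq_right (by linarith : -x ≤ 0), zero_mul, Pi.zero_apply]
    · rw [max_eq_right h, mul_zero, Pi.zero_apply]
  have hMsa : IsSelfAdjoint M := cfc_predicate _ B
  have h4 : chiOp B * P = P := kerProj_mul_eq_self h3
  have h5 : chiOp B * M = 0 := by
    have := congrArg star (mul_kerProj M)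
    rwa [star_mul, hMsa.star_eq, (isStarProjection_kerProj M).isSelfAdjoint.star_eq,
      star_zero] at this
  rw [h1, sub_mul, one_mul, mul_assoc, mul_add, h4, h5, add_zero, two_mul]
  conv_rhs => rw [h2]
  abel

lemma abs_mul_abs {B : H →L[ℂ] H} (hB : IsSelfAdjoint B) :
    cfc (fun x : ℝ => |x|) B * cfc (fun x : ℝ => |x|) B = B * B := by
  rw [← cfc_mul _ _ B (by fun_prop) (by fun_prop)]
  conv_rhs => rw [← cfc_id' ℝ B, ← cfc_mul _ _ B (by fun_prop) (by fun_prop)]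
  congr 1
  ext x
  exact abs_mul_abs_self x

lemma kerProj_conj {S U : H →L[ℂ] H} (hU : U ∈ unitary (H →L[ℂ] H)) :
    kerProj (star U * S * U) = star U * kerProj S * U := by
  have hp := isStarProjection_kerProj S
  refine kerProj_eq ⟨?_, ?_⟩ fun x => ?_
  · unfold IsIdempotentElem
    calc _ = star U * kerProj S * (U * star U) * kerProj S * U := by simp only [mul_assoc]
      _ = star U * (kerProj S * kerProj S) * U := by
        rw [Unitary.mul_star_self_of_mem hU]; simp only [mul_assoc, one_mul]
      _ = _ := by rw [hp.isIdempotentElem.eq]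
  · exact hp.isSelfAdjoint.conjugate' U
  · change star U (S (U x)) = 0 ↔ star U (kerProj S (U x)) = x
    constructor
    · intro h
      have h1 : S (U x) = 0 := unitary_star_cancel hU (by rw [h, map_zero])
      rw [kerProj_apply_eq_self_iff.2 h1, unitary_star_apply hU]
    · intro h
      have h1 : kerProj S (U x) = U x :=
        unitary_star_cancel hU (by rw [h, unitary_star_apply hU])
      rw [kerProj_apply_eq_self_iff.1 h1, map_zero]

lemma chiOp_conj {B U : H →L[ℂ] H} (hB : IsSelfAdjoint B) (hU : U ∈ unitary (H →L[ℂ] H)) :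
    chiOp (star U * B * U) = star U * chiOp B * U := by
  unfold chiOp
  rw [← kerProj_conj hU]
  congr 1
  have h := StarAlgHomClass.map_cfc (S := ℂ) (Unitary.conjStarAlgAut ℂ (H →L[ℂ] H) (star ⟨U, hU⟩))
    (fun t : ℝ => max (-t) 0) B (by fun_prop) (by
      have : Continuous fun X : H →L[ℂ] H => star U * X * star (star U) := by fun_prop
      exact this) hB (hB.map _)
  simp only [Unitary.conjStarAlgAut_apply, Unitary.coe_star, star_star] at h
  exact h.symm

variable {N : VonNeumannAlgebra H} {J : Ideal (Elts N)} [J.IsTwoSided]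

/-- `χ` is discontinuous, but `2 χ(B) - 1 - B = (2 χ(B) - 1)(1 - |B|)`, and `1 - |B| = (1 - B²)(1 +
|B|)⁻¹` is in `J`. -/
lemma two_chi_sub_mem {B : Elts N} (hB : IsSelfAdjoint B) (h : 1 - B * B ∈ J) :
    2 * chi B - 1 - B ∈ J := by
  have hB' : IsSelfAdjoint (B : H →L[ℂ] H) := congrArg Subtype.val hB
  set a : Elts N := ⟨cfc (fun x : ℝ => |x|) (B : H →L[ℂ] H), cfc_mem B.2 _⟩ with ha
  have h1 : (2 * chi B - 1) * a = B := Subtype.ext (chiOp_abs hB')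
  have h2 : a * a = B * B := Subtype.ext (abs_mul_abs hB')
  have h3 : 0 ≤ (a : H →L[ℂ] H) := cfc_nonneg fun x _ => abs_nonneg x
  obtain ⟨y, hy, -⟩ := exists_inv_of_isUnit (x := 1 + a) (isUnit_one_add h3)
  have h4 : (1 - a) * (1 + a) = 1 - B * B := by rw [← h2]; noncomm_ring
  have h5 : 1 - a = (1 - B * B) * y := by rw [← h4, mul_assoc, hy, mul_one]
  have h6 : 2 * chi B - 1 - B = (2 * chi B - 1) * (1 - a) := by rw [mul_sub, h1, mul_one]
  rw [h6, h5]
  exact J.mul_mem_left _ (J.mul_mem_right _ h)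

omit [J.IsTwoSided] in
lemma mem_of_two_mul_mem {x : Elts N} (h : 2 * x ∈ J) : x ∈ J := by
  have h1 : x = ((2⁻¹ : ℂ) • (1 : Elts N)) * (2 * x) := by
    rw [smul_mul_assoc, one_mul, two_mul, ← two_smul ℂ x, smul_smul]
    norm_num
  rw [h1]
  exact J.mul_mem_left _ h

lemma chi_sub_mem {B B' : Elts N} (hB : IsSelfAdjoint B) (h : 1 - B * B ∈ J)
    (hB' : IsSelfAdjoint B') (h' : 1 - B' * B' ∈ J) (hBB' : B - B' ∈ J) : chi B - chi B' ∈ J := by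
  refine mem_of_two_mul_mem ?_
  have e : 2 * (chi B - chi B') =
      (2 * chi B - 1 - B) - (2 * chi B' - 1 - B') + (B - B') := by noncomm_ring
  rw [e]
  exact J.add_mem (J.sub_mem (two_chi_sub_mem hB h) (two_chi_sub_mem hB' h')) hBB'

/-- This identifies `p` and `p_F` modulo `J`, so both compressions of `U` define the same element of
the quotient. -/
lemma chi_sub_half_mem {B : Elts N} (hB : IsSelfAdjoint B) (h : 1 - B * B ∈ J) :
    chi B - (2⁻¹ : ℂ) • (B + 1) ∈ J := by
  refine mem_of_two_mul_mem ?_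
  have e : 2 * (chi B - (2⁻¹ : ℂ) • (B + 1)) = 2 * chi B - 1 - B := by
    rw [mul_sub, two_mul ((2⁻¹ : ℂ) • (B + 1)), ← two_smul ℂ ((2⁻¹ : ℂ) • (B + 1)), smul_smul,
      mul_inv_cancel₀ two_ne_zero, one_smul]
    abel
  rw [e]
  exact two_chi_sub_mem hB h

lemma isUnit_mk_of_one_sub_sq_mem {B : Elts N} (h : 1 - B * B ∈ J) :
    IsUnit (Ideal.Quotient.mk J B) := by
  have h1 : Ideal.Quotient.mk J B * Ideal.Quotient.mk J B = 1 := by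
    rw [← map_mul, ← map_one (Ideal.Quotient.mk J)]
    exact (Ideal.Quotient.eq.2 h).symm
  exact ⟨⟨_, _, h1, h1⟩, rfl⟩

lemma chi_conj {B U : Elts N} (hB : IsSelfAdjoint B) (hU : U ∈ unitary (Elts N)) :
    chi (star U * B * U) = star U * chi B * U :=
  Subtype.ext (chiOp_conj (congrArg Subtype.val hB)
    ⟨congrArg Subtype.val hU.1, congrArg Subtype.val hU.2⟩)

/-- All spectral projections have the same image in the quotient, so already the partition `0 < 1`
is admissible. -/
lemma nonempty_admissiblePartition {B : unitInterval → Elts N}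
    (h : ∀ s t, chi (B s) - chi (B t) ∈ J) : Nonempty (AdmissiblePartition J B) := by
  refine ⟨⟨1, ![0, 1], ?_, rfl, rfl, fun i r _ s _ => ?_⟩⟩
  · intro i j hij
    fin_cases i <;> fin_cases j
    · exact absurd hij (lt_irrefl _)
    · exact zero_lt_one
    · exact absurd hij (by decide)
    · exact absurd hij (lt_irrefl _)
  · rw [Ideal.Quotient.eq.2 (h r s), sub_self, norm_zero]
    norm_num

end Chi
end VNSpectralFlow

namespace VNSpectralFlow

/-! ### Resolvents at `±i` in terms of the bounded transform -/

section Resolvent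

variable {H : Type*} [NormedAddCommGroup H] [InnerProductSpace ℂ H] [CompleteSpace H]
  {N : VonNeumannAlgebra H}

/-- For `z² = -1` one has `(z - D)(z + D) = -(1 + D²)`, so `(z - D)⁻¹ = -(D + z)(1 + D²)⁻¹`, where
`D (1 + D²)⁻¹ = F R` and `(1 + D²)⁻¹ = R²`. -/
lemma IsTransform.isResolvent {D : H →ₗ.[ℂ] H} {F R : H →L[ℂ] H} (h : IsTransform D F R) {z : ℂ}
    (hz : z * z = -1) : IsResolvent D z (-(F * R + z • (R * R))) := by
  have hcomm : ∀ x, F (R x) = R (F x) := fun x => congrArg (fun T : H →L[ℂ] H => T x) h.commute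
  have hsq : ∀ x, F (F x) + R (R x) = x := fun x => congrArg (fun T : H →L[ℂ] H => T x) h.sq_add_sq
  constructor
  · intro x
    have hg := h.mem_graph (-(F x + z • R x))
    obtain ⟨a, ha, hb⟩ := (LinearPMap.mem_graph_iff _).1 hg
    have hv : (-(F * R + z • (R * R)) : H →L[ℂ] H) x = R (-(F x + z • R x)) := by
      change -(F (R x) + z • R (R x)) = _
      rw [hcomm, map_neg, map_add, map_smul]
    have ha' : (a : H) = (-(F * R + z • (R * R)) : H →L[ℂ] H) x := (show (a : H) = _ from ha).trans hv.symm
    refine ⟨ha' ▸ a.2, ?_⟩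
    have hD : D ⟨(-(F * R + z • (R * R)) : H →L[ℂ] H) x, ha' ▸ a.2⟩ = F (-(F x + z • R x)) := by
      rw [← show D a = F (-(F x + z • R x)) from hb]
      congr 1
      exact Subtype.ext ha'.symm
    rw [hD, hv, map_neg, map_neg, map_add, map_add, map_smul, map_smul, hcomm, smul_neg, smul_add,
      smul_smul, hz]
    conv_rhs => rw [← hsq x]
    module
  · intro x
    have hy : R (D x) = F x := h.apply_eq _ _ (D.mem_graph x)
    change -(F (R (z • (x : H) - D x)) + z • R (R (z • (x : H) - D x))) = x
    rw [map_sub, hy, map_smul, map_sub, map_sub, map_smul, map_smul, smul_sub, smul_smul, hz, hcomm]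
    conv_rhs => rw [← hsq x]
    module

lemma exists_transform {D : H →ₗ.[ℂ] H} (hD : IsSelfAdjoint D) (hN : IsAffiliated D N) :
    ∃ F R : Elts N, (F : H →L[ℂ] H) = boundedTransform D hD ∧ IsTransform D F R := by
  refine ⟨⟨_, boundedTransform_mem hD hN⟩, ⟨invSqrtOneAddSq D hD, ?_⟩, rfl,
    isTransform_boundedTransform D hD⟩
  rw [← SetLike.mem_coe, VonNeumannAlgebra.coe_toStarSubalgebra, SetLike.mem_coe,
    ← VonNeumannAlgebra.commutant_commutant N, VonNeumannAlgebra.mem_commutant_iff]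
  intro y hy
  unfold invSqrtOneAddSq
  rw [CFC.sqrt_eq_real_sqrt _ (invOneAddSq_nonneg D hD)]
  exact ((invOneAddSq_commute hD hN hy).cfcₙ_real _).symm

omit [CompleteSpace H] in
lemma add_toPMap_add (D : H →ₗ.[ℂ] H) (A B : H →L[ℂ] H) :
    D + LinearMap.toPMap (A : H →ₗ[ℂ] H) ⊤ + LinearMap.toPMap (B : H →ₗ[ℂ] H) ⊤ =
      D + LinearMap.toPMap ((A + B : H →L[ℂ] H) : H →ₗ[ℂ] H) ⊤ := by
  refine LinearPMap.eq_of_eq_graph ?_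
  ext ⟨x, y⟩
  rw [mem_graph_add_toPMap, mem_graph_add_toPMap, mem_graph_add_toPMap, sub_sub, add_apply,
    add_comm (B x)]

end Resolvent

/-! ### Consequences of the spectral triple axioms -/

section Triple

variable {H : Type*} [NormedAddCommGroup H] [InnerProductSpace ℂ H] [CompleteSpace H]
  {N : VonNeumannAlgebra H} {J : Ideal (Elts N)}
  {𝒜 : Type*} [NonUnitalRing 𝒜] [StarRing 𝒜] [Module ℂ 𝒜] (T : VNSpectralTriple 𝒜 N J)

lemma VNSpectralTriple.resolvent_mem_of_isUnital (hT : T.IsUnital) {z : ℂ} (hz : z.im ≠ 0)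
    {R : Elts N} (hR : IsResolvent T.D z (R : H →L[ℂ] H)) : R ∈ J := by
  obtain ⟨e, he⟩ := hT
  obtain ⟨j, hj, hj'⟩ := T.resolvent_mem z hz R hR e
  rw [he] at hj'
  have : j = R := Subtype.ext (hj'.trans (one_mul _))
  rwa [← this]

/-- Unitality puts the resolvents at `i` and `-i` themselves in `J`; their sum and difference
isolate `F R` and `R²`. -/
lemma VNSpectralTriple.exists_transform_mem (hT : T.IsUnital) :
    ∃ R : Elts N, IsTransform T.D (T.F : H →L[ℂ] H) R ∧ T.F * R ∈ J ∧ R * R ∈ J := by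
  obtain ⟨F, R, hF, hFR⟩ := exists_transform T.selfAdjoint T.affiliated
  have hF' : F = T.F := Subtype.ext hF
  rw [hF'] at hFR
  have h1 : -(T.F * R + Complex.I • (R * R)) ∈ J :=
    T.resolvent_mem_of_isUnital hT (z := Complex.I) (by simp)
      (hFR.isResolvent Complex.I_mul_I)
  have h2 : -(T.F * R + (-Complex.I) • (R * R)) ∈ J :=
    T.resolvent_mem_of_isUnital hT (z := -Complex.I) (by simp)
      (hFR.isResolvent (by rw [neg_mul_neg, Complex.I_mul_I]))
  refine ⟨R, hFR, mem_of_two_mul_mem ?_, mem_of_two_mul_mem ?_⟩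
  · have e : 2 * (T.F * R) = -(-(T.F * R + Complex.I • (R * R)) +
        -(T.F * R + (-Complex.I) • (R * R))) := by
      rw [two_mul, neg_smul]
      abel
    rw [e]
    exact neg_mem (J.add_mem h1 h2)
  · have e : 2 * (R * R) = (Complex.I • (1 : Elts N)) * (-(T.F * R + Complex.I • (R * R)) -
        -(T.F * R + (-Complex.I) • (R * R))) := by
      rw [smul_mul_assoc, one_mul, two_mul, neg_smul]
      have : -(T.F * R + Complex.I • (R * R)) - -(T.F * R + -(Complex.I • (R * R))) =
        (-(2 * Complex.I)) • (R * R) := by module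
      rw [this, smul_smul, ← two_smul ℂ (R * R)]
      congr 1
      linear_combination 2 * Complex.I_mul_I
    rw [e]
    exact J.mul_mem_left _ (J.sub_mem h1 h2)

lemma VNSpectralTriple.exists_conjPerturbation {u : 𝒜} (hu : T.rep u ∈ unitary (Elts N)) :
    ∃ A : Elts N, IsSelfAdjoint A ∧
      IsConjPerturbation T.D (T.rep u : H →L[ℂ] H) (A : H →L[ℂ] H) := by
  have hU : (T.rep u : H →L[ℂ] H) ∈ unitary (H →L[ℂ] H) :=
    ⟨congrArg Subtype.val hu.1, congrArg Subtype.val hu.2⟩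
  obtain ⟨C, hC⟩ := T.bounded_commutator u
  have h2 : ∀ x : T.D.domain, star (T.rep u : H →L[ℂ] H) x ∈ T.D.domain := by
    intro x
    have := T.mem_domain (star u) x
    rwa [map_star] at this
  have hA := isConjPerturbation_of_commutator hU (T.mem_domain u) h2 hC
  have hTr := isTransform_boundedTransform T.D T.selfAdjoint
  exact ⟨⟨_, hA.mem hU (T.rep u).2 T.affiliated hTr⟩,
    Subtype.ext (hA.isSelfAdjoint T.selfAdjoint hU hTr), hA⟩

end Triple

end VNSpectralFlow

namespace VNSpectralFlow

/-! ### The path of bounded transforms: continuity, constancy modulo `J`, endpoints -/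

section Path

variable {H : Type*} [NormedAddCommGroup H] [InnerProductSpace ℂ H] [CompleteSpace H]
  {N : VonNeumannAlgebra H} {J : Ideal (Elts N)}
  {D : H →ₗ.[ℂ] H} {Dt : unitInterval → H →ₗ.[ℂ] H} {F R A U : Elts N}
  {B Rt : unitInterval → Elts N}

lemma norm_transform_sub_le
    (hDt : ∀ t, Dt t = D + LinearMap.toPMap ((((t : ℝ) : ℂ) • (A : H →L[ℂ] H) : H →L[ℂ] H) :
      H →ₗ[ℂ] H) ⊤)
    (hB : ∀ t, IsTransform (Dt t) (B t : H →L[ℂ] H) (Rt t)) (s t : unitInterval) :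
    ‖B t - B s‖ ≤ ‖A‖ * dist t s := by
  -- Between two times the perturbation is `(t - s) A`, so the estimate for transform pairs becomes
  -- a Lipschitz bound in `t`.
  have hD : Dt t = Dt s + LinearMap.toPMap
      (((((t : ℝ) - (s : ℝ) : ℝ) : ℂ) • (A : H →L[ℂ] H) : H →L[ℂ] H) : H →ₗ[ℂ] H) ⊤ := by
    rw [hDt, hDt, add_toPMap_add, ← add_smul, ← Complex.ofReal_add, add_sub_cancel]
  have h := (hB s).norm_sub_le (hB t).toIsTransformPair ((hB s).relation (hB t) hD)
  rw [norm_smul, Complex.norm_real, mul_comm] at h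
  exact h

lemma continuous_of_isTransform
    (hDt : ∀ t, Dt t = D + LinearMap.toPMap ((((t : ℝ) : ℂ) • (A : H →L[ℂ] H) : H →L[ℂ] H) :
      H →ₗ[ℂ] H) ⊤)
    (hB : ∀ t, IsTransform (Dt t) (B t : H →L[ℂ] H) (Rt t)) : Continuous B := by
  refine (LipschitzWith.of_dist_le_mul (K := ‖A‖₊) fun s t => ?_).continuous
  rw [dist_eq_norm]
  exact norm_transform_sub_le hDt hB t s

/-- Bounded transforms of `D` and of `D + A` agree modulo `J` if `(1 + D²)^{-1}` and
`D (1 + D²)^{-1}` are in `J`. -/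
lemma transform_sub_mem [J.IsTwoSided] [IsClosed (J : Set (Elts N))] {D' : H →ₗ.[ℂ] H}
    {F' R' : Elts N} (hF : IsTransform D (F : H →L[ℂ] H) R) (hFR : F * R ∈ J) (hRR : R * R ∈ J)
    (hF' : IsTransform D' (F' : H →L[ℂ] H) R')
    (hD' : D' = D + LinearMap.toPMap ((A : H →L[ℂ] H) : H →ₗ[ℂ] H) ⊤) :
    F' - F ∈ J ∧ 1 - F' * F' ∈ J := by
  have hrel : F' * R - R' * F = R' * A * R := Subtype.ext (hF.relation hF' hD')
  have hRR' := sq_mem_of_relation hF.toIsTransformPair hrel hFR hRR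
  refine ⟨sub_mem_of_relation hF.toIsTransformPair hF'.toIsTransformPair hrel hRR hRR', ?_⟩
  have h1 : F' * F' + R' * R' = 1 := Subtype.ext hF'.sq_add_sq
  rwa [← h1, add_sub_cancel_left]

lemma transform_zero_eq (hF : IsTransform D (F : H →L[ℂ] H) R)
    (hDt : ∀ t, Dt t = D + LinearMap.toPMap ((((t : ℝ) : ℂ) • (A : H →L[ℂ] H) : H →L[ℂ] H) :
      H →ₗ[ℂ] H) ⊤)
    (hB : ∀ t, IsTransform (Dt t) (B t : H →L[ℂ] H) (Rt t)) : B 0 = F := by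
  have h := hF.norm_sub_le (hB 0).toIsTransformPair (hF.relation (hB 0) (hDt 0))
  rw [Set.Icc.coe_zero, Complex.ofReal_zero, zero_smul, norm_zero] at h
  exact Subtype.ext (sub_eq_zero.1 (norm_le_zero_iff.1 h))

lemma transform_one_eq (hU : U ∈ unitary (Elts N)) (hF : IsTransform D (F : H →L[ℂ] H) R)
    (hA : IsConjPerturbation D (U : H →L[ℂ] H) A)
    (hDt : ∀ t, Dt t = D + LinearMap.toPMap ((((t : ℝ) : ℂ) • (A : H →L[ℂ] H) : H →L[ℂ] H) :
      H →ₗ[ℂ] H) ⊤)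
    (hB : ∀ t, IsTransform (Dt t) (B t : H →L[ℂ] H) (Rt t)) : B 1 = star U * F * U := by
  have h1 := hB 1
  rw [hDt, Set.Icc.coe_one, Complex.ofReal_one, one_smul] at h1
  exact Subtype.ext ((hA.isTransform ⟨congrArg Subtype.val hU.1, congrArg Subtype.val hU.2⟩
    hF).eq_of_isTransform h1)

end Path

/-! ### The index theorem for a path in `N` that is constant modulo `J` -/

section SpectralFlow

variable {H : Type*} [NormedAddCommGroup H] [InnerProductSpace ℂ H] [CompleteSpace H]
  {N : VonNeumannAlgebra H} {J : Ideal (Elts N)} [J.IsTwoSided] [IsClosed (J : Set (Elts N))]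
  {F U : Elts N} {B : unitInterval → Elts N}

/-- A path of self-adjoint unitaries modulo `J` which is constant modulo `J` and joins `F` to
`U* F U` has spectral flow the boundary of the compression of `U`. -/
theorem hasSpectralFlow_of_sub_mem (hU : U ∈ unitary (Elts N)) (hBc : Continuous B)
    (hBsa : ∀ t, IsSelfAdjoint (B t)) (hB : ∀ t, B t - B 0 ∈ J) (hB2 : ∀ t, 1 - B t * B t ∈ J)
    (hB1 : B 1 = star U * B 0 * U) (hpU : chi (B 0) * U - U * chi (B 0) ∈ J)
    (a : (Elts N ⧸ J)ˣ) (ha : (a : Elts N ⧸ J) =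
      Ideal.Quotient.mk J (chi (B 0) * U * chi (B 0)) + Ideal.Quotient.mk J (1 - chi (B 0))) :
    HasSpectralFlow J B (boundary J (KOne.ofUnit a)) := by
  have hchi : ∀ t, chi (B t) - chi (B 0) ∈ J := fun t =>
    chi_sub_mem (hBsa t) (hB2 t) (hBsa 0) (hB2 0) (hB t)
  refine ⟨hBc, fun t => ⟨hBsa t, isUnit_mk_of_one_sub_sq_mem (hB2 t)⟩, ?_, fun P => ?_⟩
  · refine nonempty_admissiblePartition fun s t => ?_
    have := J.sub_mem (hchi s) (hchi t)
    rwa [sub_sub_sub_cancel_right] at this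
  · obtain ⟨W, h, hW, hidx⟩ := exists_index_eq_boundary (isStarProjection_chi (B 0)) hU hpU a ha
    have h1 : chi (B 1) = star U * chi (B 0) * U := by rw [hB1, chi_conj (hBsa 0) hU]
    refine Subtype.ext ?_
    rw [← hidx]
    have h2 : IsRelUnitary J (chi (B 0)) (chi (B 1)) W := h1 ▸ h
    rw [flow_eq_index hchi P h2 hW]
    congr 1

-- `F` and `U* F U` agree modulo `J`, hence so do their spectral projections `χ(F)` and `U* χ(F) U`;
-- multiply the difference by `U`.
omit [IsClosed (J : Set (Elts N))] in
lemma chi_commutator_mem (hU : U ∈ unitary (Elts N)) (hFsa : IsSelfAdjoint F)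
    (hF2 : 1 - F * F ∈ J) (hFU : star U * F * U - F ∈ J) : chi F * U - U * chi F ∈ J := by
  have hUU := Unitary.mul_star_self_of_mem hU
  have hUU' := Unitary.star_mul_self_of_mem hU
  have h2 : 1 - star U * F * U * (star U * F * U) ∈ J := by
    have e : 1 - star U * F * U * (star U * F * U) = star U * (1 - F * F) * U := by
      calc _ = star U * U - star U * F * (U * star U) * F * U := by
            rw [hUU']; simp only [mul_assoc]
        _ = _ := by rw [hUU]; noncomm_ring
    rw [e]
    exact J.mul_mem_right _ (J.mul_mem_left _ hF2)
  have h3 := chi_sub_mem (hFsa.conjugate' U) h2 hFsa hF2 hFU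
  rw [chi_conj hFsa hU] at h3
  have e : chi F * U - U * chi F = U * (star U * chi F * U - chi F) := by
    rw [mul_sub, ← mul_assoc, ← mul_assoc, hUU, one_mul]
  rw [e]
  exact J.mul_mem_left _ h3

/-- The index theorem for a path of self-adjoint unitaries modulo `J` which is constant modulo `J`
and joins `F` to `U* F U`. -/
theorem exists_unit_spectralFlow {p pF : Elts N} (hU : U ∈ unitary (Elts N)) (hBc : Continuous B)
    (hBsa : ∀ t, IsSelfAdjoint (B t)) (hB0 : B 0 = F) (hB1 : B 1 = star U * F * U)
    (hB : ∀ t, B t - F ∈ J ∧ 1 - B t * B t ∈ J) (hp : p = chi F)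
    (hpF : pF = (2⁻¹ : ℂ) • (F + 1)) :
    ∃ (a : (Elts N ⧸ J)ˣ) (hFred : IsFredholm J p p (p * U * p)),
      (a : Elts N ⧸ J) = Ideal.Quotient.mk J (p * U * p) + Ideal.Quotient.mk J (1 - p) ∧
      (a : Elts N ⧸ J) = Ideal.Quotient.mk J (pF * U * pF + 1 - pF) ∧
      HasSpectralFlow J B (boundary J (KOne.ofUnit a)) ∧
      boundary J (KOne.ofUnit a) = fredholmIndex hFred := by
  subst hB0 hp hpF
  have hpU := chi_commutator_mem hU (hBsa 0) (hB 0).2 (hB1 ▸ (hB 1).1)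
  have hpp := isStarProjection_chi (B 0)
  obtain ⟨a, ha⟩ := exists_unit_compression hpp hU hpU
  refine ⟨a, isFredholm_compression hpp hU hpU, ha, ?_,
    hasSpectralFlow_of_sub_mem hU hBc hBsa (fun t => (hB t).1) (fun t => (hB t).2) hB1 hpU a ha,
    boundary_eq_fredholmIndex hpp hU hpU a ha _⟩
  -- Since `p` and `p_F` coincide modulo `J`, the unit obtained from `p` also represents `π(p_F U
  -- p_F + 1 - p_F)`.
  have hmk := Ideal.Quotient.eq.2 (chi_sub_half_mem (hBsa 0) (hB 0).2)
  rw [ha, add_sub_assoc, map_add, map_sub, map_sub, map_mul, map_mul, map_mul, map_mul, hmk]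

end SpectralFlow
-- The path from `D` to `u* D u` of a spectral triple
section ConjPath

variable {H : Type*} [NormedAddCommGroup H] [InnerProductSpace ℂ H] [CompleteSpace H]
  {N : VonNeumannAlgebra H} {J : Ideal (Elts N)} [J.IsTwoSided] [IsClosed (J : Set (Elts N))]
  {𝒜 : Type*} [NonUnitalRing 𝒜] [StarRing 𝒜] [Module ℂ 𝒜]

/-- The path `(1 - t) D + t u* D u` is a norm continuous bounded perturbation of `D`, and its
bounded transforms are a norm continuous path in `N` from `F` to `u* F u` that is constant
modulo `J`. -/
theorem VNSpectralTriple.exists_transform_path (T : VNSpectralTriple 𝒜 N J) (hT : T.IsUnital)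
    {u : 𝒜} (hu : T.rep u ∈ unitary (Elts N)) :
    ∃ (A B : unitInterval → Elts N)
      (hsa : ∀ t, IsSelfAdjoint (conjPath T.D (T.rep u : H →L[ℂ] H) t)),
      (Continuous A ∧ (∀ t, IsSelfAdjoint (A t)) ∧
        ∀ t, conjPath T.D (T.rep u : H →L[ℂ] H) t =
          T.D + LinearMap.toPMap ((A t : H →L[ℂ] H) : H →ₗ[ℂ] H) ⊤) ∧
      (∀ t, (B t : H →L[ℂ] H) = boundedTransform _ (hsa t)) ∧ Continuous B ∧
      (∀ t, IsSelfAdjoint (B t)) ∧ B 0 = T.F ∧ B 1 = star (T.rep u) * T.F * T.rep u ∧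
      ∀ t, B t - T.F ∈ J ∧ 1 - B t * B t ∈ J := by
  obtain ⟨R, hF, hFR, hRR⟩ := T.exists_transform_mem hT
  obtain ⟨A, hAsa, hA⟩ := T.exists_conjPerturbation hu
  set U := T.rep u
  have hU' : (U : H →L[ℂ] H) ∈ unitary (H →L[ℂ] H) :=
    ⟨congrArg Subtype.val hu.1, congrArg Subtype.val hu.2⟩
  have hDt : ∀ t : unitInterval, conjPath T.D (U : H →L[ℂ] H) t = T.D + LinearMap.toPMap
      ((((t : ℝ) : ℂ) • (A : H →L[ℂ] H) : H →L[ℂ] H) : H →ₗ[ℂ] H) ⊤ := hA.conjPath_eq hU'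
  have hAt : ∀ t : unitInterval, IsSelfAdjoint (((t : ℝ) : ℂ) • A) := fun t =>
    IsSelfAdjoint.smul (Complex.conj_ofReal _) hAsa
  have hsa : ∀ t, IsSelfAdjoint (conjPath T.D (U : H →L[ℂ] H) t) := fun t => by
    rw [hDt]
    exact add_toPMap_isSelfAdjoint T.selfAdjoint (congrArg Subtype.val (hAt t))
  have haff : ∀ t, IsAffiliated (conjPath T.D (U : H →L[ℂ] H) t) N := fun t => by
    rw [hDt]
    exact isAffiliated_add_toPMap T.affiliated (((t : ℝ) : ℂ) • A).2
  choose B Rt hBt hB using fun t => exists_transform (hsa t) (haff t)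
  refine ⟨fun t => ((t : ℝ) : ℂ) • A, B, hsa, ⟨?_, hAt, hDt⟩, hBt,
    continuous_of_isTransform hDt hB, fun t => Subtype.ext (hB t).selfAdjoint,
    transform_zero_eq hF hDt hB, transform_one_eq hu hF hA hDt hB, fun t =>
    transform_sub_mem (A := ((t : ℝ) : ℂ) • A) hF hFR hRR (hB t) (hDt t)⟩
  exact Continuous.smul (Complex.continuous_ofReal.comp continuous_subtype_val) continuous_const

end ConjPath
end VNSpectralFlow

open VNSpectralFlow
set_option maxHeartbeats 1000000 in
theorem mainTheorem5 {H : Type*} [NormedAddCommGroup H] [InnerProductSpace ℂ H] [CompleteSpace H]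
    (N : VonNeumannAlgebra H) (J : Ideal (Elts N)) [J.IsTwoSided] [IsClosed (J : Set (Elts N))]
    {𝒜 : Type*} [NonUnitalRing 𝒜] [StarRing 𝒜] [Module ℂ 𝒜]
    (T : VNSpectralTriple 𝒜 N J) (hT : T.IsUnital)
    (u : 𝒜) (hu : T.rep u ∈ unitary (Elts N))
    (U p pF : Elts N) (hU : U = T.rep u) (hp : p = chi T.F)
    (hpF : pF = (2⁻¹ : ℂ) • (T.F + 1)) :
    ∃ (a b : (Elts N ⧸ J)ˣ) (hFred : IsFredholm J p p (p * U * p)),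
      (a : Elts N ⧸ J) = Ideal.Quotient.mk J (p * U * p) + Ideal.Quotient.mk J (1 - p) ∧
      (b : Elts N ⧸ J) = Ideal.Quotient.mk J (pF * U * pF + 1 - pF) ∧
      HasUnboundedSpectralFlow J T.D (conjPath T.D U) (boundary J (KOne.ofUnit a)) ∧
      boundary J (KOne.ofUnit a) = fredholmIndex hFred ∧
      boundary J (KOne.ofUnit a) = boundary J (KOne.ofUnit b) := by
  obtain ⟨A, B, hsa, hA, hBt, hBc, hBsa, hB0, hB1, hJ⟩ := T.exists_transform_path hT hu
  subst hU
  obtain ⟨a, hFred, ha, hb, hflow, hidx⟩ :=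
    exists_unit_spectralFlow hu hBc hBsa hB0 hB1 hJ hp hpF
  -- One unit serves for both classes, so the last equality of boundaries is trivial.
  exact ⟨a, a, hFred, ha, hb, ⟨⟨A, hA⟩, hsa, B, hBt, hflow⟩, hidx, rfl⟩
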